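/- Let $\Gamma\subset\mathbb R^2$ be a simple closed convex $C^\infty$ curve with outward unit normal $n$, let $\kappa\in(2,\infty)$, and suppose that the curvature of $\Gamma$ vanishes at only finitely many points, at each of them to an order at most $\kappa-2$. Here the curvature vanishes at $z\in\Gamma$ to order $m>0$ if, in suitable orthonormal coordinates $(x,y)$ centred at $z$, $\Gamma$ is near $z$ the graph $y=|x|^{m+2}g(x)$, $|x|<r$, for some $r>0$ and some $g\in C^\infty([-r,r])$ without zeros. For $\varepsilon>0$ let $T_\varepsilon=\{x\in\mathbb R^2:\operatorname{dist}(x,\Gamma)\le\varepsilon\}$. Let $\rho>0$ be such that every point of $T_\rho$ has a unique closest point on $\Gamma$ and $\rho$ times the curvature of $\Gamma$ is everywhere less than $1$. On $T_\rho$ let $P_\Gamma$ be the closest point projection, $d_\Gamma(x)=n(P_\Gamma x)\cdot(x-P_\Gamma x)$ the signed distance, and $J(x)=1-d_\Gamma(x)\,c(x)$, where $c(x)$ is the signed curvature at $x$ of the level curve of $d_\Gamma$ through $x$ (with the sign for which a convex curve has nonnegative curvature). Let $q\ge 0$ be an integer and let $\theta:\mathbb R\to\mathbb R$ be a weight function of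 regularity order $q$: $\operatorname{supp}\theta=[-1,1]$, $\int_{-1}^1\theta=1$, $\theta\in C^{q-1}(\mathbb R)$ if $q\ge1$, and $\theta^{(q)}$ is piecewise $C^1$ (finitely many pieces, $C^1$ up to the end points of each piece). Put $\theta_\varepsilon(s)=\varepsilon^{-1}\theta(\varepsilon^{-1}s)$. For $f\in C^\infty(\Gamma)$ let $$\mathcal I(f)=\int_\Gamma f\,d\sigma,\qquad \mathcal I_h(f)=h^2\sum_{x\in(h\mathbb Z)^2\cap T_\varepsilon}f(P_\Gamma x)\,\theta_\varepsilon(d_\Gamma(x))\,J(x),$$ where $\sigma$ is arc length. For $\eta\in\mathrm{SO}(2)$ and $\xi\in[0,1]^2$ let $\mathcal I_h(f;\eta,\xi)$ be the same quadrature for the transformed curve $\eta\Gamma+h\xi$ and the transported function $y\mapsto f(\eta^{-1}(y-h\xi))$. Let $\alpha\in[0,1]$ and let the tube width $\varepsilon=\varepsilon(h)$ satisfy $\varepsilon=\Theta(h^\alpha)$ as $h\to0^+$ and $0<\varepsilon(h)\le\rho$ for all sufficiently small $h>0$. Then, for all sufficiently small $h>0$, the squared error $|\mathcal I_h(f;\eta,\xi)-\mathcal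 I(f)|^2$ is integrable over $(\xi,\eta)\in[0,1]^2\times\mathrm{SO}(2)$, and $$\int_{[0,1]^2}\int_{\mathrm{SO}(2)}\bigl|\mathcal I_h(f;\eta,\xi)-\mathcal I(f)\bigr|^2\,d\eta\,d\xi=O\bigl(h^{1+2(q+1)(1-\alpha)}\bigr)\qquad(h\to0^+),$$ where $d\eta$ is the normalized Haar measure on $\mathrm{SO}(2)$. -/

import Mathlib

open Set Filter Topology MeasureTheory Asymptotics
open scoped ContDiff

noncomputable section

/-- The Euclidean plane. -/
abbrev Plane : Type := EuclideanSpace ℝ (Fin 2)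

/-- The rotation group of the plane. -/
abbrev SO2 : Type := Matrix.specialOrthogonalGroup (Fin 2) ℝ

/-- The planar cross product (determinant) of two vectors. -/
def cross (u v : Plane) : ℝ := u 0 * v 1 - u 1 * v 0

/-! ### Closed curves -/

/-- The signed curvature `(x' y'' - y' x'') / |γ'|³` of a parametrized plane curve. It is nonnegative
for counterclockwise convex curves. -/
def curvature (γ : ℝ → Plane) (t : ℝ) : ℝ :=
  cross (deriv γ t) (deriv (deriv γ) t) / ‖deriv γ t‖ ^ 3

/-- The unit normal to the right of the tangent; it is the outward normal of a counterclockwise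
simple closed curve. -/
def outwardNormal (γ : ℝ → Plane) (t : ℝ) : Plane :=
  ‖deriv γ t‖⁻¹ • !₂[deriv γ t 1, -(deriv γ t 0)]

/-- The curve at signed distance `s` from `γ`, that is the level curve `{d_Γ = s}`. -/
def parallelCurve (γ : ℝ → Plane) (s : ℝ) : ℝ → Plane := fun t => γ t + s • outwardNormal γ t

/-- `γ` is a regular counterclockwise `T`-periodic parametrization of a simple closed convex smooth
curve. Convexity: the curve lies on one side of each of its tangent lines; that it is the left side
says that the curve is run through counterclockwise. -/
structure IsConvexClosedCurve (γ : ℝ → Plane) (T : ℝ) : Prop where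
  smooth : ContDiff ℝ ∞ γ
  period_pos : 0 < T
  periodic : Function.Periodic γ T
  regular : ∀ t, deriv γ t ≠ 0
  simple : InjOn γ (Ico 0 T)
  convex : ∀ s t, 0 ≤ cross (deriv γ t) (γ s - γ t)

/-- The curvature of the curve `Γ` vanishes at its point `z` to the order `m = k - 2`, where `k > 2`:
in the coordinates `(x, y)` of some orthonormal frame `e₁, e₂` with origin at `z`, the part of `Γ`
near `z` is a graph `y = |x| ^ k * h x`, where `h` is smooth on `[-r, r]` and has no zero there. -/
def CurvatureVanishesToOrder (Γ : Set Plane) (z : Plane) (m : ℝ) : Prop :=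
  0 < m ∧ ∃ (e₁ e₂ : Plane) (r : ℝ) (h : ℝ → ℝ) (U : Set Plane),
    ‖e₁‖ = 1 ∧ ‖e₂‖ = 1 ∧ inner ℝ e₁ e₂ = 0 ∧ 0 < r ∧
    ContDiffOn ℝ ∞ h (Icc (-r) r) ∧ (∀ x ∈ Icc (-r) r, h x ≠ 0) ∧
    IsOpen U ∧ z ∈ U ∧
    Γ ∩ U = (fun x : ℝ => z + x • e₁ + (|x| ^ (m + 2) * h x) • e₂) '' Ioo (-r) r

/-! ### Projection, signed distance and tube -/

/-- A parameter of a point of the curve that is closest to `x`. -/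
def footParam (γ : ℝ → Plane) (x : Plane) : ℝ :=
  Classical.epsilon fun t => dist x (γ t) = Metric.infDist x (range γ)

/-- The projection `P_Γ x`, a point of the curve closest to `x`. -/
def proj (γ : ℝ → Plane) (x : Plane) : Plane := γ (footParam γ x)

/-- The signed distance `d_Γ x = n (P_Γ x) · (x - P_Γ x)`. -/
def signedDistance (γ : ℝ → Plane) (x : Plane) : ℝ :=
  inner ℝ (outwardNormal γ (footParam γ x)) (x - proj γ x)

/-- The closed two-sided `ε`-tube around the curve. -/
def tube (γ : ℝ → Plane) (ε : ℝ) : Set Plane := {x | Metric.infDist x (range γ) ≤ ε}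

/-- The Jacobian `1 - d_Γ x * κ x`, where `κ x` is the signed curvature at `x` of the level curve of
the signed distance through `x`. -/
def jacobian (γ : ℝ → Plane) (x : Plane) : ℝ :=
  1 - signedDistance γ x * curvature (parallelCurve γ (signedDistance γ x)) (footParam γ x)

/-- `ρ` is an admissible tube width for `γ`: every point of the closed `ρ`-tube has exactly one
closest point on the curve, and the product of `ρ` and the curvature stays below `1`. -/
def IsTubeWidth (γ : ℝ → Plane) (ρ : ℝ) : Prop :=
  0 < ρ ∧
  (∀ x ∈ tube γ ρ, ∃! y, y ∈ range γ ∧ dist x y = Metric.infDist x (range γ)) ∧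
  ∀ t, ρ * curvature γ t < 1

/-! ### Weight functions -/

/-- A weight function of regularity order `q`: its support is `[-1, 1]`, its integral is `1`, it is of
class `C^(q-1)` (no condition if `q = 0`), and its `q`-th derivative is piecewise `C¹`. The last
condition says that, off finitely many break points, the function is of class `C^(q+1)` up to the
end points of each piece, i.e. on each piece it is the restriction of a `C^(q+1)` function on the
line. The values at the break points are free if `q = 0`. -/
structure IsWeight (q : ℕ) (θ : ℝ → ℝ) : Prop where
  support_eq : tsupport θ = Icc (-1) 1
  integral_eq : ∫ s in (-1 : ℝ)..1, θ s = 1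
  regular : ∀ m : ℕ, m < q → ContDiff ℝ m θ
  piecewise : ∃ S : Finset ℝ, ∀ a b : ℝ, a < b → Disjoint (S : Set ℝ) (Ioo a b) →
    ∃ G : ℝ → ℝ, ContDiff ℝ (q + 1 : ℕ) G ∧ EqOn θ G (Ioo a b)

/-- The scaled weight `θ_ε s = ε⁻¹ θ (ε⁻¹ s)`. -/
def scaledWeight (θ : ℝ → ℝ) (ε s : ℝ) : ℝ := ε⁻¹ * θ (ε⁻¹ * s)

/-! ### The boundary integral and its quadrature -/

/-- The integral of `f` over the closed curve with respect to arc length. -/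
def boundaryIntegral (γ : ℝ → Plane) (T : ℝ) (f : Plane → ℝ) : ℝ :=
  ∫ t in (0 : ℝ)..T, f (γ t) * ‖deriv γ t‖

/-- The integrand `f (P_Γ x) θ_ε (d_Γ x) J (x)`. -/
def tubeIntegrand (γ : ℝ → Plane) (f : Plane → ℝ) (θ : ℝ → ℝ) (ε : ℝ) (x : Plane) : ℝ :=
  f (proj γ x) * scaledWeight θ ε (signedDistance γ x) * jacobian γ x

/-- The point `h • w` of the lattice `(h ℤ)²`. -/
def latticePoint (h : ℝ) (w : Fin 2 → ℤ) : Plane := !₂[h * w 0, h * w 1]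

/-- The implicit boundary integral quadrature: `h²` times the sum of the integrand over the points of
`(h ℤ)²` in the tube. For `h > 0` only finitely many terms of the sum are nonzero. -/
def ibim (γ : ℝ → Plane) (f : Plane → ℝ) (θ : ℝ → ℝ) (ε h : ℝ) : ℝ :=
  h ^ 2 * ∑' w : Fin 2 → ℤ, (tube γ ε).indicator (tubeIntegrand γ f θ ε) (latticePoint h w)

/-! ### Random rigid motions -/

/-- The action of a rotation on the plane. -/
def rotate (η : SO2) (x : Plane) : Plane :=
  Matrix.toEuclideanLin (η : Matrix (Fin 2) (Fin 2) ℝ) x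

/-- The quadrature on the transformed curve `η Γ + h ξ`, with the integrand `f` carried along by the
rigid motion `x ↦ η x + h ξ`. -/
def ibimMoved (γ : ℝ → Plane) (f : Plane → ℝ) (θ : ℝ → ℝ) (ε h : ℝ) (η : SO2) (ξ : Plane) : ℝ :=
  ibim (fun t => rotate η (γ t) + h • ξ) (fun y => f (rotate η⁻¹ (y - h • ξ))) θ ε h

/-- The unit square `[0, 1]²`. -/
def unitSquare : Set Plane := {ξ | ∀ i, ξ i ∈ Icc (0 : ℝ) 1}

end

noncomputable section

/-! ### Smooth cut-offs -/

/-! Let F be the integrand extended by zero off the tube. As a function of the shift ξ the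
quadrature is a periodization of F, and its k-th Fourier coefficient is the Fourier transform of F
at 2πk/h (up to the rotation). The coefficient at k = 0 is ∫ F. In the coordinates x = γ(t) + s n(t)
the area element is |γ'|(1 + sκ) and J = 1/(1 + sκ), so the curvature factors cancel and ∫ F is
exactly the boundary integral. By Parseval the mean square error over ξ is the sum over k ≠ 0 of
|F̂(2πk/h)|² (`hasSum_sq_latticeSum`). Averaging over rotations turns each term into a mean over the
circle of radius R = 2π|k|/h (`integral_rotate_inv`, `integral_sq_latticeSum_rotate_le`).

Everything thus rests on the circular bound ∫ |F̂(R,φ)|² dφ ≤ C / (R (Rε)^(2(q+1))) of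
`exists_integral_sq_tubeFourier_le`. Split the curve smoothly according to the size of ν, the
component of the normal in the direction φ. Where |ν| is small the direction is nearly tangent, the
phase is nonstationary along the curve, and repeated integration by parts gives any power of 1/R
(`integral_nonstationary_le`). Where ν is bounded below, the integral across the tube is the Fourier
transform of θ at Rεν. By regularity of θ, q + 1 integrations by parts (`exists_fourier_repr`) give
the factor (Rε)^(-(q+1)), and leave oscillatory integrals over curves parallel to the boundary.

The remaining factor 1/R comes from averaging in φ, not from curvature (`exists_integral_sq_le`).
The square of such an integral is a double integral over t, t' with kernel ∫ exp(iR D·u(φ)) dφ,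
where u(φ) is the unit vector at angle φ and D is the secant between two points of the parallel
curve. On a short arc D is nearly tangent, so its component across u(φ) is nearly a multiple of ν
and is bounded below by a multiple of |t - t'| on the support of the amplitude. The kernel is then
O(1/(1 + R²|t - t'|²)) (`exists_circle_kernel_bound`), and a Schur test gains 1/R.

With this bound the k-th term is O(h (h/ε)^(2(q+1)) |k|^(-(2q+3))), which is summable over ℤ².
Substituting ε = Θ(h^α) gives the rate. The change of variables needs the tube coordinates to be
injective; `two_mul_inner_le` provides this by showing that inner tangent discs of radius ρ contain
no point of the curve in their interior. -/

theorem exists_contDiff_cutoff {a b : ℝ} (ha : 0 < a) (hab : a < b) :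
    ∃ B : ℝ → ℝ, ContDiff ℝ ∞ B ∧ (∀ x, |x| ≤ a → B x = 0) ∧ ∀ x, b ≤ |x| → B x = 1 := by
  have hd : 0 < b ^ 2 - a ^ 2 := by nlinarith
  refine ⟨fun x => Real.smoothTransition ((x ^ 2 - a ^ 2) / (b ^ 2 - a ^ 2)), ?_, ?_, ?_⟩
  · exact Real.smoothTransition.contDiff.comp (by fun_prop)
  · intro x hx
    apply Real.smoothTransition.zero_of_nonpos
    apply div_nonpos_of_nonpos_of_nonneg _ hd.le
    rw [← sq_abs x]
    nlinarith [abs_nonneg x]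
  · intro x hx
    apply Real.smoothTransition.one_of_one_le
    rw [le_div_iff₀ hd, ← sq_abs x]
    nlinarith [abs_nonneg x]

/-- A globally smooth substitute for 1/x. It allows division by a phase derivative wherever the
amplitude is supported, with no smoothness problem elsewhere. -/
theorem exists_contDiff_inv {c : ℝ} (hc : 0 < c) :
    ∃ ι : ℝ → ℝ, ContDiff ℝ ∞ ι ∧ ∀ x, c ≤ |x| → ι x * x = 1 := by
  obtain ⟨B, hB, hB0, hB1⟩ := exists_contDiff_cutoff (half_pos hc) (half_lt_self hc)
  refine ⟨fun x => B x / x, ?_, ?_⟩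
  · rw [contDiff_iff_contDiffAt]
    intro x
    by_cases hx : x = 0
    · subst hx
      have : (fun x => B x / x) =ᶠ[𝓝 0] fun _ => 0 := by
        filter_upwards [Metric.ball_mem_nhds (0 : ℝ) (half_pos hc)] with x hx
        rw [hB0 x (by simpa using (mem_ball_zero_iff.1 hx).le), zero_div]
      exact contDiffAt_const.congr_of_eventuallyEq this
    · exact hB.contDiffAt.div contDiffAt_id hx
  · intro x hx
    have : x ≠ 0 := by rintro rfl; simp at hx; linarith
    simp only [hB1 x hx]
    field_simp

/-! ### Oscillating exponentials -/

/-- The oscillating exponential `x ↦ e^{i x}`. -/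
def osc (x : ℝ) : ℂ := Complex.exp (x * Complex.I)

theorem norm_osc (x : ℝ) : ‖osc x‖ = 1 := Complex.norm_exp_ofReal_mul_I x

theorem osc_add (x y : ℝ) : osc (x + y) = osc x * osc y := by
  simp [osc, add_mul, Complex.exp_add]

theorem osc_zero : osc 0 = 1 := by simp [osc]

theorem conj_osc (x : ℝ) : (starRingEnd ℂ) (osc x) = osc (-x) := by
  simp [osc, ← Complex.exp_conj]

theorem HasDerivAt.osc {u : ℝ → ℝ} {u' t : ℝ} (hu : HasDerivAt u u' t) :
    HasDerivAt (fun t => osc (u t)) (u' * Complex.I * osc (u t)) t := by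
  have h := ((hu.ofReal_comp).mul_const Complex.I).cexp
  simp only [_root_.osc]
  convert h using 1
  ring

@[fun_prop]
theorem continuous_osc : Continuous osc := by unfold osc; fun_prop

@[fun_prop]
theorem measurable_osc : Measurable osc := continuous_osc.measurable

/-! ### Partial derivatives in the first variable -/

section NonStationary

variable {P : Type*} [NormedAddCommGroup P] [NormedSpace ℝ P]

/-- The partial derivative in the first, real, variable. -/
def derivFst (g : ℝ × P → ℝ) (x : ℝ × P) : ℝ := fderiv ℝ g x (1, 0)

theorem ContDiff.derivFst {g : ℝ × P → ℝ} (hg : ContDiff ℝ ∞ g) : ContDiff ℝ ∞ (derivFst g) :=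
  (hg.fderiv_right (m := ∞) (by simp)).clm_apply contDiff_const

theorem hasDerivAt_derivFst {g : ℝ × P → ℝ} (hg : ContDiff ℝ ∞ g) (t : ℝ) (p : P) :
    HasDerivAt (fun t => g (t, p)) (derivFst g (t, p)) t := by
  have h1 : HasFDerivAt g (fderiv ℝ g (t, p)) (t, p) :=
    (hg.differentiable (by simp) _).hasFDerivAt
  exact h1.comp_hasDerivAt t ((hasDerivAt_id t).prodMk (hasDerivAt_const t p))

theorem derivFst_periodic {g : ℝ × P → ℝ} {T : ℝ} (hg : ContDiff ℝ ∞ g)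
    (hper : ∀ t p, g (t + T, p) = g (t, p)) (t : ℝ) (p : P) :
    derivFst g (t + T, p) = derivFst g (t, p) := by
  have h1 := (hasDerivAt_derivFst hg (t + T) p).comp_add_const t T
  simp only [hper] at h1
  exact h1.unique (hasDerivAt_derivFst hg t p)

/-- Each integration by parts spends two powers of ψ': one completes the derivative of exp(iRψ), the
other may be lost when the rest is differentiated. Carrying ψ'^(2N) in the amplitude avoids any
division, so zeros of ψ' are harmless, and compactness of K makes the constant uniform in the
parameter. -/
theorem integral_nonstationary_le {T : ℝ} {K : Set P} (hK : IsCompact K)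
    {ψ : ℝ × P → ℝ} (hψ : ContDiff ℝ ∞ ψ) (hψT : ∀ t p, ψ (t + T, p) = ψ (t, p)) (N : ℕ) :
    ∀ (g : ℝ × P → ℝ), ContDiff ℝ ∞ g → (∀ t p, g (t + T, p) = g (t, p)) →
    ∃ C, 0 ≤ C ∧ ∀ p ∈ K, ∀ R : ℝ, R ≠ 0 →
      ‖∫ t in (0 : ℝ)..T, ((g (t, p) * derivFst ψ (t, p) ^ (2 * N) : ℝ) : ℂ)
        * osc (R * ψ (t, p))‖ ≤ C / |R| ^ N := by
  induction N with
  | zero =>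
    intro g hg _
    obtain ⟨C, hC⟩ := (isCompact_uIcc (a := (0 : ℝ)) (b := T)).prod hK |>.exists_bound_of_continuousOn
      hg.continuous.continuousOn
    refine ⟨max C 0 * |T|, by positivity, fun p hp R _ => ?_⟩
    have := intervalIntegral.norm_integral_le_of_norm_le_const (a := (0 : ℝ)) (b := T)
      (f := fun t => ((g (t, p) * derivFst ψ (t, p) ^ (2 * 0) : ℝ) : ℂ) * osc (R * ψ (t, p)))
      (C := max C 0) (fun t ht => by
        have := hC (t, p) ⟨uIoc_subset_uIcc ht, hp⟩
        simpa [norm_osc] using Or.inl this)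
    simpa using this
  | succ N ih =>
    intro g hg hgT
    have hψ1 := hψ.derivFst
    -- The cofactor left after ψ'^(2N) is taken out of the derivative of g ψ'^(2N+1). It is the
    -- amplitude for the induction hypothesis.
    set g2 : ℝ × P → ℝ := fun q => derivFst g q * derivFst ψ q
      + (2 * N + 1) * g q * derivFst (derivFst ψ) q with hg2
    obtain ⟨C, hC0, hC⟩ := ih g2
      ((hg.derivFst.mul hψ1).add ((contDiff_const.mul hg).mul hψ1.derivFst)) (fun t p => by
        simp only [hg2, hgT, derivFst_periodic hg hgT, derivFst_periodic hψ hψT,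
          derivFst_periodic hψ1 (derivFst_periodic hψ hψT)])
    refine ⟨C, hC0, fun p hp R hR => ?_⟩
    have hder : ∀ t, HasDerivAt (fun t => g (t, p) * derivFst ψ (t, p) ^ (2 * N + 1))
        (g2 (t, p) * derivFst ψ (t, p) ^ (2 * N)) t := fun t => by
      have := (hasDerivAt_derivFst hg t p).mul ((hasDerivAt_derivFst hψ1 t p).pow (2 * N + 1))
      refine this.congr_deriv ?_
      simp only [hg2, Nat.add_sub_cancel, Pi.pow_apply]
      push_cast
      ring
    have hc : ∀ {w : ℝ × P → ℝ}, ContDiff ℝ ∞ w → Continuous fun t : ℝ => w (t, p) :=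
      fun hw => hw.continuous.comp (by fun_prop)
    have hcg := hc hg
    have hcg2 : Continuous fun t : ℝ => g2 (t, p) := hc
      ((hg.derivFst.mul hψ1).add ((contDiff_const.mul hg).mul hψ1.derivFst))
    have hcψ := hc hψ
    have hcψ1 := hc hψ1
    have hIBP := intervalIntegral.integral_mul_deriv_eq_deriv_mul (a := (0 : ℝ)) (b := T)
      (u := fun t => ((g (t, p) * derivFst ψ (t, p) ^ (2 * N + 1) : ℝ) : ℂ))
      (v := fun t => osc (R * ψ (t, p)))
      (u' := fun t => ((g2 (t, p) * derivFst ψ (t, p) ^ (2 * N) : ℝ) : ℂ))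
      (v' := fun t => ((R * derivFst ψ (t, p) : ℝ) : ℂ) * Complex.I * osc (R * ψ (t, p)))
      (fun t _ => (hder t).ofReal_comp)
      (fun t _ => ((hasDerivAt_derivFst hψ t p).const_mul R).osc)
      (Complex.continuous_ofReal.comp (hcg2.mul (hcψ1.pow _))).continuousOn.intervalIntegrable
      (Continuous.intervalIntegrable (by fun_prop) _ _)
    -- Periodicity makes the boundary terms at 0 and T cancel.
    have e1 := hgT 0 p
    have e2 := hψT 0 p
    have e3 := derivFst_periodic hψ hψT 0 p
    rw [zero_add] at e1 e2 e3
    simp only [e1, e2, e3, sub_self, zero_sub] at hIBP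
    have hkey : (R * Complex.I : ℂ) *
        (∫ t in (0 : ℝ)..T, ((g (t, p) * derivFst ψ (t, p) ^ (2 * (N + 1)) : ℝ) : ℂ)
        * osc (R * ψ (t, p))) = -∫ t in (0 : ℝ)..T,
          ((g2 (t, p) * derivFst ψ (t, p) ^ (2 * N) : ℝ) : ℂ) * osc (R * ψ (t, p)) := by
      rw [← hIBP, ← intervalIntegral.integral_const_mul]
      congr 1
      ext t
      push_cast
      ring
    have hn := congrArg norm hkey
    rw [norm_mul, norm_neg, norm_mul, Complex.norm_I, mul_one, Complex.norm_real,
      Real.norm_eq_abs] at hn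
    have hRpos : 0 < |R| := abs_pos.2 hR
    have hb := hC p hp R hR
    rw [← hn] at hb
    rw [pow_succ, le_div_iff₀ (by positivity)]
    rw [le_div_iff₀ (by positivity)] at hb
    linarith [hb]

end NonStationary

/-! ### A Schur test -/

theorem integral_inv_one_add_sq_le {S : ℝ} (hS : 0 < S) (t a b : ℝ) :
    ∫ s in a..b, (1 + (S * (t - s)) ^ 2)⁻¹ ≤ Real.pi / S := by
  have h := intervalIntegral.integral_comp_sub_mul (fun x : ℝ => (1 + x ^ 2)⁻¹) (a := a) (b := b)
    hS.ne' (S * t)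
  simp only [mul_sub]
  rw [h, integral_inv_one_add_sq, smul_eq_mul, div_eq_inv_mul]
  apply mul_le_mul_of_nonneg_left _ (by positivity)
  linarith [Real.arctan_lt_pi_div_two (S * t - S * a),
    Real.neg_pi_div_two_lt_arctan (S * t - S * b)]

/-- This is a TT* argument: write the square as a double integral over t, t', integrate in φ first,
and bound the row integrals of the resulting kernel by Mπ/S. -/
theorem integral_sq_norm_integral_le {A : ℝ → ℝ → ℂ} (hA : Continuous (Function.uncurry A))
    {α β b M S : ℝ} (hαβ : α ≤ β) (hS : 0 < S) (hM : 0 ≤ M)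
    (hK : ∀ t ∈ Icc α β, ∀ t' ∈ Icc α β,
      ‖∫ φ in (0 : ℝ)..b, A t φ * (starRingEnd ℂ) (A t' φ)‖ ≤ M * (1 + (S * (t - t')) ^ 2)⁻¹) :
    ∫ φ in (0 : ℝ)..b, ‖∫ t in α..β, A t φ‖ ^ 2 ≤ (β - α) * (M * (Real.pi / S)) := by
  have hc1 : ∀ {f g h : ℝ × ℝ → ℝ}, Continuous f → Continuous g → Continuous fun x => A (f x) (g x) :=
    fun hf hg => hA.comp (hf.prodMk hg)
  have hB : Continuous fun x : ℝ × ℝ × ℝ => A x.1 x.2.2 * (starRingEnd ℂ) (A x.2.1 x.2.2) :=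
    (hA.comp (by fun_prop : Continuous fun x : ℝ × ℝ × ℝ => (x.1, x.2.2))).mul
      (Complex.continuous_conj.comp
        (hA.comp (by fun_prop : Continuous fun x : ℝ × ℝ × ℝ => (x.2.1, x.2.2))))
  have hsq : ∀ φ, ((‖∫ t in α..β, A t φ‖ ^ 2 : ℝ) : ℂ) =
      ∫ t in α..β, ∫ t' in α..β, A t φ * (starRingEnd ℂ) (A t' φ) := fun φ => by
    have hcj : ∫ t' in α..β, (starRingEnd ℂ) (A t' φ) = (starRingEnd ℂ) (∫ t' in α..β, A t' φ) := by
      rw [intervalIntegral.integral_of_le hαβ, intervalIntegral.integral_of_le hαβ, integral_conj]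
    simp_rw [intervalIntegral.integral_const_mul, intervalIntegral.integral_mul_const, hcj]
    rw [Complex.mul_conj, Complex.normSq_eq_norm_sq]
  have hswap : ((∫ φ in (0 : ℝ)..b, ‖∫ t in α..β, A t φ‖ ^ 2 : ℝ) : ℂ) =
      ∫ t in α..β, ∫ t' in α..β, ∫ φ in (0 : ℝ)..b, A t φ * (starRingEnd ℂ) (A t' φ) := by
    rw [← intervalIntegral.integral_ofReal]
    simp_rw [hsq]
    rw [intervalIntegral_intervalIntegral_swap]
    · refine intervalIntegral.integral_congr fun t _ => ?_
      rw [intervalIntegral_intervalIntegral_swap]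
      refine ((Continuous.integrableOn_Icc ?_ (a := ((min 0 b, min α β) : ℝ × ℝ))
        (b := (max 0 b, max α β))).mono_set ?_)
      · exact hB.comp (by fun_prop : Continuous fun x : ℝ × ℝ => (t, x.2, x.1))
      · rw [← Icc_prod_Icc]
        exact prod_mono uIoc_subset_uIcc uIoc_subset_uIcc
    · refine ((Continuous.integrableOn_Icc ?_ (a := ((min 0 b, min α β) : ℝ × ℝ))
        (b := (max 0 b, max α β))).mono_set ?_)
      · exact intervalIntegral.continuous_parametric_intervalIntegral_of_continuous'
          (f := fun (x : ℝ × ℝ) t' => A x.2 x.1 * (starRingEnd ℂ) (A t' x.1))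
          (hB.comp (by fun_prop : Continuous fun x : (ℝ × ℝ) × ℝ => (x.1.2, x.2, x.1.1))) α β
      · rw [← Icc_prod_Icc]
        exact prod_mono uIoc_subset_uIcc uIoc_subset_uIcc
  have hkc : ∀ t, Continuous fun s => M * (1 + (S * (t - s)) ^ 2)⁻¹ := fun t =>
    continuous_const.mul (Continuous.inv₀ (by fun_prop) fun s => by positivity)
  have hin : ∀ t ∈ Icc α β, ‖∫ t' in α..β, ∫ φ in (0 : ℝ)..b, A t φ * (starRingEnd ℂ) (A t' φ)‖
      ≤ M * (Real.pi / S) := fun t ht => by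
    refine (intervalIntegral.norm_integral_le_of_norm_le hαβ (Eventually.of_forall
      fun t' ht' => hK t ht t' (Ioc_subset_Icc_self ht')) ((hkc t).intervalIntegrable _ _)).trans ?_
    rw [intervalIntegral.integral_const_mul]
    exact mul_le_mul_of_nonneg_left (integral_inv_one_add_sq_le hS t α β) hM
  have hfin := intervalIntegral.norm_integral_le_of_norm_le_const (a := α) (b := β)
    (C := M * (Real.pi / S)) (fun t ht => hin t (by
      rw [uIoc_of_le hαβ] at ht; exact Ioc_subset_Icc_self ht))
  rw [← hswap, Complex.norm_real, Real.norm_eq_abs, abs_of_nonneg (sub_nonneg.2 hαβ)] at hfin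
  linarith [le_abs_self (∫ φ in (0 : ℝ)..b, ‖∫ t in α..β, A t φ‖ ^ 2)]

/-! ### The circle kernel -/

/-- Here a and b stand for the unit tangents at two points, and u for the secant scaled to be close
to a. The φ-derivative of the phase is the component of u across the direction φ. Where V does not
vanish the same component of a exceeds 1/4, so the phase is nonstationary and two integrations by
parts suffice. -/
theorem exists_circle_kernel_bound {V : ℝ → ℝ} (hV : ContDiff ℝ ∞ V)
    (hV0 : ∀ x, |x| ≤ 1 / 4 → V x = 0) :
    ∃ C, 0 ≤ C ∧ ∀ a₀ a₁ b₀ b₁ u₀ u₁ : ℝ, |a₀| ≤ 1 → |a₁| ≤ 1 → |b₀| ≤ 1 → |b₁| ≤ 1 →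
      |u₀ - a₀| ≤ 1 / 16 → |u₁ - a₁| ≤ 1 / 16 → ∀ R : ℝ,
      ‖∫ φ in (0 : ℝ)..2 * Real.pi,
        ((V (Real.cos φ * a₁ - Real.sin φ * a₀) * V (Real.cos φ * b₁ - Real.sin φ * b₀) : ℝ) : ℂ)
          * osc (R * (Real.cos φ * u₀ + Real.sin φ * u₁))‖ ≤ C * (1 + R ^ 2)⁻¹ := by
  obtain ⟨ι, hι, hι1⟩ := exists_contDiff_inv (c := 1 / 8) (by norm_num)
  let ψ : ℝ × (ℝ × ℝ) × (ℝ × ℝ) × (ℝ × ℝ) → ℝ := fun q => Real.cos q.1 * q.2.2.2.1 + Real.sin q.1 * q.2.2.2.2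
  let dψ : ℝ × (ℝ × ℝ) × (ℝ × ℝ) × (ℝ × ℝ) → ℝ := fun q => Real.cos q.1 * q.2.2.2.2 - Real.sin q.1 * q.2.2.2.1
  let g : ℝ × (ℝ × ℝ) × (ℝ × ℝ) × (ℝ × ℝ) → ℝ := fun q => V (Real.cos q.1 * q.2.1.2 - Real.sin q.1 * q.2.1.1) *
    V (Real.cos q.1 * q.2.2.1.2 - Real.sin q.1 * q.2.2.1.1)
  have hψ : ContDiff ℝ ∞ ψ := by
    have := Real.contDiff_cos (n := ∞); have := Real.contDiff_sin (n := ∞); fun_prop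
  have hdψ : ContDiff ℝ ∞ dψ := by
    have := Real.contDiff_cos (n := ∞); have := Real.contDiff_sin (n := ∞); fun_prop
  have hg : ContDiff ℝ ∞ g := by
    have := Real.contDiff_cos (n := ∞); have := Real.contDiff_sin (n := ∞); fun_prop
  have hder : ∀ t p, derivFst ψ (t, p) = dψ (t, p) := fun t p => by
    refine (hasDerivAt_derivFst hψ t p).unique ?_
    have := ((Real.hasDerivAt_cos t).mul_const p.2.2.1).add
      ((Real.hasDerivAt_sin t).mul_const p.2.2.2)
    refine this.congr_deriv ?_
    simp only [dψ]
    ring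
  have hψT : ∀ t p, ψ (t + 2 * Real.pi, p) = ψ (t, p) := fun t p => by simp [ψ]
  have hK : IsCompact (Icc (((-2, -2), (-2, -2), (-2, -2)) : (ℝ × ℝ) × (ℝ × ℝ) × (ℝ × ℝ)) ((2, 2), (2, 2), (2, 2))) :=
    isCompact_Icc
  obtain ⟨C₀, hC₀, h₀⟩ := integral_nonstationary_le hK hψ hψT 0 g hg (fun t p => by simp [g])
  obtain ⟨C₂, hC₂, h₂⟩ := integral_nonstationary_le hK hψ hψT 2 (fun q => g q * ι (dψ q) ^ 4)
    (hg.mul ((hι.comp hdψ).pow 4)) (fun t p => by simp [g, dψ])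
  refine ⟨2 * (C₀ + C₂), by positivity, fun a₀ a₁ b₀ b₁ u₀ u₁ ha₀ ha₁ hb₀ hb₁ hu₀ hu₁ R => ?_⟩
  -- The nonstationary bound excludes R = 0. In that case the exponential is 1, which is also what u
  -- = 0 and R = 1 give.
  have hp0 : (((a₀, a₁), (b₀, b₁), (0, 0)) : (ℝ × ℝ) × (ℝ × ℝ) × (ℝ × ℝ)) ∈
      Icc (((-2, -2), (-2, -2), (-2, -2)) : (ℝ × ℝ) × (ℝ × ℝ) × (ℝ × ℝ))
        ((2, 2), (2, 2), (2, 2)) := by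
    simp only [abs_le] at ha₀ ha₁ hb₀ hb₁
    refine ⟨⟨⟨?_, ?_⟩, ⟨?_, ?_⟩, ?_, ?_⟩, ⟨⟨?_, ?_⟩, ⟨?_, ?_⟩, ?_, ?_⟩⟩ <;> dsimp only <;> linarith
  have hp : (((a₀, a₁), (b₀, b₁), (u₀, u₁)) : (ℝ × ℝ) × (ℝ × ℝ) × (ℝ × ℝ)) ∈
      Icc (((-2, -2), (-2, -2), (-2, -2)) : (ℝ × ℝ) × (ℝ × ℝ) × (ℝ × ℝ)) ((2, 2), (2, 2), (2, 2)) := by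
    simp only [abs_le] at ha₀ ha₁ hb₀ hb₁ hu₀ hu₁
    refine ⟨⟨⟨?_, ?_⟩, ⟨?_, ?_⟩, ?_, ?_⟩, ⟨⟨?_, ?_⟩, ⟨?_, ?_⟩, ?_, ?_⟩⟩ <;> dsimp only <;> linarith
  have hb₀ : ‖∫ φ in (0 : ℝ)..2 * Real.pi,
        ((V (Real.cos φ * a₁ - Real.sin φ * a₀) * V (Real.cos φ * b₁ - Real.sin φ * b₀) : ℝ) : ℂ)
          * osc (R * (Real.cos φ * u₀ + Real.sin φ * u₁))‖ ≤ C₀ := by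
    by_cases hR : R = 0
    · simpa [g, ψ, hR] using h₀ _ hp0 1 one_ne_zero
    · simpa [g, ψ] using h₀ _ hp R hR
  rcases le_or_gt |R| 1 with hR | hR
  · refine hb₀.trans ?_
    rw [← div_eq_mul_inv, le_div_iff₀ (by positivity)]
    have : R ^ 2 ≤ 1 := (sq_le_one_iff_abs_le_one R).2 hR
    nlinarith
  · have hR0 : R ≠ 0 := by rintro rfl; simp at hR; linarith
    have hR2 : 1 < R ^ 2 := (one_lt_sq_iff_one_lt_abs R).2 hR
    have := h₂ _ hp R hR0
    rw [sq_abs] at this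
    refine le_trans (le_of_eq ?_) (this.trans ?_)
    · congr 1
      refine intervalIntegral.integral_congr fun φ _ => ?_
      rw [hder]
      simp only [g, dψ, ψ]
      congr 2
      by_cases hx : |Real.cos φ * a₁ - Real.sin φ * a₀| ≤ 1 / 4
      · simp [hV0 _ hx]
      -- 1/8 = 1/4 - 2 · 1/16: each coordinate of u - a costs at most 1/16.
      · have hy : 1 / 8 ≤ |Real.cos φ * u₁ - Real.sin φ * u₀| := by
          have e : Real.cos φ * a₁ - Real.sin φ * a₀ = (Real.cos φ * u₁ - Real.sin φ * u₀) -
            (Real.cos φ * (u₁ - a₁)) + Real.sin φ * (u₀ - a₀) := by ring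
          have h1 : |Real.cos φ * (u₁ - a₁)| ≤ 1 / 16 := by
            rw [abs_mul]; nlinarith [Real.abs_cos_le_one φ, abs_nonneg (u₁ - a₁)]
          have h2 : |Real.sin φ * (u₀ - a₀)| ≤ 1 / 16 := by
            rw [abs_mul]; nlinarith [Real.abs_sin_le_one φ, abs_nonneg (u₀ - a₀)]
          rw [e] at hx
          have h3 := abs_add_le ((Real.cos φ * u₁ - Real.sin φ * u₀) -
            (Real.cos φ * (u₁ - a₁))) (Real.sin φ * (u₀ - a₀))
          have h4 := abs_sub (Real.cos φ * u₁ - Real.sin φ * u₀) (Real.cos φ * (u₁ - a₁))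
          linarith
        have := hι1 _ hy
        rw [show (2 * 2) = 4 from rfl, mul_assoc, ← mul_pow, this]
        simp
    · rw [← div_eq_mul_inv, div_le_div_iff₀ (by positivity) (by positivity)]
      nlinarith

/-! ### Framed closed curves -/

/-- A closed plane curve `(X, Y)` with speed `v`, unit tangent `(c₀, c₁)` and curvature `κ`. -/
structure FramedCurve where
  (T : ℝ)
  (X Y c₀ c₁ v κ : ℝ → ℝ)
  T_pos : 0 < T
  contDiff_X : ContDiff ℝ ∞ X
  contDiff_Y : ContDiff ℝ ∞ Y
  contDiff_c₀ : ContDiff ℝ ∞ c₀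
  contDiff_c₁ : ContDiff ℝ ∞ c₁
  contDiff_v : ContDiff ℝ ∞ v
  continuous_κ : Continuous κ
  periodic_X : Function.Periodic X T
  periodic_Y : Function.Periodic Y T
  periodic_c₀ : Function.Periodic c₀ T
  periodic_c₁ : Function.Periodic c₁ T
  v_pos : ∀ t, 0 < v t
  unit : ∀ t, c₀ t ^ 2 + c₁ t ^ 2 = 1
  hasDerivAt_X : ∀ t, HasDerivAt X (v t * c₀ t) t
  hasDerivAt_Y : ∀ t, HasDerivAt Y (v t * c₁ t) t
  hasDerivAt_c₀ : ∀ t, HasDerivAt c₀ (-(v t * κ t * c₁ t)) t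
  hasDerivAt_c₁ : ∀ t, HasDerivAt c₁ (v t * κ t * c₀ t) t

namespace FramedCurve

variable (G : FramedCurve)

/-- The component of the unit normal in the direction of angle `φ`. -/
def nrm (φ t : ℝ) : ℝ := Real.cos φ * G.c₁ t - Real.sin φ * G.c₀ t

/-- The component of the unit tangent in the direction of angle `φ`. -/
def tang (φ t : ℝ) : ℝ := Real.cos φ * G.c₀ t + Real.sin φ * G.c₁ t

/-- The component in the direction of angle `φ` of the parallel curve at distance `σ`. -/
def phase (σ φ t : ℝ) : ℝ :=
  Real.cos φ * (G.X t + σ * G.c₁ t) + Real.sin φ * (G.Y t - σ * G.c₀ t)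

theorem phase_eq (σ φ t : ℝ) : G.phase σ φ t = G.phase 0 φ t + σ * G.nrm φ t := by
  simp only [phase, nrm]; ring

theorem nrm_sq_add_tang_sq (φ t : ℝ) : G.nrm φ t ^ 2 + G.tang φ t ^ 2 = 1 := by
  simp only [nrm, tang]
  linear_combination (Real.cos φ ^ 2 + Real.sin φ ^ 2) * G.unit t + Real.cos_sq_add_sin_sq φ

theorem abs_c₀_le (t : ℝ) : |G.c₀ t| ≤ 1 := by
  rw [← sq_le_one_iff_abs_le_one]; nlinarith [G.unit t, sq_nonneg (G.c₁ t)]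

theorem abs_c₁_le (t : ℝ) : |G.c₁ t| ≤ 1 := by
  rw [← sq_le_one_iff_abs_le_one]; nlinarith [G.unit t, sq_nonneg (G.c₀ t)]

@[fun_prop]
theorem continuous_c₀ : Continuous G.c₀ := G.contDiff_c₀.continuous
@[fun_prop]
theorem continuous_c₁ : Continuous G.c₁ := G.contDiff_c₁.continuous
@[fun_prop]
theorem continuous_X : Continuous G.X := G.contDiff_X.continuous
@[fun_prop]
theorem continuous_Y : Continuous G.Y := G.contDiff_Y.continuous
@[fun_prop]
theorem continuous_v : Continuous G.v := G.contDiff_v.continuous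

theorem hasDerivAt_parallel_fst (σ t : ℝ) :
    HasDerivAt (fun t => G.X t + σ * G.c₁ t) (G.v t * (1 + σ * G.κ t) * G.c₀ t) t :=
  ((G.hasDerivAt_X t).add ((G.hasDerivAt_c₁ t).const_mul σ)).congr_deriv (by ring)

theorem hasDerivAt_parallel_snd (σ t : ℝ) :
    HasDerivAt (fun t => G.Y t - σ * G.c₀ t) (G.v t * (1 + σ * G.κ t) * G.c₁ t) t :=
  ((G.hasDerivAt_Y t).sub ((G.hasDerivAt_c₀ t).const_mul σ)).congr_deriv (by ring)

theorem continuous_speed (σ : ℝ) : Continuous fun t => G.v t * (1 + σ * G.κ t) :=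
  G.continuous_v.mul (continuous_const.add (continuous_const.mul G.continuous_κ))

/-- If the frame component `c` varies by at most `1 / 16`, then so do the secants of a function
with derivative `w * c`. -/
theorem abs_secant_sub_le {Z c w : ℝ → ℝ} (hc : Continuous c) (hw : Continuous w)
    (hZ : ∀ t, HasDerivAt Z (w t * c t) t) (hw0 : ∀ t, 0 ≤ w t) {t t' : ℝ}
    (hosc : ∀ s ∈ uIcc t' t, |c s - c t| ≤ 1 / 16) :
    |Z t - Z t' - (∫ s in t'..t, w s) * c t| ≤ |∫ s in t'..t, w s| * (1 / 16) := by
  have h1 := intervalIntegral.integral_eq_sub_of_hasDerivAt (a := t') (b := t)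
    (fun s _ => hZ s) ((hw.mul hc).intervalIntegrable _ _)
  have h2 : Z t - Z t' - (∫ s in t'..t, w s) * c t = ∫ s in t'..t, w s * (c s - c t) := by
    rw [← h1, ← intervalIntegral.integral_mul_const, ← intervalIntegral.integral_sub
      (f := fun s => w s * c s) (g := fun s => w s * c t) ((hw.mul hc).intervalIntegrable _ _) ((hw.mul continuous_const).intervalIntegrable _ _)]
    simp only [mul_sub]
  have h3 := intervalIntegral.norm_integral_le_abs_of_norm_le (a := t') (b := t) (μ := volume)
    (f := fun s => w s * (c s - c t)) (g := fun s => w s * (1 / 16))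
    ((ae_restrict_iff' measurableSet_uIoc).2 (Eventually.of_forall fun s hs => by
      rw [norm_mul, Real.norm_eq_abs, Real.norm_eq_abs, abs_of_nonneg (hw0 s)]
      exact mul_le_mul_of_nonneg_left (hosc s (uIoc_subset_uIcc hs)) (hw0 s)))
    ((hw.mul continuous_const).intervalIntegrable _ _)
  rw [intervalIntegral.integral_mul_const, abs_mul] at h3
  rw [h2]
  simpa using h3

/-! ### Mean square decay of oscillatory integrals over parallel curves. -/

variable {G}

/-- On an arc along which the tangent hardly turns, a secant of the parallel curve is its signed
length L times a vector close to the tangent. The circle kernel therefore decays in RL, and |L| is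
at least w₀|t - t'|; the Schur test then gives 1/R. -/
theorem exists_integral_sq_le_of_short {a V : ℝ → ℝ} (ha : Continuous a) (hV : ContDiff ℝ ∞ V)
    (hV0 : ∀ x, |x| ≤ 1 / 4 → V x = 0) {ρ w₀ : ℝ} (hw₀ : 0 < w₀)
    (hw : ∀ σ ∈ Icc (-ρ) ρ, ∀ t, w₀ ≤ G.v t * (1 + σ * G.κ t)) {α β : ℝ} (hαβ : α ≤ β)
    (hosc : ∀ s ∈ Icc α β, ∀ t ∈ Icc α β, |G.c₀ s - G.c₀ t| ≤ 1 / 16 ∧ |G.c₁ s - G.c₁ t| ≤ 1 / 16) :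
    ∃ C, 0 ≤ C ∧ ∀ σ ∈ Icc (-ρ) ρ, ∀ R > 0,
      ∫ φ in (0 : ℝ)..2 * Real.pi, ‖∫ t in α..β, ((a t * V (G.nrm φ t) : ℝ) : ℂ)
        * osc (R * G.phase σ φ t)‖ ^ 2 ≤ C / R := by
  obtain ⟨C, hC, hker⟩ := exists_circle_kernel_bound hV hV0
  obtain ⟨M, hM⟩ := (isCompact_Icc (a := α) (b := β)).exists_bound_of_continuousOn ha.continuousOn
  have hM' : ∀ t ∈ Icc α β, |a t| ≤ max M 0 := fun t ht => (hM t ht).trans (le_max_left _ _)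
  refine ⟨(β - α) * ((max M 0) ^ 2 * C * (Real.pi / w₀)), by
    have := sub_nonneg.2 hαβ; positivity, fun σ hσ R hR => ?_⟩
  have hVc := hV.continuous
  have hphase : Continuous fun x : ℝ × ℝ => G.phase σ x.2 x.1 := by unfold phase; fun_prop
  have hnrm : Continuous fun x : ℝ × ℝ => G.nrm x.2 x.1 := by unfold nrm; fun_prop
  have hA : Continuous (Function.uncurry fun t φ =>
      ((a t * V (G.nrm φ t) : ℝ) : ℂ) * osc (R * G.phase σ φ t)) := by
    simp only [Function.uncurry_def]; fun_prop
  refine (integral_sq_norm_integral_le hA (S := R * w₀) (M := max M 0 ^ 2 * C) hαβ (by positivity)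
    (by positivity) fun t ht t' ht' => ?_).trans (le_of_eq (by field_simp))
  set w : ℝ → ℝ := fun s => G.v s * (1 + σ * G.κ s) with hwdef
  have hwc : Continuous w := G.continuous_speed σ
  have hwp : ∀ s, w₀ ≤ w s := hw σ hσ
  have hw0 : ∀ s, 0 ≤ w s := fun s => hw₀.le.trans (hwp s)
  set L := ∫ s in t'..t, w s with hL
  have hsub : uIcc t' t ⊆ Icc α β := uIcc_subset_Icc ht' ht
  have hd0 := abs_secant_sub_le G.continuous_c₀ hwc (G.hasDerivAt_parallel_fst σ) hw0
    (t := t) (t' := t') fun s hs => (hosc s (hsub hs) t ht).1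
  have hd1 := abs_secant_sub_le G.continuous_c₁ hwc (G.hasDerivAt_parallel_snd σ) hw0
    (t := t) (t' := t') fun s hs => (hosc s (hsub hs) t ht).2
  have hLw : w₀ * |t - t'| ≤ |L| := by
    have := intervalIntegral.norm_integral_le_abs_of_norm_le (a := t') (b := t) (μ := volume)
      (f := fun _ => w₀) (g := w) (Eventually.of_forall fun s => by
        rw [Real.norm_eq_abs, abs_of_pos hw₀]; exact hwp s) (hwc.intervalIntegrable _ _)
    rw [intervalIntegral.integral_const, smul_eq_mul, norm_mul, Real.norm_eq_abs, Real.norm_eq_abs,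
      abs_of_pos hw₀] at this
    linarith
  set D₀ := G.X t + σ * G.c₁ t - (G.X t' + σ * G.c₁ t') with hD₀
  set D₁ := G.Y t - σ * G.c₀ t - (G.Y t' - σ * G.c₀ t') with hD₁
  -- If L = 0 the secant vanishes too, and the tangent itself serves as the scaled secant.
  have hu : ∀ D c : ℝ, |D - L * c| ≤ |L| * (1 / 16) →
      ∃ u, |u - c| ≤ 1 / 16 ∧ D = L * u := fun D c h => by
    by_cases hL0 : L = 0
    · refine ⟨c, by simp, ?_⟩
      rw [hL0] at h ⊢
      simpa using h
    · refine ⟨D / L, ?_, by field_simp⟩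
      have : D / L - c = (D - L * c) / L := by field_simp
      rw [this, abs_div, div_le_iff₀ (abs_pos.2 hL0)]
      linarith
  obtain ⟨u₀, hu₀, hDu₀⟩ := hu _ _ hd0
  obtain ⟨u₁, hu₁, hDu₁⟩ := hu _ _ hd1
  have hk := hker (G.c₀ t) (G.c₁ t) (G.c₀ t') (G.c₁ t') u₀ u₁ (G.abs_c₀_le t) (G.abs_c₁_le t)
    (G.abs_c₀_le t') (G.abs_c₁_le t') hu₀ hu₁ (R * L)
  have hcong : ∫ φ in (0 : ℝ)..2 * Real.pi, ((a t * V (G.nrm φ t) : ℝ) : ℂ)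
        * osc (R * G.phase σ φ t) * (starRingEnd ℂ) (((a t' * V (G.nrm φ t') : ℝ) : ℂ)
        * osc (R * G.phase σ φ t')) = ((a t * a t' : ℝ) : ℂ) * ∫ φ in (0 : ℝ)..2 * Real.pi,
        ((V (Real.cos φ * G.c₁ t - Real.sin φ * G.c₀ t)
          * V (Real.cos φ * G.c₁ t' - Real.sin φ * G.c₀ t') : ℝ) : ℂ)
          * osc (R * L * (Real.cos φ * u₀ + Real.sin φ * u₁)) := by
    rw [← intervalIntegral.integral_const_mul]
    refine intervalIntegral.integral_congr fun φ _ => ?_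
    have e : R * L * (Real.cos φ * u₀ + Real.sin φ * u₁)
        = R * G.phase σ φ t + -(R * G.phase σ φ t') := by
      have : R * L * (Real.cos φ * u₀ + Real.sin φ * u₁)
        = R * (Real.cos φ * D₀ + Real.sin φ * D₁) := by rw [hDu₀, hDu₁]; ring
      rw [this, hD₀, hD₁]
      simp only [phase]
      ring
    simp only [nrm, e]
    rw [osc_add, ← conj_osc, map_mul, Complex.conj_ofReal]
    push_cast
    ring
  rw [hcong, norm_mul, Complex.norm_real, Real.norm_eq_abs, abs_mul]
  have h1 : |a t| * |a t'| ≤ max M 0 ^ 2 := by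
    rw [sq]
    exact mul_le_mul (hM' t ht) (hM' t' ht') (abs_nonneg _) (by positivity)
  have h2 : C * (1 + (R * L) ^ 2)⁻¹ ≤ C * (1 + (R * w₀ * (t - t')) ^ 2)⁻¹ := by
    refine mul_le_mul_of_nonneg_left (inv_anti₀ (by positivity) ?_) hC
    have : |R * w₀ * (t - t')| ≤ |R * L| := by
      rw [abs_mul, abs_mul, abs_mul, abs_of_pos hR, abs_of_pos hw₀, mul_assoc]
      exact mul_le_mul_of_nonneg_left hLw hR.le
    linarith [sq_le_sq.2 this]
  calc _ ≤ max M 0 ^ 2 * (C * (1 + (R * w₀ * (t - t')) ^ 2)⁻¹) :=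
        mul_le_mul h1 (hk.trans h2) (norm_nonneg _) (by positivity)
    _ = _ := by ring

/-- Cut the period into finitely many arcs, short by uniform continuity of the tangent. Their number
depends on the curve only, so summing the bounds costs a constant. -/
theorem exists_integral_sq_le {a V : ℝ → ℝ} (ha : Continuous a) (hV : ContDiff ℝ ∞ V)
    (hV0 : ∀ x, |x| ≤ 1 / 4 → V x = 0) {ρ w₀ : ℝ} (hw₀ : 0 < w₀)
    (hw : ∀ σ ∈ Icc (-ρ) ρ, ∀ t, w₀ ≤ G.v t * (1 + σ * G.κ t)) :
    ∃ C, 0 ≤ C ∧ ∀ σ ∈ Icc (-ρ) ρ, ∀ R > 0,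
      ∫ φ in (0 : ℝ)..2 * Real.pi, ‖∫ t in (0 : ℝ)..G.T, ((a t * V (G.nrm φ t) : ℝ) : ℂ)
        * osc (R * G.phase σ φ t)‖ ^ 2 ≤ C / R := by
  obtain ⟨δ, hδ, hosc⟩ : ∃ δ > 0, ∀ s ∈ Icc (0 : ℝ) G.T, ∀ t ∈ Icc (0 : ℝ) G.T, |s - t| < δ →
      |G.c₀ s - G.c₀ t| ≤ 1 / 16 ∧ |G.c₁ s - G.c₁ t| ≤ 1 / 16 := by
    have h0 := isCompact_Icc.uniformContinuousOn_of_continuous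
      (s := Icc (0 : ℝ) G.T) G.continuous_c₀.continuousOn
    have h1 := isCompact_Icc.uniformContinuousOn_of_continuous
      (s := Icc (0 : ℝ) G.T) G.continuous_c₁.continuousOn
    rw [Metric.uniformContinuousOn_iff] at h0 h1
    obtain ⟨d0, hd0, h0⟩ := h0 (1 / 16) (by norm_num)
    obtain ⟨d1, hd1, h1⟩ := h1 (1 / 16) (by norm_num)
    exact ⟨min d0 d1, by positivity, fun s hs t ht hst =>
      ⟨(h0 s hs t ht (hst.trans_le (min_le_left _ _))).le,
        (h1 s hs t ht (hst.trans_le (min_le_right _ _))).le⟩⟩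
  obtain ⟨n, hn⟩ := exists_nat_gt (G.T / δ)
  have hn0 : (0 : ℝ) < n := (div_pos G.T_pos hδ).trans hn
  have key : ∀ m : ℕ, m ≤ n → ∃ C, 0 ≤ C ∧ ∀ σ ∈ Icc (-ρ) ρ, ∀ R > 0,
      ∫ φ in (0 : ℝ)..2 * Real.pi, ‖∫ t in (0 : ℝ)..(m * (G.T / n)),
        ((a t * V (G.nrm φ t) : ℝ) : ℂ) * osc (R * G.phase σ φ t)‖ ^ 2 ≤ C / R := by
    intro m
    induction m with
    | zero => exact fun _ => ⟨0, le_rfl, fun σ _ R _ => by simp⟩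
    | succ m ih =>
      intro hm
      obtain ⟨C₁, hC₁, h₁⟩ := ih (by omega)
      have hle : (m : ℝ) * (G.T / n) ≤ (m + 1 : ℕ) * (G.T / n) := by
        have := G.T_pos
        push_cast
        gcongr
        linarith
      have hend : ((m + 1 : ℕ) : ℝ) * (G.T / n) ≤ G.T := by
        have h : ((m + 1 : ℕ) : ℝ) ≤ n := by exact_mod_cast hm
        calc _ ≤ (n : ℝ) * (G.T / n) := by
              have := G.T_pos
              gcongr
          _ = G.T := by field_simp
      have hsub : Icc ((m : ℝ) * (G.T / n)) ((m + 1 : ℕ) * (G.T / n)) ⊆ Icc 0 G.T :=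
        Icc_subset_Icc (by have := G.T_pos; positivity) hend
      have hlen : G.T / n < δ := by
        rw [div_lt_iff₀ hn0]; rw [div_lt_iff₀ hδ] at hn; linarith
      obtain ⟨C₂, hC₂, h₂⟩ := exists_integral_sq_le_of_short (G := G) ha hV hV0 hw₀ hw hle
        (fun s hs t ht => hosc s (hsub hs) t (hsub ht) (by
          have e : ((m + 1 : ℕ) : ℝ) * (G.T / n) = m * (G.T / n) + G.T / n := by push_cast; ring
          rw [e] at hs ht
          rw [abs_lt]
          constructor <;> linarith [hs.1, hs.2, ht.1, ht.2]))
      refine ⟨2 * (C₁ + C₂), by positivity, fun σ hσ R hR => ?_⟩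
      have hVc := hV.continuous
      have hA : Continuous (Function.uncurry fun φ t =>
          ((a t * V (G.nrm φ t) : ℝ) : ℂ) * osc (R * G.phase σ φ t)) := by
        simp only [Function.uncurry_def, phase, nrm]; fun_prop
      have hsplit : ∀ φ, ∫ t in (0 : ℝ)..((m + 1 : ℕ) * (G.T / n)),
          ((a t * V (G.nrm φ t) : ℝ) : ℂ) * osc (R * G.phase σ φ t) =
          (∫ t in (0 : ℝ)..(m * (G.T / n)), ((a t * V (G.nrm φ t) : ℝ) : ℂ)
            * osc (R * G.phase σ φ t)) +
          ∫ t in (m * (G.T / n))..((m + 1 : ℕ) * (G.T / n)), ((a t * V (G.nrm φ t) : ℝ) : ℂ)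
            * osc (R * G.phase σ φ t) := fun φ => by
        have : Continuous fun t => ((a t * V (G.nrm φ t) : ℝ) : ℂ) * osc (R * G.phase σ φ t) :=
          hA.comp (by fun_prop : Continuous fun t : ℝ => (φ, t))
        exact (intervalIntegral.integral_add_adjacent_intervals (this.intervalIntegrable _ _)
          (this.intervalIntegrable _ _)).symm
      have hcont : ∀ α β : ℝ, Continuous fun φ => ‖∫ t in α..β, ((a t * V (G.nrm φ t) : ℝ) : ℂ)
            * osc (R * G.phase σ φ t)‖ ^ 2 := fun α β =>
        ((intervalIntegral.continuous_parametric_intervalIntegral_of_continuous' hA α β).norm).pow 2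
      have hmono := intervalIntegral.integral_mono_on (a := 0) (b := 2 * Real.pi) (μ := volume)
        (by positivity) ((hcont 0 ((m + 1 : ℕ) * (G.T / n))).intervalIntegrable _ _)
        (((continuous_const (y := (2 : ℝ))).mul ((hcont 0 (m * (G.T / n))).add
          (hcont (m * (G.T / n)) ((m + 1 : ℕ) * (G.T / n))))).intervalIntegrable _ _)
        (fun φ _ => by
          rw [hsplit]
          refine (pow_le_pow_left₀ (norm_nonneg _) (norm_add_le _ _) 2).trans ?_
          exact add_sq_le)
      refine hmono.trans ?_
      simp only [Pi.mul_apply, Pi.add_apply]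
      rw [intervalIntegral.integral_const_mul, intervalIntegral.integral_add
        ((hcont _ _).intervalIntegrable _ _) ((hcont _ _).intervalIntegrable _ _)]
      have e := add_le_add (h₁ σ hσ R hR) (h₂ σ hσ R hR)
      calc _ ≤ 2 * (C₁ / R + C₂ / R) := by linarith
        _ = _ := by ring
  have := key n le_rfl
  rwa [mul_div_cancel₀ _ hn0.ne'] at this

end FramedCurve

/-! ### Piecewise smooth functions -/

/-- Off finitely many points, `θ` is of class `C^n` up to the end points of each piece. -/
def PiecewiseContDiff (n : ℕ) (θ : ℝ → ℝ) : Prop :=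
  ∃ S : Finset ℝ, ∀ a b : ℝ, a < b → Disjoint (S : Set ℝ) (Ioo a b) →
    ∃ G : ℝ → ℝ, ContDiff ℝ n G ∧ EqOn θ G (Ioo a b)

theorem EqOn.deriv_Ioo {θ G : ℝ → ℝ} {a b : ℝ} (h : EqOn θ G (Ioo a b)) :
    EqOn (deriv θ) (deriv G) (Ioo a b) := fun _ hs =>
  (h.eventuallyEq_of_mem (Ioo_mem_nhds hs.1 hs.2)).deriv_eq

theorem PiecewiseContDiff.deriv {n : ℕ} {θ : ℝ → ℝ} (h : PiecewiseContDiff (n + 1) θ) :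
    PiecewiseContDiff n (deriv θ) := by
  obtain ⟨S, hS⟩ := h
  refine ⟨S, fun a b hab hd => ?_⟩
  obtain ⟨G, hG, hθ⟩ := hS a b hab hd
  refine ⟨_root_.deriv G, ?_, EqOn.deriv_Ioo hθ⟩
  exact ((contDiff_succ_iff_deriv (n := n)).1 (by exact_mod_cast hG)).2.2

theorem PiecewiseContDiff.mono {n m : ℕ} (hmn : m ≤ n) {θ : ℝ → ℝ} (h : PiecewiseContDiff n θ) :
    PiecewiseContDiff m θ := by
  obtain ⟨S, hS⟩ := h
  refine ⟨S, fun a b hab hd => ?_⟩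
  obtain ⟨G, hG, hθ⟩ := hS a b hab hd
  exact ⟨G, hG.of_le (by exact_mod_cast hmn), hθ⟩

theorem PiecewiseContDiff.exists_finite_differentiableAt {θ : ℝ → ℝ}
    (h : PiecewiseContDiff 1 θ) : ∃ S : Set ℝ, S.Finite ∧ ∀ x ∉ S, DifferentiableAt ℝ θ x := by
  obtain ⟨S, hS⟩ := h
  refine ⟨S, S.finite_toSet, fun x hx => ?_⟩
  obtain ⟨δ, hδ, hb⟩ := Metric.isOpen_iff.1 S.finite_toSet.isClosed.isOpen_compl x hx
  rw [Real.ball_eq_Ioo] at hb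
  obtain ⟨G, hG, hθ⟩ := hS (x - δ) (x + δ) (by linarith)
    (disjoint_left.2 fun y hy hy' => hb hy' hy)
  have : θ =ᶠ[𝓝 x] G := hθ.eventuallyEq_of_mem (Ioo_mem_nhds (by linarith) (by linarith))
  exact (hG.differentiable (by simp) x).congr_of_eventuallyEq this

/-- Off the finite set of break points the function is continuous, and its values on a finite set do
not affect measurability. -/
theorem PiecewiseContDiff.measurable {θ : ℝ → ℝ} (h : PiecewiseContDiff 1 θ) : Measurable θ := by
  obtain ⟨S, hS, hd⟩ := h.exists_finite_differentiableAt
  refine measurable_of_measurable_on_compl_finite S hS (Continuous.measurable ?_)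
  exact continuousOn_iff_continuous_domRestrict.1 fun x hx =>
    (hd x hx).continuousAt.continuousWithinAt

/-- Integration by parts against an oscillating exponential, with boundary terms at finitely many
points. -/
def HasJumpFormula (θ : ℝ → ℝ) (a b : ℝ) : Prop :=
  ∃ (c : ℝ →₀ ℝ) (M : ℝ), (∀ x ∈ c.support, x ∈ Icc a b) ∧
    (∀ s ∈ Icc a b, |θ s| ≤ M ∧ |deriv θ s| ≤ M) ∧
    ∀ l : ℝ, (l : ℂ) * ∫ s in a..b, (θ s : ℂ) * osc (l * s) =
      Complex.I * ((∫ s in a..b, ((deriv θ s : ℝ) : ℂ) * osc (l * s)) +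
        c.sum fun x z => (z : ℂ) * osc (l * x))

theorem intervalIntegrable_mul_osc {g : ℝ → ℝ} (hg : Measurable g) {a b M : ℝ} (hab : a ≤ b)
    (hM : ∀ s ∈ Icc a b, |g s| ≤ M) (l : ℝ) :
    IntervalIntegrable (fun s => (g s : ℂ) * osc (l * s)) volume a b := by
  rw [intervalIntegrable_iff_integrableOn_Icc_of_le hab]
  refine Measure.integrableOn_of_bounded (M := M) (by simp) (by
    have : Measurable fun s => (g s : ℂ) * osc (l * s) :=
      (Complex.measurable_ofReal.comp hg).mul (measurable_osc.comp (by fun_prop))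
    exact this.aestronglyMeasurable) ?_
  refine (ae_restrict_iff' measurableSet_Icc).2 (Eventually.of_forall fun s hs => ?_)
  rw [norm_mul, norm_osc, mul_one, Complex.norm_real]
  exact hM s hs

theorem HasJumpFormula.trans {θ : ℝ → ℝ} (hθ : Measurable θ) {a b c : ℝ} (hab : a ≤ b) (hbc : b ≤ c)
    (h₁ : HasJumpFormula θ a b) (h₂ : HasJumpFormula θ b c) : HasJumpFormula θ a c := by
  obtain ⟨c₁, M₁, hs₁, hM₁, hf₁⟩ := h₁
  obtain ⟨c₂, M₂, hs₂, hM₂, hf₂⟩ := h₂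
  refine ⟨c₁ + c₂, max M₁ M₂, fun x hx => ?_, fun s hs => ?_, fun l => ?_⟩
  · rcases Finset.mem_union.1 (Finsupp.support_add hx) with h | h
    · exact ⟨(hs₁ x h).1, (hs₁ x h).2.trans hbc⟩
    · exact ⟨hab.trans (hs₂ x h).1, (hs₂ x h).2⟩
  · rcases le_total s b with h | h
    · have := hM₁ s ⟨hs.1, h⟩
      exact ⟨this.1.trans (le_max_left _ _), this.2.trans (le_max_left _ _)⟩
    · have := hM₂ s ⟨h, hs.2⟩
      exact ⟨this.1.trans (le_max_right _ _), this.2.trans (le_max_right _ _)⟩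
  · have hd : Measurable (deriv θ) := measurable_deriv θ
    rw [Finsupp.sum_add_index' (by simp) (by intros; push_cast; ring),
      ← intervalIntegral.integral_add_adjacent_intervals
        (intervalIntegrable_mul_osc hθ hab (fun s hs => (hM₁ s hs).1) l)
        (intervalIntegrable_mul_osc hθ hbc (fun s hs => (hM₂ s hs).1) l),
      ← intervalIntegral.integral_add_adjacent_intervals
        (intervalIntegrable_mul_osc hd hab (fun s hs => (hM₁ s hs).2) l)
        (intervalIntegrable_mul_osc hd hbc (fun s hs => (hM₂ s hs).2) l), mul_add, hf₁, hf₂]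
    ring

/-- The integration by parts is done for the smooth extension G, whose values at the end points give
the boundary terms. The values of θ and its derivative at a and b do not affect the integrals and
enter only the uniform bound. -/
theorem HasJumpFormula.of_eqOn {θ G : ℝ → ℝ} {a b : ℝ} (hab : a ≤ b) (hG : ContDiff ℝ 1 G)
    (h : EqOn θ G (Ioo a b)) : HasJumpFormula θ a b := by
  have hG' : Continuous (deriv G) := hG.continuous_deriv le_rfl
  have hGc : Continuous G := hG.continuous
  obtain ⟨M₁, hM₁⟩ := (isCompact_Icc (a := a) (b := b)).exists_bound_of_continuousOn
    hGc.continuousOn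
  obtain ⟨M₂, hM₂⟩ := (isCompact_Icc (a := a) (b := b)).exists_bound_of_continuousOn
    hG'.continuousOn
  have hbound : ∀ (f g : ℝ → ℝ) (M : ℝ), EqOn f g (Ioo a b) → (∀ s ∈ Icc a b, ‖g s‖ ≤ M) →
      ∀ s ∈ Icc a b, |f s| ≤ max M (max |f a| |f b|) := by
    intro f g M hfg hM s hs
    rcases hs.1.eq_or_lt with rfl | h1
    · simp
    rcases hs.2.eq_or_lt with rfl | h2
    · simp
    rw [hfg ⟨h1, h2⟩]
    exact (hM s hs).trans (le_max_left _ _)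
  refine ⟨Finsupp.single a (G a) + Finsupp.single b (-G b),
    max (max M₁ (max |θ a| |θ b|)) (max M₂ (max |deriv θ a| |deriv θ b|)), ?_, ?_, ?_⟩
  · intro x hx
    rcases Finset.mem_union.1 (Finsupp.support_add hx) with h | h
    · rw [Finset.mem_singleton.1 (Finsupp.support_single_subset h)]; exact ⟨le_rfl, hab⟩
    · rw [Finset.mem_singleton.1 (Finsupp.support_single_subset h)]; exact ⟨hab, le_rfl⟩
  · exact fun s hs => ⟨(hbound _ _ _ h hM₁ s hs).trans (le_max_left _ _),
      (hbound _ _ _ (EqOn.deriv_Ioo h) hM₂ s hs).trans (le_max_right _ _)⟩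
  · intro l
    have hcongr : ∀ f g : ℝ → ℝ, EqOn f g (Ioo a b) → ∫ s in a..b, (f s : ℂ) * osc (l * s) =
        ∫ s in a..b, (g s : ℂ) * osc (l * s) := fun f g hfg => by
      rw [intervalIntegral.integral_of_le hab, intervalIntegral.integral_of_le hab,
        integral_Ioc_eq_integral_Ioo, integral_Ioc_eq_integral_Ioo]
      exact setIntegral_congr_fun measurableSet_Ioo fun s hs => by simp only [hfg hs]
    rw [hcongr θ G h, hcongr _ _ (EqOn.deriv_Ioo h), Finsupp.sum_add_index' (by simp)
      (by intros; push_cast; ring), Finsupp.sum_single_index (by simp),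
      Finsupp.sum_single_index (by simp)]
    have hIBP := intervalIntegral.integral_mul_deriv_eq_deriv_mul (a := a) (b := b)
      (u := fun t => (G t : ℂ)) (v := fun t => osc (l * t)) (u' := fun t => ((deriv G t : ℝ) : ℂ))
      (v' := fun t => ((l * 1 : ℝ) : ℂ) * Complex.I * osc (l * t))
      (fun t _ => ((hG.differentiable (by simp) t).hasDerivAt).ofReal_comp)
      (fun t _ => ((hasDerivAt_id t).const_mul l).osc)
      ((Complex.continuous_ofReal.comp hG').intervalIntegrable _ _)
      (Continuous.intervalIntegrable (by fun_prop) _ _)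
    have e : ∫ s in a..b, (G s : ℂ) * (((l * 1 : ℝ) : ℂ) * Complex.I * osc (l * s)) =
        l * Complex.I * ∫ s in a..b, (G s : ℂ) * osc (l * s) := by
      rw [← intervalIntegral.integral_const_mul]
      congr 1
      ext s
      push_cast
      ring
    rw [e] at hIBP
    push_cast
    linear_combination (-Complex.I) * hIBP +
      ((l : ℂ) * ∫ s in a..b, (G s : ℂ) * osc (l * s)) * Complex.I_sq

theorem PiecewiseContDiff.hasJumpFormula {θ : ℝ → ℝ} (h : PiecewiseContDiff 1 θ) {a b : ℝ}
    (hab : a ≤ b) : HasJumpFormula θ a b := by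
  have hm := h.measurable
  obtain ⟨S, hS⟩ := h
  -- S' contains all break points inside (a, b). Splitting the interval at one of them removes it
  -- from the interior of both halves, so the induction runs on S'.
  have key : ∀ S' : Finset ℝ, ∀ a b : ℝ, a ≤ b → (∀ x ∈ S, x ∈ Ioo a b → x ∈ S') →
      HasJumpFormula θ a b := by
    intro S'
    induction S' using Finset.induction with
    | empty =>
      intro a b hab hx
      rcases hab.eq_or_lt with rfl | hlt
      · exact HasJumpFormula.of_eqOn (G := 0) le_rfl contDiff_const (by simp)
      obtain ⟨G, hG, hθ⟩ := hS a b hlt (disjoint_left.2 fun x hxS hxI => by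
        simpa using hx x hxS hxI)
      exact HasJumpFormula.of_eqOn hab (by exact_mod_cast hG) hθ
    | insert x S' _ ih =>
      intro a b hab hy
      by_cases hx : x ∈ Ioo a b
      · refine HasJumpFormula.trans hm hx.1.le hx.2.le (ih a x hx.1.le fun y hyS hyI => ?_)
          (ih x b hx.2.le fun y hyS hyI => ?_)
        · exact (Finset.mem_insert.1 (hy y hyS ⟨hyI.1, hyI.2.trans hx.2⟩)).resolve_left hyI.2.ne
        · exact (Finset.mem_insert.1 (hy y hyS ⟨hx.1.trans hyI.1, hyI.2⟩)).resolve_left hyI.1.ne'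
      · exact ih a b hab fun y hyS hyI =>
          (Finset.mem_insert.1 (hy y hyS hyI)).resolve_left fun h => hx (h ▸ hyI)
  exact key S a b hab fun x hx _ => hx

/-! ### The Fourier transform of a weight -/

/-- The first q integrations by parts have no boundary terms, because the derivatives of θ of order
below q are continuous and vanish at ±1. Only the last one sees the jumps, recorded by c.
Multiplying by l^(q+1) instead of dividing keeps the identity valid at l = 0. -/
theorem exists_fourier_repr (q : ℕ) : ∀ θ : ℝ → ℝ, (∀ s ∉ Icc (-1 : ℝ) 1, θ s = 0) →
    (∀ m : ℕ, m < q → ContDiff ℝ m θ) → PiecewiseContDiff (q + 1) θ →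
    ∃ (g : ℝ → ℝ) (c : ℝ →₀ ℝ) (M : ℝ), Measurable g ∧ (∀ s ∈ Icc (-1 : ℝ) 1, |g s| ≤ M) ∧
      (∀ x ∈ c.support, x ∈ Icc (-1 : ℝ) 1) ∧
      ∀ l : ℝ, (l : ℂ) ^ (q + 1) * ∫ s in (-1 : ℝ)..1, (θ s : ℂ) * osc (l * s) =
        Complex.I ^ (q + 1) * ((∫ s in (-1 : ℝ)..1, (g s : ℂ) * osc (l * s)) +
          c.sum fun x z => (z : ℂ) * osc (l * x)) := by
  induction q with
  | zero =>
    intro θ _ _ hp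
    obtain ⟨c, M, hc, hM, hl⟩ := hp.hasJumpFormula (a := -1) (b := 1) (by norm_num)
    exact ⟨deriv θ, c, M, measurable_deriv θ, fun s hs => (hM s hs).2, hc, by simpa using hl⟩
  | succ q ih =>
    intro θ h0 hreg hp
    obtain ⟨g, c, M, hg, hM, hc, hl⟩ := ih (deriv θ) (fun s hs => by
      have : θ =ᶠ[𝓝 s] fun _ => 0 := by
        filter_upwards [isClosed_Icc.isOpen_compl.mem_nhds hs] with x hx using h0 x hx
      simpa using this.deriv_eq) (fun m hm => by
        have := hreg (m + 1) (by omega)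
        exact ((contDiff_succ_iff_deriv (n := m)).1 (by exact_mod_cast this)).2.2) hp.deriv
    refine ⟨g, c, M, hg, hM, hc, fun l => ?_⟩
    have hθc : Continuous θ := (hreg 0 (by omega)).continuous
    -- At the end points ±1 themselves the vanishing comes from continuity.
    have hone : ∀ x : ℝ, 1 ≤ |x| → θ x = 0 := by
      intro x hx
      have hcl : IsClosed {x | θ x = 0} := isClosed_eq hθc continuous_const
      rcases le_abs.1 hx with h | h
      · have : closure (Ioi (1 : ℝ)) ⊆ {x | θ x = 0} :=
          hcl.closure_subset_iff.2 fun y hy => h0 y fun hy' => absurd hy'.2 (not_le.2 hy)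
        exact this (by rw [closure_Ioi]; exact h)
      · have : closure (Iio (-1 : ℝ)) ⊆ {x | θ x = 0} :=
          hcl.closure_subset_iff.2 fun y hy => h0 y fun hy' => absurd hy'.1 (not_le.2 hy)
        exact this (by rw [closure_Iio]; exact (by simp; linarith : x ∈ Iic (-1 : ℝ)))
    have hp1 : PiecewiseContDiff 1 θ := hp.mono (by omega)
    obtain ⟨S, hS, hdiff⟩ := hp1.exists_finite_differentiableAt
    obtain ⟨_, M', _, hM', _⟩ := hp1.hasJumpFormula (a := -1) (b := 1) (by norm_num)
    have hi1 := intervalIntegrable_mul_osc (measurable_deriv θ) (by norm_num : (-1 : ℝ) ≤ 1)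
      (fun s hs => (hM' s hs).2) l
    have hi2 := intervalIntegrable_mul_osc hθc.measurable (by norm_num : (-1 : ℝ) ≤ 1)
      (fun s hs => (hM' s hs).1) l
    -- The derivative may fail to exist at break points, so the fundamental theorem is used in the
    -- form that allows countably many exceptions for a continuous function.
    have hFTC := integral_eq_of_hasDerivAt_off_countable (a := -1) (b := 1)
      (fun s => (θ s : ℂ) * osc (l * s))
      (fun s => ((deriv θ s : ℝ) : ℂ) * osc (l * s) + (l * Complex.I) * ((θ s : ℂ) * osc (l * s)))
      hS.countable (by fun_prop) (fun x hx => by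
        have h1 := ((hdiff x hx.2).hasDerivAt).ofReal_comp
        have h2 := ((hasDerivAt_id x).const_mul l).osc
        refine (h1.mul h2).congr_deriv ?_
        push_cast
        simp only [id]
        ring) (hi1.add (hi2.const_mul _))
    rw [intervalIntegral.integral_add hi1 (hi2.const_mul _),
      intervalIntegral.integral_const_mul, hone 1 (by simp), hone (-1) (by simp)] at hFTC
    simp only [Complex.ofReal_zero, zero_mul, sub_zero] at hFTC
    have hstep : (l : ℂ) * ∫ s in (-1 : ℝ)..1, (θ s : ℂ) * osc (l * s) =
        Complex.I * ∫ s in (-1 : ℝ)..1, ((deriv θ s : ℝ) : ℂ) * osc (l * s) := by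
      linear_combination (-Complex.I) * hFTC +
        (l : ℂ) * (∫ s in (-1 : ℝ)..1, (θ s : ℂ) * osc (l * s)) * Complex.I_sq
    rw [pow_succ, mul_assoc, hstep, mul_left_comm, hl l]
    ring

theorem IsWeight.eq_zero {q : ℕ} {θ : ℝ → ℝ} (hθ : IsWeight q θ) {s : ℝ}
    (hs : s ∉ Icc (-1 : ℝ) 1) : θ s = 0 := by
  rw [← hθ.support_eq] at hs
  exact image_eq_zero_of_notMem_tsupport hs

theorem IsWeight.piecewiseContDiff {q : ℕ} {θ : ℝ → ℝ} (hθ : IsWeight q θ) :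
    PiecewiseContDiff (q + 1) θ := hθ.piecewise

theorem IsWeight.measurable {q : ℕ} {θ : ℝ → ℝ} (hθ : IsWeight q θ) : Measurable θ :=
  (hθ.piecewiseContDiff.mono (by omega : 1 ≤ q + 1)).measurable

theorem IsWeight.exists_bound {q : ℕ} {θ : ℝ → ℝ} (hθ : IsWeight q θ) :
    ∃ M, 0 ≤ M ∧ ∀ s, |θ s| ≤ M := by
  obtain ⟨_, M, _, hM, _⟩ := (hθ.piecewiseContDiff.mono (by omega : 1 ≤ q + 1)).hasJumpFormula
    (a := -1) (b := 1) (by norm_num)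
  refine ⟨max M 0, le_max_right _ _, fun s => ?_⟩
  by_cases hs : s ∈ Icc (-1 : ℝ) 1
  · exact (hM s hs).1.trans (le_max_left _ _)
  · simp [hθ.eq_zero hs]

theorem integral_integral_mul_swap {g : ℝ → ℝ} (hg : Measurable g) {M : ℝ}
    (hM : ∀ s ∈ Icc (-1 : ℝ) 1, |g s| ≤ M) {K : ℝ → ℝ → ℂ} (hK : Continuous (Function.uncurry K))
    (T : ℝ) :
    ∫ t in (0 : ℝ)..T, ∫ s in (-1 : ℝ)..1, (g s : ℂ) * K t s =
      ∫ s in (-1 : ℝ)..1, (g s : ℂ) * ∫ t in (0 : ℝ)..T, K t s := by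
  rw [intervalIntegral_intervalIntegral_swap]
  · simp_rw [intervalIntegral.integral_const_mul]
  · obtain ⟨M', hM'⟩ := ((isCompact_uIcc (a := (0 : ℝ)) (b := T)).prod
      (isCompact_Icc (a := (-1 : ℝ)) (b := 1))).exists_bound_of_continuousOn hK.continuousOn
    rw [uIoc_of_le (by norm_num : (-1 : ℝ) ≤ 1)]
    refine Measure.integrableOn_of_bounded (M := M * M') ?_ ?_ ?_
    · rw [Measure.volume_eq_prod, Measure.prod_prod]
      exact ENNReal.mul_ne_top (by simp [uIoc]) (by simp)
    · exact ((Complex.measurable_ofReal.comp (hg.comp measurable_snd)).mul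
        hK.measurable).aestronglyMeasurable
    · refine (ae_restrict_iff' (measurableSet_uIoc.prod measurableSet_Ioc)).2
        (Eventually.of_forall fun x hx => ?_)
      have h1 := hM x.2 (Ioc_subset_Icc_self hx.2)
      have h2 := hM' x ⟨uIoc_subset_uIcc hx.1, Ioc_subset_Icc_self hx.2⟩
      simp only [Function.uncurry] at h2 ⊢
      rw [norm_mul, Complex.norm_real]
      exact mul_le_mul h1 h2 (norm_nonneg _) ((abs_nonneg _).trans h1)

/-- Cauchy–Schwarz on an interval of length 2, read off from the nonnegative integral of (u - m)²
with m the mean of u. -/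
theorem sq_integral_le {u : ℝ → ℝ} (hu : Continuous u) :
    (∫ s in (-1 : ℝ)..1, u s) ^ 2 ≤ 2 * ∫ s in (-1 : ℝ)..1, u s ^ 2 := by
  set m := (∫ s in (-1 : ℝ)..1, u s) / 2 with hm
  have h0 : 0 ≤ ∫ s in (-1 : ℝ)..1, (u s ^ 2 - (2 * m) * u s + m ^ 2) :=
    intervalIntegral.integral_nonneg (by norm_num) fun s _ => by nlinarith [sq_nonneg (u s - m)]
  rw [intervalIntegral.integral_add (Continuous.intervalIntegrable (by fun_prop) _ _)
    (Continuous.intervalIntegrable (by fun_prop) _ _), intervalIntegral.integral_sub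
    (Continuous.intervalIntegrable (by fun_prop) _ _)
    (Continuous.intervalIntegrable (by fun_prop) _ _), intervalIntegral.integral_const_mul,
    intervalIntegral.integral_const, smul_eq_mul] at h0
  have : ∫ s in (-1 : ℝ)..1, u s = 2 * m := by rw [hm]; ring
  rw [this] at h0 ⊢
  linarith

/-! ### Circular mean square of the Fourier transform of the tube integrand. -/

namespace FramedCurve

variable {G : FramedCurve}

/-- The factor 1 - B confines the amplitude to directions whose normal component is below 1/2. The
tangential component is then at least 1/2, and the phase derivative, speed times tangential
component, is at least w₀/2. -/
theorem exists_norm_integral_nonstationary_le {a B : ℝ → ℝ} (ha : ContDiff ℝ ∞ a)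
    (haT : Function.Periodic a G.T) (hB : ContDiff ℝ ∞ B) (hB1 : ∀ x, 1 / 2 ≤ |x| → B x = 1)
    {ρ w₀ : ℝ} (hw₀ : 0 < w₀) (hw : ∀ σ ∈ Icc (-ρ) ρ, ∀ t, w₀ ≤ G.v t * (1 + σ * G.κ t)) (N : ℕ) :
    ∃ C, 0 ≤ C ∧ ∀ σ ∈ Icc (-ρ) ρ, ∀ φ ∈ Icc 0 (2 * Real.pi), ∀ R > 0,
      ‖∫ t in (0 : ℝ)..G.T, ((a t * (1 - B (G.nrm φ t)) : ℝ) : ℂ) * osc (R * G.phase σ φ t)‖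
        ≤ C / R ^ N := by
  obtain ⟨ι, hι, hι1⟩ := exists_contDiff_inv (half_pos hw₀)
  have hX : ContDiff ℝ ∞ fun q : ℝ × ℝ × ℝ => G.X q.1 := G.contDiff_X.comp contDiff_fst
  have hY : ContDiff ℝ ∞ fun q : ℝ × ℝ × ℝ => G.Y q.1 := G.contDiff_Y.comp contDiff_fst
  have h0 : ContDiff ℝ ∞ fun q : ℝ × ℝ × ℝ => G.c₀ q.1 := G.contDiff_c₀.comp contDiff_fst
  have h1 : ContDiff ℝ ∞ fun q : ℝ × ℝ × ℝ => G.c₁ q.1 := G.contDiff_c₁.comp contDiff_fst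
  have hcos : ContDiff ℝ ∞ fun q : ℝ × ℝ × ℝ => Real.cos q.2.2 :=
    Real.contDiff_cos.comp (by fun_prop)
  have hsin : ContDiff ℝ ∞ fun q : ℝ × ℝ × ℝ => Real.sin q.2.2 :=
    Real.contDiff_sin.comp (by fun_prop)
  let ψ : ℝ × ℝ × ℝ → ℝ := fun q => G.phase q.2.1 q.2.2 q.1
  have hψ : ContDiff ℝ ∞ ψ := by simp only [ψ, phase]; fun_prop
  have hnrm : ContDiff ℝ ∞ fun q : ℝ × ℝ × ℝ => G.nrm q.2.2 q.1 := by
    simp only [nrm]; fun_prop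
  have hder : ∀ t σ φ, derivFst ψ (t, σ, φ) = G.v t * (1 + σ * G.κ t) * G.tang φ t :=
    fun t σ φ => by
      refine (hasDerivAt_derivFst hψ t (σ, φ)).unique ?_
      refine (((G.hasDerivAt_parallel_fst σ t).const_mul (Real.cos φ)).add
        ((G.hasDerivAt_parallel_snd σ t).const_mul (Real.sin φ))).congr_deriv ?_
      simp only [tang]
      ring
  have hψT : ∀ t (p : ℝ × ℝ), ψ (t + G.T, p) = ψ (t, p) := fun t p => by
    simp only [ψ, phase, G.periodic_X t, G.periodic_Y t, G.periodic_c₀ t, G.periodic_c₁ t]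
  obtain ⟨C, hC, h⟩ := integral_nonstationary_le (T := G.T)
    (isCompact_Icc (a := ((-ρ, 0) : ℝ × ℝ)) (b := (ρ, 2 * Real.pi))) hψ hψT N
    (fun q => a q.1 * (1 - B (G.nrm q.2.2 q.1)) * ι (derivFst ψ q) ^ (2 * N))
    (((ha.comp contDiff_fst).mul (contDiff_const.sub (hB.comp hnrm))).mul
      ((hι.comp hψ.derivFst).pow _)) (fun t p => by
        simp only [derivFst_periodic hψ hψT, nrm, haT t, G.periodic_c₀ t, G.periodic_c₁ t])
  refine ⟨C, hC, fun σ hσ φ hφ R hR => ?_⟩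
  have := h (σ, φ) ⟨⟨hσ.1, hφ.1⟩, ⟨hσ.2, hφ.2⟩⟩ R hR.ne'
  rw [abs_of_pos hR] at this
  refine le_trans (le_of_eq ?_) this
  congr 1
  refine intervalIntegral.integral_congr fun t _ => ?_
  simp only [ψ]
  congr 2
  by_cases hx : 1 / 2 ≤ |G.nrm φ t|
  · simp [hB1 _ hx]
  · have hy : 1 / 2 ≤ |G.tang φ t| := by
      by_contra hy
      push Not at hx hy
      have e1 := sq_lt_sq' (by linarith [abs_nonneg (G.nrm φ t)]) hx
      have e2 := sq_lt_sq' (by linarith [abs_nonneg (G.tang φ t)]) hy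
      rw [sq_abs] at e1 e2
      linarith [G.nrm_sq_add_tang_sq φ t]
    have hge : w₀ / 2 ≤ |derivFst ψ (t, σ, φ)| := by
      rw [hder, abs_mul, abs_of_pos (hw₀.trans_le (hw σ hσ t))]
      have := hw σ hσ t
      nlinarith
    rw [mul_assoc, ← mul_pow, hι1 _ hge, one_pow, mul_one]

/-- The Fourier transform, at the point with polar coordinates `R, φ`, of the function
`a t * θ_ε s` in the coordinates `t, s` of the tube. -/
def tubeFourier (G : FramedCurve) (a θ : ℝ → ℝ) (ε R φ : ℝ) : ℂ :=
  ∫ t in (0 : ℝ)..G.T, ∫ s in (-1 : ℝ)..1,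
    (θ s : ℂ) * ((a t : ℂ) * osc (R * G.phase (ε * s) φ t))

/-- The oscillatory integral of `b` along the parallel curve at distance `σ`. -/
def oscIntegral (G : FramedCurve) (b : ℝ → ℝ → ℝ) (R σ φ : ℝ) : ℂ :=
  ∫ t in (0 : ℝ)..G.T, ((b φ t : ℝ) : ℂ) * osc (R * G.phase σ φ t)

theorem continuous_oscIntegral {b : ℝ → ℝ → ℝ} (hb : Continuous (Function.uncurry b)) (R : ℝ) :
    Continuous (Function.uncurry (G.oscIntegral b R)) := by
  refine intervalIntegral.continuous_parametric_intervalIntegral_of_continuous'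
    (f := fun (x : ℝ × ℝ) t => ((b x.2 t : ℝ) : ℂ) * osc (R * G.phase x.1 x.2 t)) ?_ 0 G.T
  have : Continuous fun x : (ℝ × ℝ) × ℝ => b x.1.2 x.2 :=
    hb.comp (by fun_prop : Continuous fun x : (ℝ × ℝ) × ℝ => (x.1.2, x.2))
  simp only [Function.uncurry_def, phase]
  fun_prop

/-- In the nonstationary part s becomes the outer variable, since that part is estimated along each
parallel curve separately. The other part keeps s inside, where the regularity of θ is exploited. -/
theorem tubeFourier_eq_add {a θ B : ℝ → ℝ} (hac : Continuous a) (hBc : Continuous B)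
    (hθ : Measurable θ) {Mθ : ℝ} (hMθ : ∀ s, |θ s| ≤ Mθ) (ε R φ : ℝ) :
    G.tubeFourier a θ ε R φ =
      (∫ s in (-1 : ℝ)..1, (θ s : ℂ) *
        G.oscIntegral (fun φ t => a t * (1 - B (G.nrm φ t))) R (ε * s) φ) +
      ∫ t in (0 : ℝ)..G.T, ∫ s in (-1 : ℝ)..1,
        (θ s : ℂ) * (((a t * B (G.nrm φ t) : ℝ) : ℂ) * osc (R * G.phase (ε * s) φ t)) := by
  have hKc : ∀ b : ℝ → ℝ, Continuous b → Continuous (Function.uncurry fun t s : ℝ =>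
      ((b t : ℝ) : ℂ) * osc (R * G.phase (ε * s) φ t)) := fun b hb => by
    simp only [Function.uncurry_def, phase]
    fun_prop
  have hc1 : Continuous fun t => a t * (1 - B (G.nrm φ t)) := by simp only [nrm]; fun_prop
  have hc2 : Continuous fun t => a t * B (G.nrm φ t) := by simp only [nrm]; fun_prop
  unfold tubeFourier oscIntegral
  rw [integral_integral_mul_swap hθ (fun s _ => hMθ s) (hKc a hac),
    integral_integral_mul_swap hθ (fun s _ => hMθ s) (hKc _ hc2)]
  have hin : ∀ b : ℝ → ℝ, Continuous b → IntervalIntegrable (fun s => (θ s : ℂ) *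
      ∫ t in (0 : ℝ)..G.T, ((b t : ℝ) : ℂ) * osc (R * G.phase (ε * s) φ t)) volume (-1) 1 := by
    intro b hb
    refine IntervalIntegrable.mul_continuousOn ?_ ?_
    · simpa using intervalIntegrable_mul_osc hθ (by norm_num : (-1 : ℝ) ≤ 1)
        (fun s _ => hMθ s) 0 |>.congr (fun s _ => by simp [osc_zero] : EqOn _
          (fun s => (θ s : ℂ)) _)
    · refine (intervalIntegral.continuous_parametric_intervalIntegral_of_continuous'
        (f := fun s t => ((b t : ℝ) : ℂ) * osc (R * G.phase (ε * s) φ t)) ?_ 0 G.T).continuousOn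
      exact (hKc b hb).comp continuous_swap
  rw [← intervalIntegral.integral_add (hin _ hc1) (hin _ hc2)]
  refine intervalIntegral.integral_congr fun s _ => ?_
  have hKt : ∀ b : ℝ → ℝ, Continuous b →
      Continuous fun t => ((b t : ℝ) : ℂ) * osc (R * G.phase (ε * s) φ t) := fun b hb =>
    (hKc b hb).comp (by fun_prop : Continuous fun t : ℝ => (t, s))
  rw [← mul_add, ← intervalIntegral.integral_add ((hKt _ hc1).intervalIntegrable _ _)
    ((hKt _ hc2).intervalIntegrable _ _)]
  congr 1
  refine intervalIntegral.integral_congr fun t _ => ?_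
  push_cast
  ring

/-- For fixed t the s-integral is the Fourier transform of θ at Rε times the normal component. The
power of that component held in the amplitude, together with (Rε)^p, supplies the factor l^p of
`hrep`. Undoing the factorization of the phase then gives integrals over whole parallel curves, at
distances weighted by g and by the jumps c. -/
theorem integral_stationary_eq {a V θ g : ℝ → ℝ} (hac : Continuous a) (hVc : Continuous V)
    (hg : Measurable g) {M : ℝ} (hM : ∀ s ∈ Icc (-1 : ℝ) 1, |g s| ≤ M) {c : ℝ →₀ ℝ} {p : ℕ}
    (hrep : ∀ l : ℝ, (l : ℂ) ^ p * ∫ s in (-1 : ℝ)..1, (θ s : ℂ) * osc (l * s) =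
        Complex.I ^ p * ((∫ s in (-1 : ℝ)..1, (g s : ℂ) * osc (l * s)) +
          c.sum fun x z => (z : ℂ) * osc (l * x))) (ε R φ : ℝ) :
    (((R * ε) ^ p : ℝ) : ℂ) * (∫ t in (0 : ℝ)..G.T, ∫ s in (-1 : ℝ)..1,
        (θ s : ℂ) * (((a t * (V (G.nrm φ t) * G.nrm φ t ^ p) : ℝ) : ℂ) *
          osc (R * G.phase (ε * s) φ t))) =
      Complex.I ^ p * ((∫ s in (-1 : ℝ)..1, (g s : ℂ) *
        G.oscIntegral (fun φ t => a t * V (G.nrm φ t)) R (ε * s) φ) +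
        ∑ x ∈ c.support, (c x : ℂ) *
          G.oscIntegral (fun φ t => a t * V (G.nrm φ t)) R (ε * x) φ) := by
  have hKc : Continuous (Function.uncurry fun t s : ℝ =>
      ((a t * V (G.nrm φ t) : ℝ) : ℂ) * osc (R * G.phase (ε * s) φ t)) := by
    simp only [Function.uncurry_def, phase, nrm]
    fun_prop
  have hKt : ∀ s, Continuous fun t =>
      ((a t * V (G.nrm φ t) : ℝ) : ℂ) * osc (R * G.phase (ε * s) φ t) := fun s =>
    hKc.comp (by fun_prop : Continuous fun t : ℝ => (t, s))
  have hinner : ∀ t, (((R * ε) ^ p : ℝ) : ℂ) * ∫ s in (-1 : ℝ)..1,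
      (θ s : ℂ) * (((a t * (V (G.nrm φ t) * G.nrm φ t ^ p) : ℝ) : ℂ) * osc (R * G.phase (ε * s) φ t)) =
      Complex.I ^ p * ((∫ s in (-1 : ℝ)..1, (g s : ℂ) *
        (((a t * V (G.nrm φ t) : ℝ) : ℂ) * osc (R * G.phase (ε * s) φ t))) +
        ∑ x ∈ c.support, (c x : ℂ) *
        (((a t * V (G.nrm φ t) : ℝ) : ℂ) * osc (R * G.phase (ε * x) φ t))) := by
    intro t
    -- The phase is affine in the distance from the curve, with the normal component as slope.
    have hosc : ∀ s, osc (R * G.phase (ε * s) φ t) =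
        osc (R * G.phase 0 φ t) * osc (R * ε * G.nrm φ t * s) := fun s => by
      rw [G.phase_eq (ε * s), ← osc_add]
      congr 1
      ring
    have e1 : ∀ (u : ℝ → ℝ) (b : ℂ), ∫ s in (-1 : ℝ)..1, (u s : ℂ) *
        (b * osc (R * G.phase (ε * s) φ t)) = b * osc (R * G.phase 0 φ t) *
          ∫ s in (-1 : ℝ)..1, (u s : ℂ) * osc (R * ε * G.nrm φ t * s) := fun u b => by
      rw [← intervalIntegral.integral_const_mul]
      refine intervalIntegral.integral_congr fun s _ => ?_
      simp only [hosc]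
      ring
    have e2 : ∑ x ∈ c.support, (c x : ℂ) *
        (((a t * V (G.nrm φ t) : ℝ) : ℂ) * osc (R * G.phase (ε * x) φ t)) =
        ((a t * V (G.nrm φ t) : ℝ) : ℂ) * osc (R * G.phase 0 φ t) *
          c.sum fun x z => (z : ℂ) * osc (R * ε * G.nrm φ t * x) := by
      rw [Finsupp.sum, Finset.mul_sum]
      refine Finset.sum_congr rfl fun x _ => ?_
      rw [hosc]
      ring
    rw [e1, e1, e2]
    have := hrep (R * ε * G.nrm φ t)
    push_cast at this ⊢
    rw [mul_pow] at this
    linear_combination ((a t : ℂ) * V (G.nrm φ t) * osc (R * G.phase 0 φ t)) * this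
  rw [← intervalIntegral.integral_const_mul]
  simp_rw [hinner]
  rw [intervalIntegral.integral_const_mul, intervalIntegral.integral_add,
    integral_integral_mul_swap hg hM hKc, intervalIntegral.integral_finsetSum]
  · simp_rw [intervalIntegral.integral_const_mul]
    rfl
  · exact fun x _ => ((hKt x).const_mul _).intervalIntegrable _ _
  -- As g is only measurable and bounded, continuity in t of its Fourier integral is obtained by
  -- dominated convergence.
  · have hx : IntervalIntegrable (fun t => ∫ s in (-1 : ℝ)..1, (g s : ℂ) *
        (((a t * V (G.nrm φ t) : ℝ) : ℂ) * osc (R * G.phase (ε * s) φ t))) volume 0 G.T := by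
      have e : ∀ t, ∫ s in (-1 : ℝ)..1, (g s : ℂ) * (((a t * V (G.nrm φ t) : ℝ) : ℂ) *
          osc (R * G.phase (ε * s) φ t)) = ((a t * V (G.nrm φ t) : ℝ) : ℂ) *
          osc (R * G.phase 0 φ t) * ∫ s in (-1 : ℝ)..1, (g s : ℂ) *
          osc (R * ε * G.nrm φ t * s) := fun t => by
        rw [← intervalIntegral.integral_const_mul]
        refine intervalIntegral.integral_congr fun s _ => ?_
        simp only [G.phase_eq (ε * s)]
        rw [mul_add, osc_add, show R * (ε * s * G.nrm φ t) = R * ε * G.nrm φ t * s by ring]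
        ring
      simp_rw [e]
      refine Continuous.intervalIntegrable (Continuous.mul ?_ ?_) _ _
      · simpa using hKt 0
      · refine intervalIntegral.continuous_of_dominated_interval (bound := fun _ => M)
          (fun t => ?_) (fun t => ?_) (by simp) ?_
        · exact ((Complex.measurable_ofReal.comp hg).mul
            (measurable_osc.comp (by fun_prop))).aestronglyMeasurable
        · refine Eventually.of_forall fun s hs => ?_
          rw [uIoc_of_le (by norm_num)] at hs
          rw [norm_mul, norm_osc, mul_one, Complex.norm_real]
          exact hM s (Ioc_subset_Icc_self hs)
        · refine Eventually.of_forall fun s _ => ?_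
          simp only [nrm]
          fun_prop
    exact hx
  · exact (continuous_finsetSum _ fun x _ => (hKt x).const_mul _).intervalIntegrable _ _

/-- Cauchy–Schwarz in s and over the jumps reduces the weighted combination to the mean squares of
single U(σ, ·). The continuous majorant Q spares any check that the left side is integrable in φ. -/
theorem integral_sq_weighted_le {U : ℝ → ℝ → ℂ} (hUc : Continuous (Function.uncurry U))
    {ρ ε C₂ : ℝ} (hmem : ∀ s ∈ Icc (-1 : ℝ) 1, ε * s ∈ Icc (-ρ) ρ)
    (h₂ : ∀ σ ∈ Icc (-ρ) ρ, ∫ φ in (0 : ℝ)..2 * Real.pi, ‖U σ φ‖ ^ 2 ≤ C₂)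
    {g : ℝ → ℝ} {M : ℝ} (hM : ∀ s ∈ Icc (-1 : ℝ) 1, |g s| ≤ M) {c : ℝ →₀ ℝ}
    (hc : ∀ x ∈ c.support, x ∈ Icc (-1 : ℝ) 1) :
    ∃ Q : ℝ → ℝ, Continuous Q ∧
      (∀ φ, ‖(∫ s in (-1 : ℝ)..1, (g s : ℂ) * U (ε * s) φ) +
        ∑ x ∈ c.support, (c x : ℂ) * U (ε * x) φ‖ ^ 2 ≤ Q φ) ∧
      ∫ φ in (0 : ℝ)..2 * Real.pi, Q φ ≤
        (4 * M ^ 2 * 2 + 2 * ((∑ x ∈ c.support, c x ^ 2) * c.support.card)) * C₂ := by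
  have hUc2 : ∀ φ, Continuous fun s => U (ε * s) φ := fun φ =>
    hUc.comp (by fun_prop : Continuous fun s : ℝ => (ε * s, φ))
  have hUc3 : ∀ σ, Continuous fun φ => U σ φ := fun σ =>
    hUc.comp (by fun_prop : Continuous fun φ : ℝ => (σ, φ))
  set W : ℝ := ∑ x ∈ c.support, c x ^ 2 with hW
  have hW0 : 0 ≤ W := Finset.sum_nonneg fun _ _ => sq_nonneg _
  let Q : ℝ → ℝ := fun φ => 4 * M ^ 2 * (∫ s in (-1 : ℝ)..1, ‖U (ε * s) φ‖ ^ 2) +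
    2 * (W * ∑ x ∈ c.support, ‖U (ε * x) φ‖ ^ 2)
  have hUsc : Continuous (Function.uncurry fun φ s : ℝ => ‖U (ε * s) φ‖ ^ 2) :=
    ((hUc.comp (by fun_prop : Continuous fun x : ℝ × ℝ => (ε * x.2, x.1))).norm).pow 2
  have hQ1c : Continuous fun φ => ∫ s in (-1 : ℝ)..1, ‖U (ε * s) φ‖ ^ 2 :=
    intervalIntegral.continuous_parametric_intervalIntegral_of_continuous' hUsc _ _
  have hQ2c : Continuous fun φ => ∑ x ∈ c.support, ‖U (ε * x) φ‖ ^ 2 :=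
    continuous_finsetSum _ fun x _ => ((hUc3 (ε * x)).norm).pow 2
  have hQc : Continuous Q := by simp only [Q]; fun_prop
  refine ⟨Q, hQc, ?_, ?_⟩
  · intro φ
    refine (pow_le_pow_left₀ (norm_nonneg _) (norm_add_le _ _) 2).trans (add_sq_le.trans ?_)
    have j1 : ‖∫ s in (-1 : ℝ)..1, (g s : ℂ) * U (ε * s) φ‖ ≤
        M * ∫ s in (-1 : ℝ)..1, ‖U (ε * s) φ‖ := by
      rw [← intervalIntegral.integral_const_mul]
      refine intervalIntegral.norm_integral_le_of_norm_le (by norm_num)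
        (Eventually.of_forall fun s hs => ?_)
        (((hUc2 φ).norm.const_mul _).intervalIntegrable _ _)
      rw [norm_mul, Complex.norm_real]
      exact mul_le_mul_of_nonneg_right (hM s (Ioc_subset_Icc_self hs)) (norm_nonneg _)
    have j2 : ‖∑ x ∈ c.support, (c x : ℂ) * U (ε * x) φ‖ ≤
        ∑ x ∈ c.support, |c x| * ‖U (ε * x) φ‖ :=
      (norm_sum_le _ _).trans (Finset.sum_le_sum fun x _ => by rw [norm_mul, Complex.norm_real]; rfl)
    have j3 := Finset.sum_mul_sq_le_sq_mul_sq c.support (fun x => |c x|) fun x => ‖U (ε * x) φ‖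
    simp only [sq_abs] at j3
    have j4 := sq_integral_le (hUc2 φ).norm
    have k1 := pow_le_pow_left₀ (norm_nonneg _) j1 2
    have k2 := (pow_le_pow_left₀ (norm_nonneg _) j2 2).trans j3
    rw [mul_pow] at k1
    have k3 := mul_le_mul_of_nonneg_left j4 (sq_nonneg M)
    simp only [Q]
    linarith
  · simp only [Q]
    rw [intervalIntegral.integral_add ((hQ1c.const_mul _).intervalIntegrable _ _)
      (((hQ2c.const_mul _).const_mul _).intervalIntegrable _ _),
      intervalIntegral.integral_const_mul, intervalIntegral.integral_const_mul,
      intervalIntegral.integral_const_mul, intervalIntegral.integral_finsetSum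
        (f := fun x φ => ‖U (ε * x) φ‖ ^ 2) (fun x _ => (((hUc3 (ε * x)).norm).pow 2).intervalIntegrable _ _),
      intervalIntegral_intervalIntegral_swap]
    · have i1 : ∫ s in (-1 : ℝ)..1, ∫ φ in (0 : ℝ)..2 * Real.pi, ‖U (ε * s) φ‖ ^ 2 ≤
          2 * (C₂) := by
        have := intervalIntegral.norm_integral_le_of_norm_le_const (a := -1) (b := 1)
          (f := fun s => ∫ φ in (0 : ℝ)..2 * Real.pi, ‖U (ε * s) φ‖ ^ 2) (C := C₂)
          (fun s hs => by
            rw [uIoc_of_le (by norm_num)] at hs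
            rw [Real.norm_of_nonneg (intervalIntegral.integral_nonneg (by positivity)
              fun _ _ => by positivity)]
            exact h₂ _ (hmem s (Ioc_subset_Icc_self hs)))
        rw [show |(1 : ℝ) - -1| = 2 by norm_num] at this
        linarith [le_abs_self (∫ s in (-1 : ℝ)..1, ∫ φ in (0 : ℝ)..2 * Real.pi,
          ‖U (ε * s) φ‖ ^ 2), Real.norm_eq_abs (∫ s in (-1 : ℝ)..1,
          ∫ φ in (0 : ℝ)..2 * Real.pi, ‖U (ε * s) φ‖ ^ 2)]
      have i2 : ∑ x ∈ c.support, ∫ φ in (0 : ℝ)..2 * Real.pi, ‖U (ε * x) φ‖ ^ 2 ≤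
          c.support.card * C₂ := by
        have := Finset.sum_le_card_nsmul c.support
          (fun x => ∫ φ in (0 : ℝ)..2 * Real.pi, ‖U (ε * x) φ‖ ^ 2) (C₂)
          (fun x hx => h₂ _ (hmem x (hc x hx)))
        rwa [nsmul_eq_mul] at this
      calc _ ≤ 4 * M ^ 2 * (2 * (C₂)) + 2 * (W * (c.support.card * C₂)) := by gcongr
        _ = _ := by ring
    · refine (hUsc.integrableOn_Icc (a := ((min 0 (2 * Real.pi), min (-1) 1) : ℝ × ℝ))
        (b := (max 0 (2 * Real.pi), max (-1) 1))).mono_set ?_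
      rw [← Icc_prod_Icc]
      exact prod_mono uIoc_subset_uIcc uIoc_subset_uIcc

theorem exists_integral_sq_tubeFourier_le {a : ℝ → ℝ} (ha : ContDiff ℝ ∞ a)
    (haT : Function.Periodic a G.T) {ρ w₀ : ℝ} (hρ : 0 < ρ) (hw₀ : 0 < w₀)
    (hw : ∀ σ ∈ Icc (-ρ) ρ, ∀ t, w₀ ≤ G.v t * (1 + σ * G.κ t)) {q : ℕ} {θ : ℝ → ℝ}
    (hθ : IsWeight q θ) :
    ∃ C, 0 ≤ C ∧ ∀ ε ∈ Ioc 0 ρ, ∀ R ≥ 1,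
      ∫ φ in (0 : ℝ)..2 * Real.pi, ‖G.tubeFourier a θ ε R φ‖ ^ 2 ≤
        C / (R * (R * ε) ^ (2 * (q + 1))) := by
  obtain ⟨B, hB, hB0, hB1⟩ := exists_contDiff_cutoff (a := 1 / 4) (b := 1 / 2)
    (by norm_num) (by norm_num)
  obtain ⟨ι, hι, hι1⟩ := exists_contDiff_inv (c := 1 / 4) (by norm_num)
  obtain ⟨Mθ, hMθ0, hMθ⟩ := hθ.exists_bound
  obtain ⟨g, c, M, hg, hM, hc, hrep⟩ := exists_fourier_repr q θ (fun s => hθ.eq_zero) hθ.regular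
    hθ.piecewiseContDiff
  have hM0 : 0 ≤ M := (abs_nonneg _).trans (hM 0 (by simp))
  -- V is B divided by x^(q+1), which is smooth because B vanishes near 0. The divided-out power is
  -- what the integrations by parts across the tube consume.
  set V : ℝ → ℝ := fun x => B x * ι x ^ (q + 1) with hVdef
  have hV : ContDiff ℝ ∞ V := hB.mul (hι.pow _)
  have hV0 : ∀ x, |x| ≤ 1 / 4 → V x = 0 := fun x hx => by simp only [V, hB0 x hx, zero_mul]
  have hBV : ∀ x, B x = V x * x ^ (q + 1) := fun x => by
    rcases le_or_gt |x| (1 / 4) with hx | hx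
    · simp only [V, hB0 x hx, zero_mul]
    · simp only [V]
      rw [mul_assoc, ← mul_pow, hι1 x hx.le, one_pow, mul_one]
  -- The order q + 2 makes the squared nonstationary part R^(-(2q+4)), which for R ≥ 1 and ε ≤ ρ is
  -- dominated by the target R^(-(2q+3)) ε^(-2(q+1)).
  obtain ⟨C₁, hC₁, h₁⟩ := exists_norm_integral_nonstationary_le (G := G) ha haT hB hB1 hw₀ hw (q + 2)
  obtain ⟨C₂, hC₂, h₂⟩ := exists_integral_sq_le (G := G) ha.continuous hV hV0 hw₀ hw
  set D₁ : ℝ := 2 * Mθ * C₁ with hD₁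
  set D₂ : ℝ := (4 * M ^ 2 * 2 + 2 * ((∑ x ∈ c.support, c x ^ 2) * c.support.card)) * C₂ with hD₂
  have hD₂0 : 0 ≤ D₂ :=
    mul_nonneg (add_nonneg (mul_nonneg (mul_nonneg zero_le_four (sq_nonneg M)) zero_le_two)
      (mul_nonneg zero_le_two (mul_nonneg (Finset.sum_nonneg fun x _ => sq_nonneg (c x))
        (Nat.cast_nonneg _)))) hC₂
  refine ⟨2 * (D₂ + 2 * Real.pi * D₁ ^ 2 * ρ ^ (2 * (q + 1))),
    mul_nonneg zero_le_two (add_nonneg hD₂0 (mul_nonneg (mul_nonneg Real.two_pi_pos.le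
      (sq_nonneg D₁)) (pow_nonneg hρ.le _))), fun ε hε R hR => ?_⟩
  have hR0 : 0 < R := by linarith
  have hmem : ∀ s ∈ Icc (-1 : ℝ) 1, ε * s ∈ Icc (-ρ) ρ := fun s hs => by
    constructor <;> nlinarith [hs.1, hs.2, hε.1, hε.2]
  have hVn : Continuous (Function.uncurry fun φ t => a t * V (G.nrm φ t)) := by
    have := ha.continuous
    have := hV.continuous
    simp only [Function.uncurry_def, nrm]
    fun_prop
  obtain ⟨Q, hQc, hQ, hQint⟩ := integral_sq_weighted_le (G.continuous_oscIntegral hVn R) (ε := ε)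
    hmem (C₂ := C₂ / R) (fun σ hσ => h₂ σ hσ R hR0) hM hc
  have hQint : ∫ φ in (0 : ℝ)..2 * Real.pi, Q φ ≤ D₂ / R :=
    hQint.trans (le_of_eq (by rw [hD₂, mul_div_assoc]))
  have hns : ∀ φ ∈ Icc 0 (2 * Real.pi), ‖∫ s in (-1 : ℝ)..1, (θ s : ℂ) * G.oscIntegral (fun φ t => a t * (1 - B (G.nrm φ t))) R (ε * s) φ‖
        ≤ D₁ / R ^ (q + 2) := by
    intro φ hφ
    have := intervalIntegral.norm_integral_le_of_norm_le_const (a := -1) (b := 1)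
      (f := fun s => (θ s : ℂ) * G.oscIntegral (fun φ t => a t * (1 - B (G.nrm φ t))) R (ε * s) φ)
      (C := Mθ * (C₁ / R ^ (q + 2))) (fun s hs => by
        rw [uIoc_of_le (by norm_num)] at hs
        rw [norm_mul, Complex.norm_real]
        exact mul_le_mul (hMθ s) (h₁ _ (hmem s (Ioc_subset_Icc_self hs)) φ hφ R hR0)
          (norm_nonneg _) hMθ0)
    refine this.trans (le_of_eq ?_)
    rw [show |(1 : ℝ) - -1| = 2 by norm_num, hD₁]
    ring
  set P : ℝ := (R * ε) ^ (q + 1) with hP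
  have hP0 : 0 < P := pow_pos (mul_pos hR0 hε.1) _
  have hH2 : ∀ φ, P ^ 2 * ‖∫ t in (0 : ℝ)..G.T, ∫ s in (-1 : ℝ)..1,
        (θ s : ℂ) * (((a t * B (G.nrm φ t) : ℝ) : ℂ) * osc (R * G.phase (ε * s) φ t))‖ ^ 2
        ≤ Q φ := by
    intro φ
    have e := congrArg norm (G.integral_stationary_eq ha.continuous hV.continuous hg hM hrep ε R φ)
    rw [norm_mul, norm_mul, Complex.norm_real, Real.norm_of_nonneg hP0.le, norm_pow,
      Complex.norm_I, one_pow, one_mul] at e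
    simp_rw [← hBV] at e
    rw [← mul_pow, e]
    exact hQ φ
  have hpt : ∀ φ ∈ Icc 0 (2 * Real.pi), ‖G.tubeFourier a θ ε R φ‖ ^ 2 ≤
      2 * (D₁ / R ^ (q + 2)) ^ 2 + 2 / P ^ 2 * Q φ := fun φ hφ => by
    rw [G.tubeFourier_eq_add ha.continuous hB.continuous hθ.measurable hMθ]
    refine (pow_le_pow_left₀ (norm_nonneg _) (norm_add_le _ _) 2).trans (add_sq_le.trans ?_)
    have l1 := pow_le_pow_left₀ (norm_nonneg _) (hns φ hφ) 2
    have l2 := hH2 φ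
    rw [← le_div_iff₀' (by positivity)] at l2
    calc _ ≤ 2 * ((D₁ / R ^ (q + 2)) ^ 2 + Q φ / P ^ 2) := by gcongr
      _ = _ := by ring
  have hmono : ∫ φ in (0 : ℝ)..2 * Real.pi, ‖G.tubeFourier a θ ε R φ‖ ^ 2 ≤
      ∫ φ in (0 : ℝ)..2 * Real.pi, (2 * (D₁ / R ^ (q + 2)) ^ 2 + 2 / P ^ 2 * Q φ) := by
    rw [intervalIntegral.integral_of_le (by positivity),
      intervalIntegral.integral_of_le (by positivity)]
    refine integral_mono_of_nonneg (Eventually.of_forall fun _ => by positivity) ?_ ?_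
    · exact (intervalIntegrable_iff_integrableOn_Ioc_of_le (by positivity)).1
        (Continuous.intervalIntegrable (by fun_prop) _ _)
    · exact (ae_restrict_iff' measurableSet_Ioc).2
        (Eventually.of_forall fun φ hφ => hpt φ (Ioc_subset_Icc_self hφ))
  refine hmono.trans ?_
  rw [intervalIntegral.integral_add (by simp) ((hQc.const_mul _).intervalIntegrable _ _),
    intervalIntegral.integral_const, intervalIntegral.integral_const_mul, smul_eq_mul, sub_zero]
  have hPP : P ^ 2 = (R * ε) ^ (2 * (q + 1)) := by rw [hP, ← pow_mul, mul_comm (q + 1)]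
  rw [← hPP]
  have hcomp : (D₁ / R ^ (q + 2)) ^ 2 ≤ D₁ ^ 2 * ρ ^ (2 * (q + 1)) / (R * P ^ 2) := by
    rw [div_pow, div_le_div_iff₀ (by positivity) (by positivity), mul_assoc]
    refine mul_le_mul_of_nonneg_left ?_ (sq_nonneg _)
    calc R * P ^ 2 = R ^ (2 * q + 3) * ε ^ (2 * (q + 1)) := by rw [hPP]; ring
      _ ≤ R ^ (2 * q + 4) * ρ ^ (2 * (q + 1)) := by
          have := hε.1.le
          have := hε.2
          gcongr
          omega
      _ = _ := by ring
  calc _ ≤ 2 * Real.pi * (2 * (D₁ ^ 2 * ρ ^ (2 * (q + 1)) / (R * P ^ 2))) +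
        2 / P ^ 2 * (D₂ / R) := by gcongr
    _ = _ := by field_simp; ring

end FramedCurve

/-! ### Parseval's identity on the unit cube and lattice sums -/

/-- The half-open unit square in coordinates. -/
def unitCube : Set (Fin 2 → ℝ) := {x | ∀ i, x i ∈ Ioc (0 : ℝ) 1}

theorem measurableSet_unitCube : MeasurableSet unitCube :=
  MeasurableSet.univ_pi' fun _ => measurableSet_Ioc

theorem volume_unitCube : volume unitCube = 1 := by
  have : unitCube = Set.pi univ fun _ => Ioc (0 : ℝ) 1 := by ext; simp [unitCube]
  rw [this, Real.volume_pi_Ioc]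
  simp

/-- Parseval on the torus, transported to the half-open square by choosing in each class the
representative with coordinates in (0, 1]. -/
theorem hasSum_sq_integral_unitCube {S : (Fin 2 → ℝ) → ℝ} (hS : Measurable S) {M : ℝ}
    (hM : ∀ x ∈ unitCube, |S x| ≤ M) :
    HasSum (fun n : Fin 2 → ℤ => ‖∫ x in unitCube,
      osc (-(2 * Real.pi * (n 0 * x 0 + n 1 * x 1))) * (S x : ℂ)‖ ^ 2)
      (∫ x in unitCube, S x ^ 2) := by
  let rep : UnitAddTorus (Fin 2) → (Fin 2 → ℝ) := fun x =>
    (UnitAddTorus.measurableEquivPiIoc (fun _ => 0) x).1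
  have hrep : Measurable rep :=
    measurable_subtype_coe.comp (UnitAddTorus.measurableEquivPiIoc fun _ => 0).measurable
  have hcube : {x : Fin 2 → ℝ | ∀ i, x i ∈ Ioc ((fun _ => 0 : Fin 2 → ℝ) i)
      ((fun _ => 0 : Fin 2 → ℝ) i + 1)} = unitCube := by simp [unitCube]
  have hmem : ∀ x, rep x ∈ unitCube := fun x => by
    have := (UnitAddTorus.measurableEquivPiIoc (fun _ => 0) x).2
    simpa [unitCube, rep] using this
  have hrepc : ∀ y ∈ unitCube, rep (fun i => (y i : UnitAddCircle)) = y := fun y hy => by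
    have := (UnitAddTorus.measurableEquivPiIoc (ι := Fin 2) (fun _ => 0)).apply_symm_apply
      ⟨y, by simpa [unitCube] using hy⟩
    exact congrArg Subtype.val this
  let f : UnitAddTorus (Fin 2) → ℂ := fun x => (S (rep x) : ℂ)
  have hf : Measurable f := Complex.measurable_ofReal.comp (hS.comp hrep)
  let _ : MeasureSpace UnitAddCircle := ⟨AddCircle.haarAddCircle⟩
  have : IsProbabilityMeasure (volume : Measure UnitAddCircle) :=
    inferInstanceAs (IsProbabilityMeasure AddCircle.haarAddCircle)
  have hLp : MemLp f 2 (volume : Measure (UnitAddTorus (Fin 2))) :=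
    MemLp.of_bound hf.aestronglyMeasurable M (Eventually.of_forall fun x => by
      simpa [f] using hM _ (hmem x))
  have hP := UnitAddTorus.hasSum_sq_mFourierCoeff (hLp.toLp f)
  have hae := hLp.coeFn_toLp
  have h1 : ∀ n : Fin 2 → ℤ, UnitAddTorus.mFourierCoeff (hLp.toLp f) n = ∫ x in unitCube,
      osc (-(2 * Real.pi * (n 0 * x 0 + n 1 * x 1))) * (S x : ℂ) := fun n => by
    have e : UnitAddTorus.mFourierCoeff (hLp.toLp f) n = UnitAddTorus.mFourierCoeff f n := by
      refine integral_congr_ae ?_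
      filter_upwards [hae] with x hx
      rw [hx]
    rw [e, UnitAddTorus.mFourierCoeff_eq_integral f n fun _ => 0, hcube]
    refine setIntegral_congr_fun measurableSet_unitCube fun y hy => ?_
    simp only [f, hrepc y hy, smul_eq_mul, UnitAddTorus.mFourier, ContinuousMap.coe_mk,
      Fin.prod_univ_two, fourier_coe_apply]
    rw [← Complex.exp_add, osc]
    congr 2
    push_cast
    simp
    ring
  have h2 : ∫ x, ‖(hLp.toLp f) x‖ ^ 2 = ∫ x in unitCube, S x ^ 2 := by
    have e : ∫ x, ‖(hLp.toLp f) x‖ ^ 2 = ∫ x, ‖f x‖ ^ 2 := by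
      refine integral_congr_ae ?_
      filter_upwards [hae] with x hx
      rw [hx]
    rw [e]
    have := UnitAddTorus.integral_preimage (fun x => ‖f x‖ ^ 2) (fun _ : Fin 2 => 0)
    rw [hcube] at this
    refine this.trans (setIntegral_congr_fun measurableSet_unitCube fun y hy => ?_)
    simp [f, hrepc y hy]
  simp only [h1, h2] at hP
  exact hP

/-- The unfolding step of Poisson summation: integer translates of the half-open square tile the
plane. -/
theorem hasSum_integral_unitCube_sub {g : (Fin 2 → ℝ) → ℂ} (hg : Integrable g) :
    HasSum (fun w : Fin 2 → ℤ => ∫ y in unitCube, g (y - fun i => (w i : ℝ))) (∫ y, g y) := by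
  have hu : (⋃ w : Fin 2 → ℤ, (fun y : Fin 2 → ℝ => y + fun i => (w i : ℝ)) ⁻¹' unitCube) = univ := by
    rw [eq_univ_iff_forall]
    intro y
    rw [mem_iUnion]
    have h : ∀ i, ∃ n : ℤ, y i + n ∈ Ioc (0 : ℝ) 1 := fun i => by
      obtain ⟨n, hn, _⟩ := existsUnique_add_zsmul_mem_Ioc (zero_lt_one (α := ℝ)) (y i) 0
      exact ⟨n, by simpa using hn⟩
    choose n hn using h
    exact ⟨n, fun i => hn i⟩
  have hd : Pairwise (Function.onFun Disjoint fun w : Fin 2 → ℤ =>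
      (fun y : Fin 2 → ℝ => y + fun i => (w i : ℝ)) ⁻¹' unitCube) := by
    intro w w' hww
    refine disjoint_left.2 fun y hy hy' => hww (funext fun i => ?_)
    have h1 := hy i
    have h2 := hy' i
    simp only [Pi.add_apply, mem_Ioc] at h1 h2
    have e1 : (w i : ℝ) < w' i + 1 := by linarith
    have e2 : (w' i : ℝ) < w i + 1 := by linarith
    have e3 : w i < w' i + 1 := by exact_mod_cast e1
    have e4 : w' i < w i + 1 := by exact_mod_cast e2
    omega
  have := hasSum_integral_iUnion (μ := volume) (f := g) (fun w : Fin 2 → ℤ =>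
    measurableSet_unitCube.preimage (measurable_add_const fun i => (w i : ℝ))) hd
    (by rw [hu]; exact hg.integrableOn)
  rw [hu, setIntegral_univ] at this
  refine this.congr_fun fun w => ?_
  have hmp := measurePreserving_add_right (volume : Measure (Fin 2 → ℝ)) fun i => (w i : ℝ)
  have h := hmp.setIntegral_preimage_emb (measurableEmbedding_addRight _)
    (fun y => g (y - fun i => (w i : ℝ))) unitCube
  rw [← h]
  simp

/-- Only finitely many points of the lattice, shifted by a vector of the cell, lie in a ball. -/
theorem exists_finset_lattice {h : ℝ} (hh : 0 < h) (A : ℝ) :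
    ∃ W : Finset (Fin 2 → ℤ), ∀ ξ ∈ unitSquare, ∀ w ∉ W, A < ‖latticePoint h w - h • ξ‖ := by
  obtain ⟨N, hN⟩ := exists_nat_gt (A / h + 1)
  rw [← sub_pos] at hN
  refine ⟨Finset.Icc (fun _ => -(N : ℤ)) fun _ => (N : ℤ), fun ξ hξ w hw => ?_⟩
  have hex : ∃ i, (N : ℤ) < |w i| := by
    by_contra hcon
    push Not at hcon
    exact hw (Finset.mem_Icc.2 ⟨fun i => (abs_le.1 (hcon i)).1, fun i => (abs_le.1 (hcon i)).2⟩)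
  obtain ⟨i, hi⟩ := hex
  have hi' : (N : ℝ) < |(w i : ℝ)| := by exact_mod_cast hi
  have hle := PiLp.norm_apply_le (latticePoint h w - h • ξ) i
  have hval : (latticePoint h w - h • ξ) i = h * (w i - ξ i) := by
    fin_cases i <;> simp [latticePoint] <;> ring
  rw [hval, Real.norm_eq_abs, abs_mul, abs_of_pos hh] at hle
  refine lt_of_lt_of_le ?_ hle
  have hξi : |ξ i| ≤ 1 := abs_le.2 ⟨by linarith [(hξ i).1], (hξ i).2⟩
  have h3 : A / h < |(w i : ℝ) - ξ i| := by
    have := abs_sub_abs_le_abs_sub (w i : ℝ) (ξ i)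
    linarith
  rw [div_lt_iff₀ hh] at h3
  linarith

theorem toLp_mem_unitSquare {y : Fin 2 → ℝ} (hy : y ∈ unitCube) :
    WithLp.toLp 2 y ∈ unitSquare := fun i => Ioc_subset_Icc_self (hy i)

theorem setIntegral_unitSquare (u : Plane → ℝ) :
    ∫ ξ in unitSquare, u ξ = ∫ y in unitCube, u (WithLp.toLp 2 y) := by
  have h1 := (PiLp.volume_preserving_toLp (Fin 2)).setIntegral_preimage_emb
    (MeasurableEquiv.toLp 2 (Fin 2 → ℝ)).measurableEmbedding u unitSquare
  rw [← h1]
  refine setIntegral_congr_set ?_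
  have h2 := Measure.univ_pi_Ioc_ae_eq_Icc (μ := fun _ : Fin 2 => (volume : Measure ℝ))
    (f := fun _ => 0) (g := fun _ => 1)
  have e1 : Set.pi univ (fun _ : Fin 2 => Ioc (0 : ℝ) 1) = unitCube := by ext; simp [unitCube]
  have e2 : Icc (fun _ : Fin 2 => (0 : ℝ)) (fun _ => 1) = WithLp.toLp 2 ⁻¹' unitSquare := by
    ext y; simp [unitSquare, Pi.le_def, forall_and]
  rw [e1, e2] at h2
  exact h2.symm

/-- The lattice sum is a periodization in ξ, so unfolding identifies its Fourier coefficients with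
values of the Fourier transform of F on the dual lattice. Subtracting the mean deletes the zero
frequency from Parseval's identity. Only mean squares occur, so F need be no more than bounded,
measurable and of bounded support. -/
theorem hasSum_sq_latticeSum {F : Plane → ℝ} (hF : Measurable F) {M A : ℝ} (hM : ∀ x, |F x| ≤ M)
    (hA : ∀ x, A < ‖x‖ → F x = 0) {h : ℝ} (hh : 0 < h) :
    HasSum (fun k : Fin 2 → ℤ => if k = 0 then 0 else
      ‖∫ x : Plane, (F x : ℂ) * osc (2 * Real.pi / h * (k 0 * x 0 + k 1 * x 1))‖ ^ 2)
      (∫ ξ in unitSquare,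
        |h ^ 2 * ∑' w, F (latticePoint h w - h • ξ) - ∫ x : Plane, F x| ^ 2) := by
  obtain ⟨W, hW⟩ := exists_finset_lattice hh A
  -- One finite set of lattice points serves for all shifts in the square, so the series is a fixed
  -- finite sum there.
  let S : (Fin 2 → ℝ) → ℝ := fun y =>
    h ^ 2 * ∑ w ∈ W, F (latticePoint h w - h • (WithLp.toLp 2 y : Plane))
  have htoLp : Measurable (WithLp.toLp 2 : (Fin 2 → ℝ) → Plane) :=
    (MeasurableEquiv.toLp 2 (Fin 2 → ℝ)).measurable
  have hSm : Measurable S :=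
    (Finset.measurable_sum _ fun w _ => hF.comp (measurable_const.sub
      (htoLp.const_smul h))).const_mul _
  have hSb : ∀ y, |S y| ≤ h ^ 2 * (W.card • M) := fun y => by
    rw [abs_mul, abs_of_pos (by positivity : 0 < h ^ 2)]
    gcongr
    exact (Finset.abs_sum_le_sum_abs _ _).trans (Finset.sum_le_card_nsmul _ _ _ fun w _ => hM _)
  have hS : ∀ y ∈ unitCube,
      h ^ 2 * ∑' w, F (latticePoint h w - h • (WithLp.toLp 2 y : Plane)) = S y := fun y hy => by
    rw [tsum_eq_sum (s := W) fun w hw => hA _ (hW _ (toLp_mem_unitSquare hy) w hw)]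
  set I := ∫ x : Plane, F x with hI
  -- the Fourier coefficients
  have hcoef : ∀ k : Fin 2 → ℤ, ∫ y in unitCube,
      osc (-(2 * Real.pi * (k 0 * y 0 + k 1 * y 1))) * (S y : ℂ) =
      ∫ x : Plane, (F x : ℂ) * osc (2 * Real.pi / h * (k 0 * x 0 + k 1 * x 1)) := by
    intro k
    let Φ : (Fin 2 → ℝ) → ℂ := fun x =>
      (F (WithLp.toLp 2 x) : ℂ) * osc (2 * Real.pi / h * (k 0 * x 0 + k 1 * x 1))
    have hΦm : Measurable Φ := (Complex.measurable_ofReal.comp (hF.comp htoLp)).mul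
      (measurable_osc.comp (by fun_prop))
    have hΦi : Integrable Φ := by
      have hsupp : Function.support Φ ⊆ WithLp.toLp 2 ⁻¹' (Metric.closedBall (0 : Plane) A) := by
        intro x hx
        rw [mem_preimage, mem_closedBall_zero_iff]
        by_contra hcon
        exact hx (by simp [Φ, hA _ (not_le.1 hcon)])
      rw [← integrableOn_iff_integrable_of_support_subset hsupp]
      refine Measure.integrableOn_of_bounded (M := M) ?_ hΦm.aestronglyMeasurable
        (Eventually.of_forall fun x => by
          simp only [Φ, norm_mul, norm_osc, mul_one, Complex.norm_real]; exact hM _)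
      rw [(PiLp.volume_preserving_toLp (Fin 2)).measure_preimage
        measurableSet_closedBall.nullMeasurableSet]
      exact measure_closedBall_lt_top.ne
    -- The point hw - hy is -h(y - w), so each summand is a translate of a single function of y; h²
    -- is the Jacobian of the scaling.
    let g : (Fin 2 → ℝ) → ℂ := fun y => (h ^ 2 : ℝ) • Φ ((-h) • y)
    have hgi : Integrable g := ((hΦi.comp_smul (neg_ne_zero.2 hh.ne'))).smul (h ^ 2 : ℝ)
    have hgint : ∫ y, g y = ∫ x : Plane, (F x : ℂ) *
        osc (2 * Real.pi / h * (k 0 * x 0 + k 1 * x 1)) := by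
      simp only [g]
      rw [integral_smul, Measure.integral_comp_smul]
      have : |((-h) ^ Module.finrank ℝ (Fin 2 → ℝ))⁻¹| = (h ^ 2)⁻¹ := by
        simp [abs_of_pos hh]
      rw [this, smul_smul, mul_inv_cancel₀ (by positivity), one_smul]
      exact (PiLp.volume_preserving_toLp (Fin 2)).integral_comp
        (MeasurableEquiv.toLp 2 (Fin 2 → ℝ)).measurableEmbedding
        fun x : Plane => (F x : ℂ) * osc (2 * Real.pi / h * (k 0 * x 0 + k 1 * x 1))
    have hgw : ∀ (w : Fin 2 → ℤ) (y : Fin 2 → ℝ), g (y - fun i => (w i : ℝ)) =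
        osc (-(2 * Real.pi * (k 0 * y 0 + k 1 * y 1))) *
          ((h ^ 2 * F (latticePoint h w - h • (WithLp.toLp 2 y : Plane)) : ℝ) : ℂ) := by
      intro w y
      have e1 : (WithLp.toLp 2 ((-h) • (y - fun i => (w i : ℝ))) : Plane) =
          latticePoint h w - h • (WithLp.toLp 2 y : Plane) := by
        ext i
        fin_cases i <;> simp [latticePoint] <;> ring
      have e2 : osc (2 * Real.pi / h * (k 0 * ((-h) • (y - fun i => (w i : ℝ))) 0 +
          k 1 * ((-h) • (y - fun i => (w i : ℝ))) 1)) =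
          osc (-(2 * Real.pi * (k 0 * y 0 + k 1 * y 1))) := by
        have : 2 * Real.pi / h * (k 0 * ((-h) • (y - fun i => (w i : ℝ))) 0 +
          k 1 * ((-h) • (y - fun i => (w i : ℝ))) 1) =
          -(2 * Real.pi * (k 0 * y 0 + k 1 * y 1)) +
            ((k 0 * w 0 + k 1 * w 1 : ℤ) : ℝ) * (2 * Real.pi) := by
          simp only [Pi.smul_apply, Pi.sub_apply, smul_eq_mul]
          push_cast
          field_simp
          ring
        rw [this, osc_add]
        have h1 : osc (((k 0 * w 0 + k 1 * w 1 : ℤ) : ℝ) * (2 * Real.pi)) = 1 := by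
          rw [osc, Complex.exp_eq_one_iff]
          exact ⟨k 0 * w 0 + k 1 * w 1, by push_cast; ring⟩
        rw [h1, mul_one]
      simp only [g, Φ]
      rw [e1, e2, Complex.real_smul]
      push_cast
      ring
    have hsum := hasSum_integral_unitCube_sub hgi
    have hfin : ∀ w ∉ W, ∫ y in unitCube, g (y - fun i => (w i : ℝ)) = 0 := fun w hw => by
      rw [setIntegral_congr_fun (g := fun _ => (0 : ℂ)) measurableSet_unitCube fun y hy => ?_]
      · simp
      · simp only [hgw, hA _ (hW _ (toLp_mem_unitSquare hy) w hw)]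
        simp
    rw [← hgint, hsum.unique (hasSum_sum_of_ne_finset_zero hfin), ← integral_finsetSum]
    · refine setIntegral_congr_fun measurableSet_unitCube fun y _ => ?_
      simp only [hgw, S]
      rw [← Finset.mul_sum, Finset.mul_sum]
      push_cast
      rfl
    · intro w _
      have : Integrable fun y => g (y - fun i => (w i : ℝ)) := hgi.comp_sub_right _
      exact this.integrableOn
  have hpars := hasSum_sq_integral_unitCube hSm fun y _ => hSb y
  simp only [hcoef] at hpars
  have hSi : IntegrableOn S unitCube := Measure.integrableOn_of_bounded
    (by rw [volume_unitCube]; simp) hSm.aestronglyMeasurable (Eventually.of_forall hSb)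
  have hS2i : IntegrableOn (fun y => S y ^ 2) unitCube := Measure.integrableOn_of_bounded
    (M := (h ^ 2 * (W.card • M)) ^ 2)
    (by rw [volume_unitCube]; simp) (hSm.pow_const 2).aestronglyMeasurable
    (Eventually.of_forall fun y => by
      rw [Real.norm_of_nonneg (sq_nonneg _), ← sq_abs]
      exact pow_le_pow_left₀ (abs_nonneg _) (hSb y) 2)
  have hmean : ∫ y in unitCube, S y = I := by
    have := hcoef 0
    simp only [Pi.zero_apply, Int.cast_zero, zero_mul, add_zero, mul_zero, neg_zero, osc_zero,
      one_mul, mul_one] at this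
    rw [integral_complex_ofReal, integral_complex_ofReal] at this
    exact_mod_cast this
  -- The variance is the second moment minus the squared mean, because the square has measure 1.
  have hvar : ∫ ξ in unitSquare, |h ^ 2 * ∑' w, F (latticePoint h w - h • ξ) - I| ^ 2 =
      (∫ y in unitCube, S y ^ 2) - I ^ 2 := by
    rw [setIntegral_unitSquare, setIntegral_congr_fun (g := fun y => S y ^ 2 - 2 * I * S y + I ^ 2)
      measurableSet_unitCube fun y hy => ?_]
    · rw [integral_add, integral_sub, integral_const_mul, hmean, setIntegral_const, Measure.real,
        volume_unitCube]
      · simp; ring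
      · exact hS2i
      · exact hSi.const_mul _
      · exact hS2i.sub (hSi.const_mul _)
      · exact integrableOn_const (by rw [volume_unitCube]; simp)
    · simp only [hS y hy, sq_abs]
      ring
  rw [hvar]
  have hzero : ‖∫ x : Plane, (F x : ℂ) *
      osc (2 * Real.pi / h * (((0 : Fin 2 → ℤ) 0 : ℤ) * x 0 + ((0 : Fin 2 → ℤ) 1 : ℤ) * x 1))‖ ^ 2
      = I ^ 2 := by
    simp only [Pi.zero_apply, Int.cast_zero, zero_mul, add_zero, mul_zero, osc_zero, mul_one]
    rw [integral_complex_ofReal, Complex.norm_real, Real.norm_eq_abs, sq_abs]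
  have := hpars.update 0 0
  rw [hzero] at this
  have e : (fun k : Fin 2 → ℤ => if k = 0 then 0 else
      ‖∫ x : Plane, (F x : ℂ) * osc (2 * Real.pi / h * (k 0 * x 0 + k 1 * x 1))‖ ^ 2) =
      Function.update (fun k : Fin 2 → ℤ =>
        ‖∫ x : Plane, (F x : ℂ) * osc (2 * Real.pi / h * (k 0 * x 0 + k 1 * x 1))‖ ^ 2) 0 0 := by
    ext k
    simp only [Function.update_apply]
  rw [e, sub_eq_neg_add, ← zero_sub]
  exact this

/-! ### The frame of a convex closed curve -/

theorem hasDerivAt_coord {u : ℝ → Plane} {u' : Plane} {t : ℝ} (h : HasDerivAt u u' t) (i : Fin 2) :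
    HasDerivAt (fun t => u t i) (u' i) t :=
  (EuclideanSpace.proj (𝕜 := ℝ) i).hasFDerivAt.comp_hasDerivAt t h

theorem norm_sq_plane (x : Plane) : ‖x‖ ^ 2 = x 0 ^ 2 + x 1 ^ 2 := by
  rw [EuclideanSpace.norm_sq_eq, Fin.sum_univ_two]
  simp

theorem inner_plane (x y : Plane) : inner ℝ x y = x 0 * y 0 + x 1 * y 1 := by
  rw [PiLp.inner_apply, Fin.sum_univ_two]
  simp [mul_comm]

theorem Function.Periodic.deriv_periodic {E : Type*} [NormedAddCommGroup E] [NormedSpace ℝ E]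
    {u : ℝ → E} {T : ℝ} (hu : Function.Periodic u T) : Function.Periodic (deriv u) T := fun t => by
  rw [← deriv_comp_add_const]
  congr 1
  exact funext hu

namespace IsConvexClosedCurve

variable {γ : ℝ → Plane} {T : ℝ} (hγ : IsConvexClosedCurve γ T)

include hγ

theorem contDiff_deriv : ContDiff ℝ ∞ (deriv γ) := (contDiff_infty_iff_deriv.1 hγ.smooth).2

theorem contDiff_deriv_deriv : ContDiff ℝ ∞ (deriv (deriv γ)) :=
  (contDiff_infty_iff_deriv.1 hγ.contDiff_deriv).2

theorem hasDerivAt (t : ℝ) : HasDerivAt γ (deriv γ t) t :=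
  (hγ.smooth.differentiable (by simp) t).hasDerivAt

theorem hasDerivAt_deriv (t : ℝ) : HasDerivAt (deriv γ) (deriv (deriv γ) t) t :=
  (hγ.contDiff_deriv.differentiable (by simp) t).hasDerivAt

theorem speed_pos (t : ℝ) : 0 < ‖deriv γ t‖ := norm_pos_iff.2 (hγ.regular t)

theorem contDiff_speed : ContDiff ℝ ∞ fun t => ‖deriv γ t‖ :=
  hγ.contDiff_deriv.norm ℝ hγ.regular

theorem contDiff_curvature : ContDiff ℝ ∞ (curvature γ) := by
  have h1 := contDiff_euclidean.1 hγ.contDiff_deriv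
  have h2 := contDiff_euclidean.1 hγ.contDiff_deriv_deriv
  have e1 := h1 0
  have e2 := h1 1
  have e3 := h2 0
  have e4 := h2 1
  exact ((e1.mul e4).sub (e2.mul e3)).div (hγ.contDiff_speed.pow 3)
    fun t => (pow_pos (hγ.speed_pos t) 3).ne'

theorem periodic_curvature : Function.Periodic (curvature γ) T := fun t => by
  have h1 := hγ.periodic.deriv_periodic
  simp only [curvature, h1 t, h1.deriv_periodic t]

theorem hasDerivAt_speed (t : ℝ) : HasDerivAt (fun t => ‖deriv γ t‖)
    ((deriv γ t 0 * deriv (deriv γ) t 0 + deriv γ t 1 * deriv (deriv γ) t 1) / ‖deriv γ t‖) t := by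
  have h := (hγ.contDiff_speed.differentiable (by simp) t).hasDerivAt
  refine h.congr_deriv ?_
  have h0 := hasDerivAt_coord (hγ.hasDerivAt_deriv t) 0
  have h1 := hasDerivAt_coord (hγ.hasDerivAt_deriv t) 1
  have e1 := h.pow 2
  have e2 := (h0.pow 2).add (h1.pow 2)
  have e3 : ((fun t => ‖deriv γ t‖) ^ 2) =
      (fun t => deriv γ t 0) ^ 2 + (fun t => deriv γ t 1) ^ 2 :=
    funext fun t => norm_sq_plane _
  rw [e3] at e1
  have := e1.unique e2
  rw [eq_div_iff (hγ.speed_pos t).ne']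
  simp only [Nat.cast_ofNat, pow_one, Nat.add_one_sub_one] at this
  linarith

/-- The curve in coordinates, with its unit tangent and curvature. -/
def framedCurve : FramedCurve where
  T := T
  X t := γ t 0
  Y t := γ t 1
  c₀ t := deriv γ t 0 / ‖deriv γ t‖
  c₁ t := deriv γ t 1 / ‖deriv γ t‖
  v t := ‖deriv γ t‖
  κ := curvature γ
  T_pos := hγ.period_pos
  contDiff_X := contDiff_euclidean.1 hγ.smooth 0
  contDiff_Y := contDiff_euclidean.1 hγ.smooth 1
  contDiff_c₀ := (contDiff_euclidean.1 hγ.contDiff_deriv 0).div hγ.contDiff_speed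
    fun t => (hγ.speed_pos t).ne'
  contDiff_c₁ := (contDiff_euclidean.1 hγ.contDiff_deriv 1).div hγ.contDiff_speed
    fun t => (hγ.speed_pos t).ne'
  contDiff_v := hγ.contDiff_speed
  continuous_κ := hγ.contDiff_curvature.continuous
  periodic_X t := by simp only [hγ.periodic t]
  periodic_Y t := by simp only [hγ.periodic t]
  periodic_c₀ t := by simp only [hγ.periodic.deriv_periodic t]
  periodic_c₁ t := by simp only [hγ.periodic.deriv_periodic t]
  v_pos := hγ.speed_pos
  unit t := by
    have := hγ.speed_pos t
    rw [div_pow, div_pow, ← add_div, ← norm_sq_plane, div_self (by positivity)]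
  hasDerivAt_X t := (hasDerivAt_coord (hγ.hasDerivAt t) 0).congr_deriv
    (mul_div_cancel₀ _ (hγ.speed_pos t).ne').symm
  hasDerivAt_Y t := (hasDerivAt_coord (hγ.hasDerivAt t) 1).congr_deriv
    (mul_div_cancel₀ _ (hγ.speed_pos t).ne').symm
  hasDerivAt_c₀ t := by
    have h := (hasDerivAt_coord (hγ.hasDerivAt_deriv t) 0).div (hγ.hasDerivAt_speed t)
      (hγ.speed_pos t).ne'
    refine h.congr_deriv ?_
    have hv := hγ.speed_pos t
    have h2 := norm_sq_plane (deriv γ t)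
    simp only [curvature, cross]
    field_simp
    rw [h2]
    ring
  hasDerivAt_c₁ t := by
    have h := (hasDerivAt_coord (hγ.hasDerivAt_deriv t) 1).div (hγ.hasDerivAt_speed t)
      (hγ.speed_pos t).ne'
    refine h.congr_deriv ?_
    have hv := hγ.speed_pos t
    have h2 := norm_sq_plane (deriv γ t)
    simp only [curvature, cross]
    field_simp
    rw [h2]
    ring

/-- The distance of the curve from its tangent line at t is nonnegative and vanishes at t. A
negative second derivative would make t a local maximum as well, so the distance would vanish nearby
and its second derivative with it. -/
theorem curvature_nonneg (t : ℝ) : 0 ≤ curvature γ t := by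
  refine div_nonneg ?_ (by positivity)
  set g : ℝ → ℝ := fun s => cross (deriv γ t) (γ s - γ t) with hg
  have h1 : ∀ s, HasDerivAt g (cross (deriv γ t) (deriv γ s)) s := fun s => by
    have h0 := hasDerivAt_coord (hγ.hasDerivAt s) 0
    have h1 := hasDerivAt_coord (hγ.hasDerivAt s) 1
    have := ((h1.sub_const (γ t 1)).const_mul (deriv γ t 0)).sub
      ((h0.sub_const (γ t 0)).const_mul (deriv γ t 1))
    exact this
  have hd1 : deriv g = fun s => cross (deriv γ t) (deriv γ s) := funext fun s => (h1 s).deriv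
  have h2 : HasDerivAt (deriv g) (cross (deriv γ t) (deriv (deriv γ) t)) t := by
    rw [hd1]
    have h0 := hasDerivAt_coord (hγ.hasDerivAt_deriv t) 0
    have h1 := hasDerivAt_coord (hγ.hasDerivAt_deriv t) 1
    exact (h1.const_mul (deriv γ t 0)).sub (h0.const_mul (deriv γ t 1))
  by_contra hneg
  push Not at hneg
  have hmax : IsLocalMax g t := isLocalMax_of_deriv_deriv_neg (by rw [h2.deriv]; exact hneg)
    (by rw [hd1]; simp [cross]; ring) (h1 t).continuousAt
  have hgt : g t = 0 := by simp [hg, cross]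
  have hz : g =ᶠ[𝓝 t] fun _ => 0 := by
    filter_upwards [hmax] with s hs
    exact le_antisymm (hgt ▸ hs) (hγ.convex s t)
  have := hz.deriv.deriv_eq
  rw [h2.deriv] at this
  simp at this
  linarith

/-- Since the curvature is nonnegative the worst case is σ = -ρ, where the speed of the parallel
curve is positive, continuous and periodic in t. -/
theorem exists_speed_bound {ρ : ℝ} (hκ : ∀ t, ρ * curvature γ t < 1) :
    ∃ w₀ > 0, ∀ σ ∈ Icc (-ρ) ρ, ∀ t,
      w₀ ≤ hγ.framedCurve.v t * (1 + σ * hγ.framedCurve.κ t) := by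
  have hc : Continuous fun t => ‖deriv γ t‖ * (1 - ρ * curvature γ t) :=
    hγ.contDiff_speed.continuous.mul
      (continuous_const.sub (continuous_const.mul hγ.contDiff_curvature.continuous))
  obtain ⟨t₀, _, ht₀⟩ := (isCompact_Icc (a := 0) (b := T)).exists_isMinOn
    ⟨0, ⟨le_rfl, hγ.period_pos.le⟩⟩ hc.continuousOn
  refine ⟨_, mul_pos (hγ.speed_pos t₀) (sub_pos.2 (hκ t₀)), fun σ hσ t => ?_⟩
  have hper : Function.Periodic (fun t => ‖deriv γ t‖ * (1 - ρ * curvature γ t)) T := fun t => by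
    simp only [hγ.periodic.deriv_periodic t, hγ.periodic_curvature t]
  obtain ⟨s, hs, hst⟩ := hper.exists_mem_Ico₀ hγ.period_pos t
  have h1 := isMinOn_iff.1 ht₀ s (Ico_subset_Icc_self hs)
  rw [← hst] at h1
  refine h1.trans ?_
  have := hγ.curvature_nonneg t
  change ‖deriv γ t‖ * (1 - ρ * curvature γ t) ≤ ‖deriv γ t‖ * (1 + σ * curvature γ t)
  refine mul_le_mul_of_nonneg_left ?_ (norm_nonneg _)
  nlinarith [hσ.1]

end IsConvexClosedCurve

/-! ### Tube coordinates -/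

namespace IsConvexClosedCurve

variable {γ : ℝ → Plane} {T : ℝ} (hγ : IsConvexClosedCurve γ T)

include hγ

theorem outwardNormal_zero (t : ℝ) : outwardNormal γ t 0 = hγ.framedCurve.c₁ t := by
  simp [outwardNormal, framedCurve, div_eq_inv_mul]

theorem outwardNormal_one (t : ℝ) : outwardNormal γ t 1 = -hγ.framedCurve.c₀ t := by
  simp [outwardNormal, framedCurve, div_eq_inv_mul]

theorem norm_outwardNormal (t : ℝ) : ‖outwardNormal γ t‖ = 1 := by
  have h := norm_sq_plane (outwardNormal γ t)
  rw [hγ.outwardNormal_zero, hγ.outwardNormal_one, neg_sq, add_comm, hγ.framedCurve.unit t] at h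
  nlinarith [norm_nonneg (outwardNormal γ t)]

theorem inner_outwardNormal_deriv (t : ℝ) : inner ℝ (outwardNormal γ t) (deriv γ t) = 0 := by
  rw [inner_plane, hγ.outwardNormal_zero, hγ.outwardNormal_one]
  simp only [framedCurve]
  ring

theorem inner_outwardNormal_nonneg (t t' : ℝ) :
    0 ≤ inner ℝ (outwardNormal γ t) (γ t - γ t') := by
  have h := hγ.convex t' t
  have hv := hγ.speed_pos t
  have e : inner ℝ (outwardNormal γ t) (γ t - γ t') =
      cross (deriv γ t) (γ t' - γ t) / ‖deriv γ t‖ := by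
    rw [inner_plane, hγ.outwardNormal_zero, hγ.outwardNormal_one]
    simp only [framedCurve, cross, PiLp.sub_apply]
    field_simp
    ring
  rw [e]
  positivity

theorem periodic_outwardNormal : Function.Periodic (outwardNormal γ) T := fun t => by
  simp only [outwardNormal, hγ.periodic.deriv_periodic t]

theorem exists_zsmul_of_eq {a b : ℝ} (h : γ a = γ b) : ∃ n : ℤ, a = b + n • T := by
  obtain ⟨n, hn, _⟩ := existsUnique_add_zsmul_mem_Ico hγ.period_pos a 0
  obtain ⟨m, hm, _⟩ := existsUnique_add_zsmul_mem_Ico hγ.period_pos b 0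
  rw [zero_add] at hn hm
  have := hγ.simple hn hm (by rw [hγ.periodic.zsmul n a, hγ.periodic.zsmul m b, h])
  exact ⟨m - n, by rw [sub_smul]; linarith⟩

theorem norm_parallelCurve_sub_sq (t s t' : ℝ) :
    ‖parallelCurve γ s t - γ t'‖ ^ 2 =
      ‖γ t - γ t'‖ ^ 2 + 2 * s * inner ℝ (outwardNormal γ t) (γ t - γ t') + s ^ 2 := by
  have : parallelCurve γ s t - γ t' = (γ t - γ t') + s • outwardNormal γ t := by
    simp only [parallelCurve]; abel
  rw [this, norm_add_sq_real, norm_smul, hγ.norm_outwardNormal, real_inner_smul_right,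
    real_inner_comm]
  simp
  ring

theorem norm_parallelCurve_sub (t s : ℝ) : ‖parallelCurve γ s t - γ t‖ = |s| := by
  simp [parallelCurve, norm_smul, hγ.norm_outwardNormal]

/-- The disc of radius `s` that touches the curve from inside contains no point of the curve if
this is so near the point of contact. -/
theorem eventually_two_mul_inner_le {ρ : ℝ} (hκ : ∀ t, ρ * curvature γ t < 1) (t : ℝ) :
    ∀ᶠ t' in 𝓝 t, 2 * ρ * inner ℝ (outwardNormal γ t) (γ t - γ t') ≤ ‖γ t - γ t'‖ ^ 2 := by
  set g : ℝ → ℝ := fun t' =>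
    ‖γ t - γ t'‖ ^ 2 - 2 * ρ * inner ℝ (outwardNormal γ t) (γ t - γ t') with hg
  have hsub : ∀ t', HasDerivAt (fun t' => γ t - γ t') (-deriv γ t') t' := fun t' =>
    (hγ.hasDerivAt t').const_sub (γ t)
  have h1 : ∀ t', HasDerivAt g (2 * inner ℝ (γ t - γ t') (-deriv γ t') -
      2 * ρ * inner ℝ (outwardNormal γ t) (-deriv γ t')) t' := fun t' => by
    have := (hsub t').norm_sq.sub
      (((hasDerivAt_const t' (outwardNormal γ t)).inner ℝ (hsub t')).const_mul (2 * ρ))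
    refine this.congr_deriv ?_
    simp
  have hd : deriv g = fun t' => 2 * inner ℝ (γ t - γ t') (-deriv γ t') -
      2 * ρ * inner ℝ (outwardNormal γ t) (-deriv γ t') := funext fun t' => (h1 t').deriv
  have h2 : HasDerivAt (deriv g) (2 * ‖deriv γ t‖ ^ 2 * (1 - ρ * curvature γ t)) t := by
    rw [hd]
    have hdd : HasDerivAt (fun t' => -deriv γ t') (-deriv (deriv γ) t) t :=
      (hγ.hasDerivAt_deriv t).neg
    have := (((hsub t).inner ℝ hdd).const_mul 2).sub
      (((hasDerivAt_const t (outwardNormal γ t)).inner ℝ hdd).const_mul (2 * ρ))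
    refine this.congr_deriv ?_
    have hv := hγ.speed_pos t
    rw [sub_self, inner_zero_left, inner_zero_left, inner_neg_neg, real_inner_self_eq_norm_sq,
      inner_neg_right, inner_plane, hγ.outwardNormal_zero, hγ.outwardNormal_one]
    simp only [framedCurve, curvature, cross]
    field_simp
    ring
  have hmin : IsLocalMin g t := isLocalMin_of_deriv_deriv_pos (by
      rw [h2.deriv]
      have := hγ.speed_pos t
      have := sub_pos.2 (hκ t)
      positivity) (by
      rw [hd]
      simp [hγ.inner_outwardNormal_deriv]) (h1 t).continuousAt
  filter_upwards [hmin] with t' ht'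
  simp only [hg, sub_self, norm_zero, inner_zero_right] at ht'
  linarith

/-- The inner tangent disc of radius ρ at γ t has no point of the curve in its interior. Otherwise
shrink it until its interior just becomes free of such points. By the local estimate the curve then
touches it at a second point away from t, so its centre, which lies in the tube, has two closest
points. -/
theorem two_mul_inner_le {ρ : ℝ} (hρ : IsTubeWidth γ ρ) (t t' : ℝ) :
    2 * ρ * inner ℝ (outwardNormal γ t) (γ t - γ t') ≤ ‖γ t - γ t'‖ ^ 2 := by
  obtain ⟨hρ0, huniq, hκ⟩ := hρ
  set m : ℝ → ℝ := fun t' => inner ℝ (outwardNormal γ t) (γ t - γ t') with hm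
  set q : ℝ → ℝ := fun t' => ‖γ t - γ t'‖ ^ 2 with hq
  have hm0 : ∀ t', 0 ≤ m t' := hγ.inner_outwardNormal_nonneg t
  have hq0 : ∀ t', 0 ≤ q t' := fun t' => sq_nonneg _
  have hmT : Function.Periodic m T := fun t' => by simp only [hm, hγ.periodic t']
  have hqT : Function.Periodic q T := fun t' => by simp only [hq, hγ.periodic t']
  have hγc : Continuous γ := hγ.smooth.continuous
  have hmc : Continuous m := by simp only [hm]; fun_prop
  have hqc : Continuous q := by simp only [hq]; fun_prop
  obtain ⟨δ, hδ, hnear⟩ := Metric.eventually_nhds_iff.1 (hγ.eventually_two_mul_inner_le hκ t)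
  change ∀ ⦃t'⦄, dist t' t < δ → 2 * ρ * m t' ≤ q t' at hnear
  set K := Icc (t + δ) (t + T - δ) with hK
  -- A periodic property need only be checked near t and on the rest K of one period.
  have hcover : ∀ P : ℝ → Prop, (∀ t', P (t' + T) ↔ P t') → (∀ t', dist t' t < δ → P t') →
      (∀ t' ∈ K, P t') → ∀ t', P t' := by
    intro P hP hP1 hP2 t'
    obtain ⟨n, hn, _⟩ := existsUnique_add_zsmul_mem_Ico hγ.period_pos t' t
    have hper : Function.Periodic P T := fun t' => propext (hP t')
    rw [← hper.zsmul n t']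
    rcases lt_or_ge (t' + n • T) (t + δ) with h1 | h1
    · exact hP1 _ (by rw [Real.dist_eq, abs_lt]; constructor <;> linarith [hn.1])
    rcases lt_or_ge (t + T - δ) (t' + n • T) with h2 | h2
    · rw [← sub_add_cancel (t' + n • T) T, hP]
      exact hP1 _ (by rw [Real.dist_eq, abs_lt]; constructor <;> linarith [hn.2])
    · exact hP2 _ ⟨h1, h2⟩
  have hqK : ∀ t' ∈ K, 0 < q t' := fun t' ht' => by
    refine pow_pos (norm_pos_iff.2 (sub_ne_zero.2 fun heq => ?_)) 2
    obtain ⟨n, hn⟩ := hγ.exists_zsmul_of_eq heq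
    rw [zsmul_eq_mul] at hn
    have hT := hγ.period_pos
    have h1 : (-1 : ℝ) < n := by
      by_contra hcon
      nlinarith [ht'.1, ht'.2]
    have h2 : (n : ℝ) < 0 := by
      by_contra hcon
      nlinarith [ht'.1, ht'.2]
    have h3 : (-1 : ℤ) < n := by exact_mod_cast h1
    have h4 : n < 0 := by exact_mod_cast h2
    omega
  refine hcover (fun t' => 2 * ρ * m t' ≤ q t') (fun t' => by simp only [hmT t', hqT t']) hnear
    (fun t₁ ht₁ => ?_) t'
  by_contra hcon
  push Not at hcon
  obtain ⟨a, haK, hamax⟩ := (isCompact_Icc : IsCompact K).exists_isMaxOn ⟨t₁, ht₁⟩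
    (hmc.continuousOn.div hqc.continuousOn fun t' ht' => (hqK t' ht').ne')
  have hmax : ∀ t' ∈ K, m t' / q t' ≤ m a / q a := isMaxOn_iff.1 hamax
  set μ := m a / q a with hμ
  have hμ1 : 1 < 2 * ρ * μ := by
    have h1 := hmax t₁ ht₁
    have h2 : 1 < 2 * ρ * (m t₁ / q t₁) := by
      rw [← mul_div_assoc, lt_div_iff₀ (hqK t₁ ht₁), one_mul]; exact hcon
    exact h2.trans_le (by gcongr)
  have hμ0 : 0 < μ := by
    by_contra hneg
    nlinarith
  -- The radius at which the shrunken disc touches the curve at γ a; maximality of μ keeps all other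
  -- points out of its interior.
  set s := (2 * μ)⁻¹ with hs
  have hs0 : 0 < s := by positivity
  have hsρ : s < ρ := by
    rw [hs, inv_lt_comm₀ (by positivity) hρ0, inv_lt_iff_one_lt_mul₀ hρ0]
    linarith
  have hall : ∀ t', 2 * s * m t' ≤ q t' := by
    refine hcover (fun t' => 2 * s * m t' ≤ q t') (fun t' => by simp only [hmT t', hqT t'])
      (fun t' ht' => ?_) fun t' ht' => ?_
    · refine le_trans ?_ (hnear ht')
      have := hm0 t'
      gcongr
    · have := hmax t' ht'
      rw [div_le_iff₀ (hqK t' ht')] at this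
      have e : 2 * s * μ = 1 := by rw [hs]; field_simp
      calc 2 * s * m t' ≤ 2 * s * (μ * q t') := by gcongr
        _ = q t' := by rw [← mul_assoc, e, one_mul]
  have heq : 2 * s * m a = q a := by
    rw [hs, hμ]
    have := (hqK a haK).ne'
    have hma : m a ≠ 0 := by
      intro h0
      rw [hμ, h0, zero_div] at hμ0
      exact lt_irrefl _ hμ0
    field_simp
  set x := parallelCurve γ (-s) t with hx
  have hdist : ∀ t', dist x (γ t') ^ 2 = q t' - 2 * s * m t' + s ^ 2 := fun t' => by
    rw [dist_eq_norm, hx, hγ.norm_parallelCurve_sub_sq]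
    simp only [hm, hq]
    ring
  have hge : ∀ t', s ≤ dist x (γ t') := fun t' =>
    (sq_le_sq₀ hs0.le dist_nonneg).1 (by rw [hdist]; linarith [hall t'])
  have hxa : dist x (γ a) = s :=
    (sq_eq_sq₀ dist_nonneg hs0.le).1 (by rw [hdist]; linarith)
  have hxt : dist x (γ t) = s := by
    rw [dist_eq_norm, hx, hγ.norm_parallelCurve_sub, abs_neg, abs_of_pos hs0]
  have hinf : Metric.infDist x (range γ) = s := le_antisymm
    ((Metric.infDist_le_dist_of_mem (mem_range_self t)).trans hxt.le)
    ((Metric.le_infDist (range_nonempty γ)).2 (by rintro _ ⟨t', rfl⟩; exact hge t'))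
  obtain ⟨y, _, hy⟩ := huniq x (by simp only [tube, mem_ofPred_eq, hinf]; exact hsρ.le)
  have e1 := hy (γ a) ⟨mem_range_self a, by rw [hxa, hinf]⟩
  have e2 := hy (γ t) ⟨mem_range_self t, by rw [hxt, hinf]⟩
  have := hqK a haK
  simp [hq, e1, e2] at this

/-- Outside the curve (s ≥ 0) convexity shows that γ t is a closest point; inside (s ≤ 0) it is the
tangent disc of radius ρ. -/
theorem infDist_parallelCurve {ρ : ℝ} (hρ : IsTubeWidth γ ρ) {s : ℝ} (hs : s ∈ Icc (-ρ) ρ) (t : ℝ) :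
    Metric.infDist (parallelCurve γ s t) (range γ) = |s| := by
  refine le_antisymm ((Metric.infDist_le_dist_of_mem (mem_range_self t)).trans ?_)
    ((Metric.le_infDist (range_nonempty γ)).2 ?_)
  · rw [dist_eq_norm, hγ.norm_parallelCurve_sub]
  · rintro _ ⟨t', rfl⟩
    rw [dist_eq_norm]
    refine (sq_le_sq₀ (abs_nonneg _) (norm_nonneg _)).1 ?_
    rw [sq_abs, hγ.norm_parallelCurve_sub_sq]
    have h1 := hγ.inner_outwardNormal_nonneg t t'
    have h2 := hγ.two_mul_inner_le hρ t t'
    rcases le_total 0 s with h | h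
    · have : 0 ≤ 2 * s * inner ℝ (outwardNormal γ t) (γ t - γ t') := by positivity
      nlinarith [sq_nonneg ‖γ t - γ t'‖]
    · nlinarith [hs.1]

theorem isCompact_range : IsCompact (range γ) := by
  rw [← hγ.periodic.image_Icc hγ.period_pos 0]
  exact isCompact_Icc.image hγ.smooth.continuous

/-- A closest point exists by compactness, and the first order condition there puts x on the normal
line. -/
theorem exists_eq_parallelCurve {ε : ℝ} {x : Plane} (hx : x ∈ tube γ ε) :
    ∃ t ∈ Ico 0 T, ∃ s ∈ Icc (-ε) ε, x = parallelCurve γ s t := by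
  obtain ⟨y, ⟨t₀, rfl⟩, hy⟩ := hγ.isCompact_range.exists_infDist_eq_dist (range_nonempty γ) x
  obtain ⟨t, ht, htt⟩ := hγ.periodic.exists_mem_Ico₀ hγ.period_pos t₀
  rw [htt] at hy
  have hmin : ∀ t', ‖x - γ t‖ ^ 2 ≤ ‖x - γ t'‖ ^ 2 := fun t' => by
    refine pow_le_pow_left₀ (norm_nonneg _) ?_ 2
    rw [← dist_eq_norm, ← dist_eq_norm, ← hy]
    exact Metric.infDist_le_dist_of_mem (mem_range_self t')
  have hder : HasDerivAt (fun t' => ‖x - γ t'‖ ^ 2) (2 * inner ℝ (x - γ t) (-deriv γ t)) t :=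
    ((hγ.hasDerivAt t).const_sub x).norm_sq
  have hcrit := (IsMinOn.isLocalMin (s := univ) (isMinOn_iff.2 fun t' _ => hmin t')
    univ_mem).hasDerivAt_eq_zero hder
  rw [inner_neg_right, inner_plane] at hcrit
  set s := inner ℝ (outwardNormal γ t) (x - γ t) with hs
  have hv := hγ.speed_pos t
  have hxs : x = parallelCurve γ s t := by
    have hunit := hγ.framedCurve.unit t
    have hc : (x - γ t) 0 * hγ.framedCurve.c₀ t + (x - γ t) 1 * hγ.framedCurve.c₁ t = 0 := by
      simp only [framedCurve]
      field_simp
      linarith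
    have h0 := hγ.outwardNormal_zero t
    have h1 := hγ.outwardNormal_one t
    have hs' : s = hγ.framedCurve.c₁ t * (x - γ t) 0 - hγ.framedCurve.c₀ t * (x - γ t) 1 := by
      rw [hs, inner_plane, h0, h1]; ring
    simp only [PiLp.sub_apply] at hc hs'
    ext i
    fin_cases i
    · simp only [parallelCurve, PiLp.add_apply, PiLp.smul_apply, smul_eq_mul, Fin.zero_eta]
      rw [h0, hs']
      linear_combination (-(x 0 - γ t 0)) * hunit + hγ.framedCurve.c₀ t * hc
    · simp only [parallelCurve, PiLp.add_apply, PiLp.smul_apply, smul_eq_mul, Fin.mk_one]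
      rw [h1, hs']
      linear_combination (-(x 1 - γ t 1)) * hunit + hγ.framedCurve.c₁ t * hc
  refine ⟨t, ht, s, abs_le.1 ?_, hxs⟩
  have : dist x (γ t) = |s| := by rw [hxs, dist_eq_norm, hγ.norm_parallelCurve_sub]
  rw [← this, ← hy]
  exact hx

theorem parallelCurve_mem_tube_iff {ρ : ℝ} (hρ : IsTubeWidth γ ρ) {s ε : ℝ} (hs : s ∈ Icc (-ρ) ρ)
    (t : ℝ) : parallelCurve γ s t ∈ tube γ ε ↔ |s| ≤ ε := by
  simp only [tube, mem_ofPred_eq, hγ.infDist_parallelCurve hρ hs]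

/-- The foot parameter is an arbitrary choice and is determined only modulo the period, which
suffices because all it is used for is periodic. -/
theorem footParam_parallelCurve {ρ : ℝ} (hρ : IsTubeWidth γ ρ) {s : ℝ} (hs : s ∈ Icc (-ρ) ρ)
    (t : ℝ) : ∃ n : ℤ, footParam γ (parallelCurve γ s t) = t + n • T := by
  set x := parallelCurve γ s t with hx
  have hxt : dist x (γ t) = Metric.infDist x (range γ) := by
    rw [hγ.infDist_parallelCurve hρ hs, dist_eq_norm, hγ.norm_parallelCurve_sub]
  have hfoot : dist x (γ (footParam γ x)) = Metric.infDist x (range γ) :=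
    Classical.epsilon_spec (p := fun t => dist x (γ t) = Metric.infDist x (range γ)) ⟨t, hxt⟩
  obtain ⟨y, _, hy⟩ := hρ.2.1 x ((hγ.parallelCurve_mem_tube_iff hρ hs t).2 (abs_le.2 hs))
  refine hγ.exists_zsmul_of_eq ?_
  rw [hy _ ⟨mem_range_self _, hfoot⟩, hy _ ⟨mem_range_self t, hxt⟩]

theorem injOn_parallelCurve {ρ : ℝ} (hρ : IsTubeWidth γ ρ) :
    InjOn (fun p : ℝ × ℝ => parallelCurve γ p.2 p.1) (Ico 0 T ×ˢ Icc (-ρ) ρ) := by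
  rintro ⟨t, s⟩ ⟨ht, hs⟩ ⟨t', s'⟩ ⟨ht', hs'⟩ h
  dsimp only at h ht hs ht' hs'
  obtain ⟨n, hn⟩ := hγ.footParam_parallelCurve hρ hs t
  obtain ⟨n', hn'⟩ := hγ.footParam_parallelCurve hρ hs' t'
  have htt : t = t' := by
    refine hγ.simple ht ht' ?_
    rw [← hγ.periodic.zsmul n t, ← hγ.periodic.zsmul n' t', ← hn, ← hn', h]
  subst htt
  have hss : s • outwardNormal γ t = s' • outwardNormal γ t := add_left_cancel h
  have hne : outwardNormal γ t ≠ 0 := fun h0 => by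
    have := hγ.norm_outwardNormal t
    rw [h0, norm_zero] at this
    exact zero_ne_one this
  rw [smul_left_injective ℝ hne hss]

end IsConvexClosedCurve

/-! ### Jacobian of the tube coordinates and the scaled integral. -/

namespace FramedCurve

variable (G : FramedCurve)

/-- The tube coordinates `(t, s) ↦ γ t + s n t`. -/
def tubeMap (p : ℝ × ℝ) : ℝ × ℝ := (G.X p.1 + p.2 * G.c₁ p.1, G.Y p.1 - p.2 * G.c₀ p.1)

/-- The derivative of the tube coordinates. -/
def tubeMapDeriv (p : ℝ × ℝ) : ℝ × ℝ →L[ℝ] ℝ × ℝ :=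
  (Matrix.toLin (.finTwoProd ℝ) (.finTwoProd ℝ)
    !![G.v p.1 * (1 + p.2 * G.κ p.1) * G.c₀ p.1, G.c₁ p.1;
      G.v p.1 * (1 + p.2 * G.κ p.1) * G.c₁ p.1, -G.c₀ p.1]).toContinuousLinearMap

theorem hasFDerivAt_tubeMap (p : ℝ × ℝ) : HasFDerivAt G.tubeMap (G.tubeMapDeriv p) p := by
  unfold tubeMapDeriv
  rw [Matrix.toLin_finTwoProd_toContinuousLinearMap]
  have hfst : HasFDerivAt Prod.fst (ContinuousLinearMap.fst ℝ ℝ ℝ) p := hasFDerivAt_fst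
  have hsnd : HasFDerivAt Prod.snd (ContinuousLinearMap.snd ℝ ℝ ℝ) p := hasFDerivAt_snd
  have hX := (G.hasDerivAt_X p.1).comp_hasFDerivAt p hfst
  have hY := (G.hasDerivAt_Y p.1).comp_hasFDerivAt p hfst
  have h0 := (G.hasDerivAt_c₀ p.1).comp_hasFDerivAt p hfst
  have h1 := (G.hasDerivAt_c₁ p.1).comp_hasFDerivAt p hfst
  refine ((hX.add (hsnd.mul h1)).prodMk (hY.sub (hsnd.mul h0))).congr_fderiv ?_
  ext <;> simp <;> ring

theorem abs_det_tubeMapDeriv {p : ℝ × ℝ} (hp : 0 ≤ 1 + p.2 * G.κ p.1) :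
    |(G.tubeMapDeriv p).det| = G.v p.1 * (1 + p.2 * G.κ p.1) := by
  have h : (G.tubeMapDeriv p).det = -(G.v p.1 * (1 + p.2 * G.κ p.1)) := by
    unfold tubeMapDeriv
    rw [ContinuousLinearMap.det, LinearMap.coe_toContinuousLinearMap, LinearMap.det_toLin,
      Matrix.det_fin_two_of]
    linear_combination (-(G.v p.1 * (1 + p.2 * G.κ p.1))) * G.unit p.1
  rw [h, abs_neg, abs_of_nonneg (mul_nonneg (G.v_pos _).le hp)]

theorem phase_eq_tubeMap (φ : ℝ) (p : ℝ × ℝ) :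
    Real.cos φ * (G.tubeMap p).1 + Real.sin φ * (G.tubeMap p).2 = G.phase p.2 φ p.1 := rfl

/-- The tube integral in the coordinates `(t, s)` is `tubeFourier`, with the width scaled out. -/
theorem setIntegral_scaledWeight_mul_osc {a θ : ℝ → ℝ} (ha : Continuous a) (hθ : Measurable θ)
    {Mθ : ℝ} (hMθ : ∀ s, |θ s| ≤ Mθ) {ε : ℝ} (hε0 : 0 < ε) (R φ : ℝ) :
    ∫ p in Ico 0 G.T ×ˢ Icc (-ε) ε, ((a p.1 * scaledWeight θ ε p.2 : ℝ) : ℂ) *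
      osc (R * G.phase p.2 φ p.1) = G.tubeFourier a θ ε R φ := by
  have hT := G.T_pos
  have hEm : MeasurableSet (Ico 0 G.T ×ˢ Icc (-ε) ε) := measurableSet_Ico.prod measurableSet_Icc
  have hosc : Measurable fun p : ℝ × ℝ => osc (R * G.phase p.2 φ p.1) := by
    have : Continuous fun p : ℝ × ℝ => G.phase p.2 φ p.1 := by
      have hX := G.contDiff_X.continuous
      have hY := G.contDiff_Y.continuous
      have h0 := G.contDiff_c₀.continuous
      have h1 := G.contDiff_c₁.continuous
      unfold FramedCurve.phase; fun_prop
    exact measurable_osc.comp (this.measurable.const_mul R)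
  have hw : Measurable fun p : ℝ × ℝ => a p.1 * scaledWeight θ ε p.2 :=
    (ha.measurable.comp measurable_fst).mul
      ((hθ.comp (measurable_snd.const_mul ε⁻¹)).const_mul ε⁻¹)
  have hum : Measurable fun p : ℝ × ℝ => ((a p.1 * scaledWeight θ ε p.2 : ℝ) : ℂ) *
      osc (R * G.phase p.2 φ p.1) := (Complex.measurable_ofReal.comp hw).mul hosc
  have hui : IntegrableOn (fun p : ℝ × ℝ => ((a p.1 * scaledWeight θ ε p.2 : ℝ) : ℂ) *
      osc (R * G.phase p.2 φ p.1)) (Ico 0 G.T ×ˢ Icc (-ε) ε) := by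
    obtain ⟨M, hM⟩ := (isCompact_Icc (a := 0) (b := G.T)).exists_bound_of_continuousOn
      ha.continuousOn
    refine Measure.integrableOn_of_bounded (M := max M 0 * (ε⁻¹ * Mθ)) ?_
      hum.aestronglyMeasurable ?_
    · rw [Measure.volume_eq_prod, Measure.prod_prod]
      exact ENNReal.mul_ne_top (by simp) (by simp)
    · refine (ae_restrict_iff' hEm).2 (Eventually.of_forall fun p hp => ?_)
      rw [norm_mul, norm_osc, mul_one, Complex.norm_real, norm_mul, scaledWeight]
      refine mul_le_mul ((hM _ (Ico_subset_Icc_self hp.1)).trans (le_max_left _ _)) ?_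
        (norm_nonneg _) (le_max_right _ _)
      rw [norm_mul, Real.norm_of_nonneg (inv_pos.2 hε0).le]
      exact mul_le_mul_of_nonneg_left (hMθ _) (inv_pos.2 hε0).le
  rw [Measure.volume_eq_prod] at hui ⊢
  rw [setIntegral_prod _ hui, integral_Ico_eq_integral_Ioc,
    ← intervalIntegral.integral_of_le hT.le, FramedCurve.tubeFourier]
  refine intervalIntegral.integral_congr fun t _ => ?_
  dsimp only
  rw [integral_Icc_eq_integral_Ioc, ← intervalIntegral.integral_of_le (by linarith)]
  -- Rescaling s by ε absorbs the factor ε⁻¹ of the scaled weight.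
  have hsub := intervalIntegral.inv_smul_integral_comp_div (a := -ε) (b := ε)
    (fun s => (θ s : ℂ) * ((a t : ℂ) * osc (R * G.phase (ε * s) φ t))) ε
  rw [neg_div, div_self hε0.ne'] at hsub
  rw [← hsub, ← intervalIntegral.integral_smul]
  refine intervalIntegral.integral_congr fun s _ => ?_
  dsimp only [scaledWeight]
  rw [mul_div_cancel₀ _ hε0.ne', Complex.real_smul, div_eq_inv_mul]
  push_cast
  ring

end FramedCurve

/-- The plane in coordinates. -/
def planeEquiv : ℝ × ℝ ≃ᵐ Plane :=
  MeasurableEquiv.finTwoArrow.symm.trans (MeasurableEquiv.toLp 2 (Fin 2 → ℝ))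

theorem planeEquiv_apply_zero (z : ℝ × ℝ) : planeEquiv z 0 = z.1 := rfl

theorem planeEquiv_apply_one (z : ℝ × ℝ) : planeEquiv z 1 = z.2 := rfl

theorem measurePreserving_planeEquiv : MeasurePreserving planeEquiv :=
  (PiLp.volume_preserving_toLp (Fin 2)).comp (volume_preserving_finTwoArrow ℝ).symm

/-! ### The tube integrand in tube coordinates and its Fourier transform. -/

namespace IsConvexClosedCurve

variable {γ : ℝ → Plane} {T : ℝ} (hγ : IsConvexClosedCurve γ T)

include hγ

theorem planeEquiv_tubeMap (p : ℝ × ℝ) :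
    planeEquiv (hγ.framedCurve.tubeMap p) = parallelCurve γ p.2 p.1 := by
  ext i
  fin_cases i
  · simp [planeEquiv_apply_zero, FramedCurve.tubeMap, parallelCurve, hγ.outwardNormal_zero]
    rfl
  · simp [planeEquiv_apply_one, FramedCurve.tubeMap, parallelCurve, hγ.outwardNormal_one]
    rfl

theorem contDiff_parallelCurve (s : ℝ) : ContDiff ℝ ∞ (parallelCurve γ s) := by
  refine contDiff_euclidean.2 fun i => ?_
  have h0 := hγ.framedCurve.contDiff_c₀
  have h1 := hγ.framedCurve.contDiff_c₁
  have hX := hγ.framedCurve.contDiff_X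
  have hY := hγ.framedCurve.contDiff_Y
  fin_cases i
  · simp only [parallelCurve, PiLp.add_apply, PiLp.smul_apply, smul_eq_mul, Fin.zero_eta,
      hγ.outwardNormal_zero]
    exact hX.add (contDiff_const.mul h1)
  · simp only [parallelCurve, PiLp.add_apply, PiLp.smul_apply, smul_eq_mul, Fin.mk_one,
      hγ.outwardNormal_one]
    exact hY.add (contDiff_const.mul h0.neg)

theorem deriv_parallelCurve (s t : ℝ) :
    deriv (parallelCurve γ s) t = (1 + s * curvature γ t) • deriv γ t := by
  have hd := ((hγ.contDiff_parallelCurve s).differentiable (by simp) t).hasDerivAt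
  have hv := hγ.speed_pos t
  ext i
  refine (hasDerivAt_coord hd i).unique ?_
  fin_cases i
  · refine (HasDerivAt.congr_deriv (hγ.framedCurve.hasDerivAt_parallel_fst s t) ?_).congr_of_eventuallyEq
      (Eventually.of_forall fun t => ?_)
    · simp only [framedCurve, PiLp.smul_apply, smul_eq_mul, Fin.zero_eta]
      field_simp
    · simp only [parallelCurve, PiLp.add_apply, PiLp.smul_apply, smul_eq_mul, Fin.zero_eta,
        hγ.outwardNormal_zero]
      rfl
  · refine (HasDerivAt.congr_deriv (hγ.framedCurve.hasDerivAt_parallel_snd s t) ?_).congr_of_eventuallyEq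
      (Eventually.of_forall fun t => ?_)
    · simp only [framedCurve, PiLp.smul_apply, smul_eq_mul, Fin.mk_one]
      field_simp
    · simp only [parallelCurve, PiLp.add_apply, PiLp.smul_apply, smul_eq_mul, Fin.mk_one,
        hγ.outwardNormal_one, mul_neg, ← sub_eq_add_neg]
      rfl

/-- With w = 1 + sκ the velocity is wγ'. The term from differentiating w is tangential and drops out
of the cross product, leaving w² over w³. -/
theorem curvature_parallelCurve {s t : ℝ} (hs : 0 < 1 + s * curvature γ t) :
    curvature (parallelCurve γ s) t = curvature γ t / (1 + s * curvature γ t) := by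
  have hd1 : deriv (parallelCurve γ s) = fun t => (1 + s * curvature γ t) • deriv γ t :=
    funext fun t => hγ.deriv_parallelCurve s t
  have hκ := (hγ.contDiff_curvature.differentiable (by simp) t).hasDerivAt
  have hd2 : deriv (deriv (parallelCurve γ s)) t =
      (1 + s * curvature γ t) • deriv (deriv γ) t + (s * deriv (curvature γ) t) • deriv γ t := by
    rw [hd1]
    exact (((hκ.const_mul s).const_add 1).smul (hγ.hasDerivAt_deriv t)).deriv
  have hv := hγ.speed_pos t
  rw [curvature, hd2, hγ.deriv_parallelCurve, norm_smul, Real.norm_of_nonneg hs.le, mul_pow]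
  have e : cross ((1 + s * curvature γ t) • deriv γ t) ((1 + s * curvature γ t) • deriv (deriv γ) t +
      (s * deriv (curvature γ) t) • deriv γ t) =
      (1 + s * curvature γ t) ^ 2 * cross (deriv γ t) (deriv (deriv γ) t) := by
    simp only [cross, PiLp.add_apply, PiLp.smul_apply, smul_eq_mul]
    ring
  rw [e]
  set w := 1 + s * curvature γ t with hw
  rw [curvature]
  field_simp

theorem periodic_parallelCurve (s : ℝ) : Function.Periodic (parallelCurve γ s) T := fun t => by
  simp only [parallelCurve, hγ.periodic t, hγ.periodic_outwardNormal t]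

theorem one_add_mul_curvature_pos {ρ : ℝ} (hρ : IsTubeWidth γ ρ) {s : ℝ} (hs : s ∈ Icc (-ρ) ρ)
    (t : ℝ) : 0 < 1 + s * curvature γ t := by
  have h1 := hγ.curvature_nonneg t
  have h2 := hρ.2.2 t
  nlinarith [hs.1]

/-- The Jacobian is 1 - sκ/(1 + sκ) = 1/(1 + sκ), the reciprocal of the curvature factor in the area
element. -/
theorem tubeIntegrand_parallelCurve {ρ : ℝ} (hρ : IsTubeWidth γ ρ) {s : ℝ} (hs : s ∈ Icc (-ρ) ρ)
    (t : ℝ) (f : Plane → ℝ) (θ : ℝ → ℝ) (ε : ℝ) :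
    tubeIntegrand γ f θ ε (parallelCurve γ s t) =
      f (γ t) * scaledWeight θ ε s * (1 + s * curvature γ t)⁻¹ := by
  obtain ⟨n, hn⟩ := hγ.footParam_parallelCurve hρ hs t
  have hproj : proj γ (parallelCurve γ s t) = γ t := by
    rw [proj, hn, hγ.periodic.zsmul n t]
  have hsd : signedDistance γ (parallelCurve γ s t) = s := by
    rw [signedDistance, hproj, hn, hγ.periodic_outwardNormal.zsmul n t, parallelCurve,
      add_sub_cancel_left, real_inner_smul_right, real_inner_self_eq_norm_sq,
      hγ.norm_outwardNormal]
    ring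
  have hpos := hγ.one_add_mul_curvature_pos hρ hs t
  have hcp : Function.Periodic (curvature (parallelCurve γ s)) T := fun t => by
    have h1 := (hγ.periodic_parallelCurve s).deriv_periodic
    simp only [curvature, h1 t, h1.deriv_periodic t]
  have hj : jacobian γ (parallelCurve γ s t) = (1 + s * curvature γ t)⁻¹ := by
    rw [jacobian, hsd, hn, hcp.zsmul n t, hγ.curvature_parallelCurve hpos]
    field_simp
    ring
  rw [tubeIntegrand, hproj, hsd, hj]

variable {ρ ε : ℝ}

theorem image_tubeMap (hρ : IsTubeWidth γ ρ) (hε : ε ≤ ρ) :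
    hγ.framedCurve.tubeMap '' (Ico 0 T ×ˢ Icc (-ε) ε) = planeEquiv ⁻¹' tube γ ε := by
  ext z
  constructor
  · rintro ⟨p, hp, rfl⟩
    rw [mem_preimage, hγ.planeEquiv_tubeMap, hγ.parallelCurve_mem_tube_iff hρ
      (Icc_subset_Icc (neg_le_neg hε) hε hp.2)]
    exact abs_le.2 hp.2
  · intro hz
    obtain ⟨t, ht, s, hs, hx⟩ := hγ.exists_eq_parallelCurve hz
    refine ⟨(t, s), ⟨ht, hs⟩, planeEquiv.injective ?_⟩
    rw [hγ.planeEquiv_tubeMap, hx]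

theorem injOn_tubeMap (hρ : IsTubeWidth γ ρ) (hε : ε ≤ ρ) :
    InjOn hγ.framedCurve.tubeMap (Ico 0 T ×ˢ Icc (-ε) ε) := by
  intro p hp p' hp' h
  refine hγ.injOn_parallelCurve hρ ⟨hp.1, Icc_subset_Icc (neg_le_neg hε) hε hp.2⟩
    ⟨hp'.1, Icc_subset_Icc (neg_le_neg hε) hε hp'.2⟩ ?_
  dsimp only
  rw [← hγ.planeEquiv_tubeMap, ← hγ.planeEquiv_tubeMap, h]

/-- The integrand of the quadrature, extended by zero outside of the tube. -/
def _root_.tubeFunction (γ : ℝ → Plane) (f : Plane → ℝ) (θ : ℝ → ℝ) (ε : ℝ) : Plane → ℝ :=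
  (tube γ ε).indicator (tubeIntegrand γ f θ ε)

theorem tubeFunction_parallelCurve (hρ : IsTubeWidth γ ρ) (hε : ε ≤ ρ) {s : ℝ}
    (hs : s ∈ Icc (-ε) ε) (t : ℝ) (f : Plane → ℝ) (θ : ℝ → ℝ) :
    tubeFunction γ f θ ε (parallelCurve γ s t) =
      f (γ t) * scaledWeight θ ε s * (1 + s * curvature γ t)⁻¹ := by
  have hs' := Icc_subset_Icc (neg_le_neg hε) hε hs
  rw [tubeFunction, indicator_of_mem ((hγ.parallelCurve_mem_tube_iff hρ hs' t).2 (abs_le.2 hs)),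
    hγ.tubeIntegrand_parallelCurve hρ hs']

/-- Measurability cannot be read off from the choice in `footParam`. Instead the tube map is a
measurable embedding, and the function is the extension by zero of an explicit measurable formula in
t and s. -/
theorem measurable_tubeFunction (hρ : IsTubeWidth γ ρ) (hε : ε ≤ ρ) {f : Plane → ℝ}
    (hf : Continuous fun t => f (γ t)) {θ : ℝ → ℝ} (hθ : Measurable θ) :
    Measurable (tubeFunction γ f θ ε) := by
  set E : Set (ℝ × ℝ) := Ico 0 T ×ˢ Icc (-ε) ε with hE
  have hEm : MeasurableSet E := measurableSet_Ico.prod measurableSet_Icc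
  have hemb := measurableEmbedding_of_fderivWithin hEm
    (fun p _ => (hγ.framedCurve.hasFDerivAt_tubeMap p).hasFDerivWithinAt) (hγ.injOn_tubeMap hρ hε)
  have hg : Measurable fun p : E => f (γ p.1.1) * scaledWeight θ ε p.1.2 *
      (1 + p.1.2 * curvature γ p.1.1)⁻¹ := by
    have h1 : Measurable fun p : ℝ × ℝ => f (γ p.1) := hf.measurable.comp measurable_fst
    have h2 : Measurable fun p : ℝ × ℝ => scaledWeight θ ε p.2 :=
      (hθ.comp (measurable_snd.const_mul ε⁻¹)).const_mul _
    have h3 : Measurable fun p : ℝ × ℝ => curvature γ p.1 :=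
      hγ.contDiff_curvature.continuous.measurable.comp measurable_fst
    exact ((h1.mul h2).mul ((measurable_snd.mul h3).const_add 1).inv).comp measurable_subtype_coe
  have hext := hemb.measurable_extend hg (g' := fun _ => (0 : ℝ)) measurable_const
  have : tubeFunction γ f θ ε = Function.extend (E.domRestrict hγ.framedCurve.tubeMap)
      (fun p : E => f (γ p.1.1) * scaledWeight θ ε p.1.2 * (1 + p.1.2 * curvature γ p.1.1)⁻¹)
      (fun _ => 0) ∘ planeEquiv.symm := by
    ext x
    by_cases hx : x ∈ tube γ ε
    · obtain ⟨t, ht, s, hs, rfl⟩ := hγ.exists_eq_parallelCurve hx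
      have e : planeEquiv.symm (parallelCurve γ s t) =
          E.domRestrict hγ.framedCurve.tubeMap ⟨(t, s), ht, hs⟩ := by
        rw [MeasurableEquiv.symm_apply_eq]
        exact (hγ.planeEquiv_tubeMap (t, s)).symm
      rw [hγ.tubeFunction_parallelCurve hρ hε hs, Function.comp_apply, e,
        hemb.injective.extend_apply]
    · rw [tubeFunction, indicator_of_notMem hx, Function.comp_apply, Function.extend_apply']
      rintro ⟨⟨p, hp⟩, hpx⟩
      have : planeEquiv.symm x ∈ planeEquiv ⁻¹' tube γ ε := by
        rw [← hγ.image_tubeMap hρ hε]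
        exact ⟨p, hp, hpx⟩
      rw [mem_preimage, MeasurableEquiv.apply_symm_apply] at this
      exact hx this
  rw [this]
  exact hext.comp planeEquiv.symm.measurable

theorem exists_bound_tubeFunction (hρ : IsTubeWidth γ ρ) (hε0 : 0 < ε) (hε : ε ≤ ρ) {f : Plane → ℝ}
    (hf : Continuous fun t => f (γ t)) {θ : ℝ → ℝ} {Mθ : ℝ} (hMθ0 : 0 ≤ Mθ)
    (hMθ : ∀ s, |θ s| ≤ Mθ) :
    ∃ M A, (∀ x, |tubeFunction γ f θ ε x| ≤ M) ∧ ∀ x, A < ‖x‖ → tubeFunction γ f θ ε x = 0 := by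
  have hc : ContinuousOn (fun p : ℝ × ℝ => f (γ p.1) * (1 + p.2 * curvature γ p.1)⁻¹)
      (Icc 0 T ×ˢ Icc (-ε) ε) := by
    refine ContinuousOn.mul (hf.comp continuous_fst).continuousOn (ContinuousOn.inv₀ ?_ ?_)
    · have := hγ.contDiff_curvature.continuous
      fun_prop
    · exact fun p hp => (hγ.one_add_mul_curvature_pos hρ
        (Icc_subset_Icc (neg_le_neg hε) hε hp.2) p.1).ne'
  obtain ⟨M, hM⟩ := (isCompact_Icc.prod isCompact_Icc).exists_bound_of_continuousOn hc
  obtain ⟨A, hA⟩ := (isCompact_Icc (a := 0) (b := T)).exists_bound_of_continuousOn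
    hγ.smooth.continuous.continuousOn
  refine ⟨max M 0 * (ε⁻¹ * Mθ), A + ε, fun x => ?_, fun x hx => ?_⟩
  · by_cases hx : x ∈ tube γ ε
    · obtain ⟨t, ht, s, hs, rfl⟩ := hγ.exists_eq_parallelCurve hx
      rw [hγ.tubeFunction_parallelCurve hρ hε hs, mul_right_comm, abs_mul]
      refine mul_le_mul ((hM (t, s) ⟨Ico_subset_Icc_self ht, hs⟩).trans (le_max_left _ _)) ?_
        (abs_nonneg _) (le_max_right _ _)
      rw [scaledWeight, abs_mul, abs_of_pos (inv_pos.2 hε0)]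
      exact mul_le_mul_of_nonneg_left (hMθ _) (inv_pos.2 hε0).le
    · rw [tubeFunction, indicator_of_notMem hx, abs_zero]
      positivity
  · refine indicator_of_notMem (fun hxt => ?_) _
    obtain ⟨t, ht, s, hs, rfl⟩ := hγ.exists_eq_parallelCurve hxt
    have h1 := hA t (Ico_subset_Icc_self ht)
    have h2 := norm_add_le (γ t) (s • outwardNormal γ t)
    rw [norm_smul, hγ.norm_outwardNormal, mul_one, Real.norm_eq_abs] at h2
    have h3 := abs_le.2 hs
    have : ‖parallelCurve γ s t‖ ≤ A + ε := by
      rw [parallelCurve]; linarith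
    linarith

/-- Change of variables to tube coordinates; the area element cancels the curvature factor of the
integrand, so the amplitude depends on t alone and the weight on s alone. -/
theorem integral_tubeFunction_mul_osc (hρ : IsTubeWidth γ ρ) (hε0 : 0 < ε) (hε : ε ≤ ρ)
    {f : Plane → ℝ} (hf : Continuous fun t => f (γ t)) {θ : ℝ → ℝ} (hθ : Measurable θ) {Mθ : ℝ}
    (hMθ : ∀ s, |θ s| ≤ Mθ) (R φ : ℝ) :
    ∫ x : Plane, (tubeFunction γ f θ ε x : ℂ) * osc (R * (Real.cos φ * x 0 + Real.sin φ * x 1)) =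
      hγ.framedCurve.tubeFourier (fun t => f (γ t) * ‖deriv γ t‖) θ ε R φ := by
  set E : Set (ℝ × ℝ) := Ico 0 T ×ˢ Icc (-ε) ε with hE
  have hEm : MeasurableSet E := measurableSet_Ico.prod measurableSet_Icc
  have hT := hγ.period_pos
  rw [← measurePreserving_planeEquiv.integral_comp planeEquiv.measurableEmbedding]
  simp only [planeEquiv_apply_zero, planeEquiv_apply_one]
  rw [← setIntegral_eq_integral_of_forall_compl_eq_zero (s := planeEquiv ⁻¹' tube γ ε)
    (fun z hz => by
      rw [tubeFunction, indicator_of_notMem (show planeEquiv z ∉ tube γ ε from hz)]; simp),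
    ← hγ.image_tubeMap hρ hε, integral_image_eq_integral_abs_det_fderiv_smul volume hEm
    (fun p _ => (hγ.framedCurve.hasFDerivAt_tubeMap p).hasFDerivWithinAt) (hγ.injOn_tubeMap hρ hε)]
  have hac : Continuous fun t => f (γ t) * ‖deriv γ t‖ := hf.mul hγ.contDiff_speed.continuous
  set a : ℝ → ℝ := fun t => f (γ t) * ‖deriv γ t‖ with ha
  let u : ℝ × ℝ → ℂ := fun p => ((a p.1 * scaledWeight θ ε p.2 : ℝ) : ℂ) *
    osc (R * hγ.framedCurve.phase p.2 φ p.1)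
  have hcongr : ∀ p ∈ E, |(hγ.framedCurve.tubeMapDeriv p).det| •
      ((tubeFunction γ f θ ε (planeEquiv (hγ.framedCurve.tubeMap p)) : ℂ) *
        osc (R * (Real.cos φ * (hγ.framedCurve.tubeMap p).1 +
          Real.sin φ * (hγ.framedCurve.tubeMap p).2))) = u p := by
    intro p hp
    have hpos := hγ.one_add_mul_curvature_pos hρ (Icc_subset_Icc (neg_le_neg hε) hε hp.2) p.1
    have hp1 : p.2 ∈ Icc (-ε) ε := hp.2
    rw [hγ.framedCurve.abs_det_tubeMapDeriv hpos.le, FramedCurve.phase_eq_tubeMap,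
      hγ.planeEquiv_tubeMap, hγ.tubeFunction_parallelCurve hρ hε hp1, ← smul_mul_assoc]
    simp only [u, ha]
    congr 1
    rw [Complex.real_smul, ← Complex.ofReal_mul]
    congr 1
    change ‖deriv γ p.1‖ * (1 + p.2 * curvature γ p.1) * _ = _
    field_simp
  rw [setIntegral_congr_fun hEm hcongr]
  exact hγ.framedCurve.setIntegral_scaledWeight_mul_osc hac hθ hMθ hε0 R φ

/-- The case of frequency zero. As θ has integral 1, averaging the quadrature over shifts of the
lattice introduces no bias. -/
theorem integral_tubeFunction {q : ℕ} (hρ : IsTubeWidth γ ρ) (hε0 : 0 < ε) (hε : ε ≤ ρ)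
    {f : Plane → ℝ} (hf : Continuous fun t => f (γ t)) {θ : ℝ → ℝ} (hθ : IsWeight q θ) :
    ∫ x : Plane, tubeFunction γ f θ ε x = boundaryIntegral γ T f := by
  obtain ⟨Mθ, -, hMθ⟩ := hθ.exists_bound
  have h := hγ.integral_tubeFunction_mul_osc hρ hε0 hε hf hθ.measurable hMθ 0 0
  simp only [FramedCurve.tubeFourier, zero_mul, osc_zero, mul_one] at h
  simp only [intervalIntegral.integral_mul_const, intervalIntegral.integral_const_mul] at h
  rw [integral_complex_ofReal, intervalIntegral.integral_ofReal, hθ.integral_eq,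
    Complex.ofReal_one, one_mul, intervalIntegral.integral_ofReal] at h
  exact_mod_cast h

end IsConvexClosedCurve

/-! ### Rotations -/

theorem SO2.apply_one_one (η : SO2) : η.1 1 1 = η.1 0 0 :=
  (Matrix.mem_specialOrthogonalGroup_fin_two_iff.1 η.2).1.symm

theorem SO2.apply_zero_one (η : SO2) : η.1 0 1 = -η.1 1 0 :=
  (Matrix.mem_specialOrthogonalGroup_fin_two_iff.1 η.2).2.1

theorem SO2.sq_add_sq (η : SO2) : η.1 0 0 ^ 2 + η.1 1 0 ^ 2 = 1 := by
  have h := (Matrix.mem_specialOrthogonalGroup_fin_two_iff.1 η.2).2.2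
  rwa [SO2.apply_zero_one, neg_sq] at h

theorem rotate_apply_zero (η : SO2) (x : Plane) :
    rotate η x 0 = η.1 0 0 * x 0 - η.1 1 0 * x 1 := by
  simp [rotate, Matrix.toLpLin_apply, SO2.apply_zero_one, sub_eq_add_neg]

theorem rotate_apply_one (η : SO2) (x : Plane) :
    rotate η x 1 = η.1 1 0 * x 0 + η.1 0 0 * x 1 := by
  simp [rotate, Matrix.toLpLin_apply, SO2.apply_one_one]

theorem plane_ext {x y : Plane} (h0 : x 0 = y 0) (h1 : x 1 = y 1) : x = y := by
  ext i; fin_cases i <;> assumption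

theorem rotate_mul (η η' : SO2) (x : Plane) : rotate (η * η') x = rotate η (rotate η' x) := by
  simp [rotate, Matrix.toLpLin_apply]

theorem rotate_one (x : Plane) : rotate 1 x = x := by
  simp [rotate]

theorem norm_rotate (η : SO2) (x : Plane) : ‖rotate η x‖ = ‖x‖ := by
  rw [← sq_eq_sq₀ (norm_nonneg _) (norm_nonneg _), norm_sq_plane, norm_sq_plane, rotate_apply_zero,
    rotate_apply_one]
  linear_combination (x 0 ^ 2 + x 1 ^ 2) * η.sq_add_sq

/-- A rotation as a linear isometry. -/
def rotateIsometry (η : SO2) : Plane ≃ₗᵢ[ℝ] Plane where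
  toFun := rotate η
  invFun := rotate η⁻¹
  map_add' := map_add (Matrix.toEuclideanLin η.1)
  map_smul' := map_smul (Matrix.toEuclideanLin η.1)
  left_inv x := by rw [← rotate_mul, inv_mul_cancel, rotate_one]
  right_inv x := by rw [← rotate_mul, mul_inv_cancel, rotate_one]
  norm_map' := norm_rotate η

theorem rotateIsometry_apply (η : SO2) (x : Plane) : rotateIsometry η x = rotate η x := rfl

theorem rotate_inv_rotate (η : SO2) (x : Plane) : rotate η⁻¹ (rotate η x) = x :=
  (rotateIsometry η).left_inv x

theorem rotate_rotate_inv (η : SO2) (x : Plane) : rotate η (rotate η⁻¹ x) = x :=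
  (rotateIsometry η).right_inv x

theorem inner_rotate (η : SO2) (x y : Plane) : inner ℝ (rotate η x) (rotate η y) = inner ℝ x y :=
  (rotateIsometry η).inner_map_map x y

theorem cross_rotate (η : SO2) (x y : Plane) : cross (rotate η x) (rotate η y) = cross x y := by
  simp only [cross, rotate_apply_zero, rotate_apply_one]
  linear_combination (x 0 * y 1 - x 1 * y 0) * η.sq_add_sq

theorem hasDerivAt_rotate_add (η : SO2) (c : Plane) {γ : ℝ → Plane} {γ' : Plane} {t : ℝ}
    (h : HasDerivAt γ γ' t) : HasDerivAt (fun t => rotate η (γ t) + c) (rotate η γ') t :=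
  ((rotateIsometry η).toContinuousLinearEquiv.toContinuousLinearMap.hasFDerivAt.comp_hasDerivAt t
    h).add_const c

theorem deriv_rotate_add (η : SO2) (c : Plane) {γ : ℝ → Plane} (h : Differentiable ℝ γ) :
    deriv (fun t => rotate η (γ t) + c) = fun t => rotate η (deriv γ t) :=
  funext fun t => (hasDerivAt_rotate_add η c (h t).hasDerivAt).deriv

theorem curvature_rotate_add (η : SO2) (c : Plane) {γ : ℝ → Plane} (h : ContDiff ℝ ∞ γ) (t : ℝ) :
    curvature (fun t => rotate η (γ t) + c) t = curvature γ t := by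
  have h2 : Differentiable ℝ (deriv γ) := (h.iterate_deriv 1).differentiable (by simp)
  have e : (fun t => rotate η (deriv γ t)) = fun t => rotate η (deriv γ t) + 0 := by simp
  rw [curvature, deriv_rotate_add η c (h.differentiable (by simp)), e, deriv_rotate_add η 0 h2]
  simp only [add_zero, cross_rotate, norm_rotate]
  rfl

theorem outwardNormal_rotate_add (η : SO2) (c : Plane) {γ : ℝ → Plane} (h : Differentiable ℝ γ)
    (t : ℝ) : outwardNormal (fun t => rotate η (γ t) + c) t = rotate η (outwardNormal γ t) := by
  rw [outwardNormal, deriv_rotate_add η c h]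
  refine plane_ext ?_ ?_
  · simp [outwardNormal, rotate_apply_zero, rotate_apply_one, norm_rotate]; ring
  · simp [outwardNormal, rotate_apply_zero, rotate_apply_one, norm_rotate]; ring

theorem parallelCurve_rotate_add (η : SO2) (c : Plane) {γ : ℝ → Plane} (h : Differentiable ℝ γ)
    (s : ℝ) : parallelCurve (fun t => rotate η (γ t) + c) s =
      fun t => rotate η (parallelCurve γ s t) + c := by
  funext t
  simp only [parallelCurve, outwardNormal_rotate_add η c h]
  simp only [← rotateIsometry_apply, map_add, map_smul]
  abel

theorem isometry_rotate_add (η : SO2) (c : Plane) : Isometry fun x => rotate η x + c :=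
  (IsometryEquiv.addRight c).isometry.comp (rotateIsometry η).isometry

theorem infDist_rotate_add (η : SO2) (c : Plane) (γ : ℝ → Plane) (x : Plane) :
    Metric.infDist (rotate η x + c) (range fun t => rotate η (γ t) + c) =
      Metric.infDist x (range γ) := by
  rw [← Metric.infDist_image (isometry_rotate_add η c) (x := x) (t := range γ), ← range_comp]
  rfl

/-- A rigid motion preserves the predicate from which the parameter is chosen, so even the arbitrary
choices coincide. -/
theorem footParam_rotate_add (η : SO2) (c : Plane) (γ : ℝ → Plane) (x : Plane) :
    footParam (fun t => rotate η (γ t) + c) (rotate η x + c) = footParam γ x := by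
  have h : ∀ t, dist (rotate η x + c) (rotate η (γ t) + c) = dist x (γ t) := fun t =>
    (isometry_rotate_add η c).dist_eq x (γ t)
  simp only [footParam, infDist_rotate_add, h]

theorem SO2.continuous_apply (i j : Fin 2) : Continuous fun η : SO2 => η.1 i j :=
  continuous_subtype_val.matrix_elem i j

theorem Continuous.rotate {X : Type*} [TopologicalSpace X] {u : X → SO2} {v : X → Plane}
    (hu : Continuous u) (hv : Continuous v) : Continuous fun x => _root_.rotate (u x) (v x) := by
  have h00 := (SO2.continuous_apply 0 0).comp hu
  have h10 := (SO2.continuous_apply 1 0).comp hu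
  simp only [Function.comp_def] at h00 h10
  have h0 : Continuous fun x => v x 0 := by fun_prop
  have h1 : Continuous fun x => v x 1 := by fun_prop
  have : Continuous fun x => (WithLp.toLp 2 ![_root_.rotate (u x) (v x) 0,
      _root_.rotate (u x) (v x) 1] : Plane) := by
    refine (PiLp.continuous_toLp 2 _).comp (continuous_pi fun i => ?_)
    fin_cases i
    · simp only [Fin.zero_eta, Matrix.cons_val_zero, rotate_apply_zero]
      fun_prop
    · simp only [Fin.mk_one, Matrix.cons_val_one, Matrix.cons_val_fin_one, rotate_apply_one]
      fun_prop
  convert this using 2 with x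
  exact plane_ext rfl rfl

/-- The inverse of a rotation is its transpose. -/
theorem SO2.continuous_inv : Continuous fun η : SO2 => η⁻¹ := by
  refine Continuous.subtype_mk (continuous_matrix fun i j => ?_) _
  exact SO2.continuous_apply j i

/-- Makes continuous functions on products with the rotation group measurable for the product
σ-algebra. -/
instance SO2.secondCountableTopology : SecondCountableTopology SO2 :=
  have : SecondCountableTopology (Matrix (Fin 2) (Fin 2) ℝ) :=
    inferInstanceAs (SecondCountableTopology (Fin 2 → Fin 2 → ℝ))
  TopologicalSpace.Subtype.secondCountableTopology _

/-! ### The quadrature on the moved curve -/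

namespace IsConvexClosedCurve

variable {γ : ℝ → Plane} {T : ℝ} (hγ : IsConvexClosedCurve γ T)

include hγ

theorem tubeFunction_rotate_add (η : SO2) (c : Plane) (f : Plane → ℝ) (θ : ℝ → ℝ) (ε : ℝ)
    (x : Plane) :
    tubeFunction (fun t => rotate η (γ t) + c) (fun y => f (rotate η⁻¹ (y - c))) θ ε
      (rotate η x + c) = tubeFunction γ f θ ε x := by
  have hd := hγ.smooth.differentiable (by simp)
  have hproj : proj (fun t => rotate η (γ t) + c) (rotate η x + c) = rotate η (proj γ x) + c := by
    rw [proj, footParam_rotate_add, proj]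
  have hsd : signedDistance (fun t => rotate η (γ t) + c) (rotate η x + c) =
      signedDistance γ x := by
    rw [signedDistance, hproj, footParam_rotate_add, outwardNormal_rotate_add η c hd,
      add_sub_add_right_eq_sub, signedDistance, ← inner_rotate η _ (x - proj γ x)]
    simp only [← rotateIsometry_apply, map_sub]
  have hj : jacobian (fun t => rotate η (γ t) + c) (rotate η x + c) = jacobian γ x := by
    rw [jacobian, hsd, footParam_rotate_add, parallelCurve_rotate_add η c hd,
      curvature_rotate_add η c (hγ.contDiff_parallelCurve _), jacobian]
  have hI : tubeIntegrand (fun t => rotate η (γ t) + c) (fun y => f (rotate η⁻¹ (y - c))) θ ε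
      (rotate η x + c) = tubeIntegrand γ f θ ε x := by
    rw [tubeIntegrand, hproj, hsd, hj, add_sub_cancel_right, rotate_inv_rotate, tubeIntegrand]
  have ht : rotate η x + c ∈ tube (fun t => rotate η (γ t) + c) ε ↔ x ∈ tube γ ε := by
    simp only [tube, mem_ofPred_eq, infDist_rotate_add]
  by_cases hx : x ∈ tube γ ε
  · rw [tubeFunction, tubeFunction, indicator_of_mem (ht.2 hx), indicator_of_mem hx, hI]
  · rw [tubeFunction, tubeFunction, indicator_of_notMem (mt ht.1 hx), indicator_of_notMem hx]

theorem ibimMoved_eq (f : Plane → ℝ) (θ : ℝ → ℝ) (ε h : ℝ) (η : SO2) (ξ : Plane) :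
    ibimMoved γ f θ ε h η ξ =
      h ^ 2 * ∑' w, tubeFunction γ f θ ε (rotate η⁻¹ (latticePoint h w - h • ξ)) := by
  rw [ibimMoved, ibim]
  congr 2
  funext w
  rw [← hγ.tubeFunction_rotate_add η (h • ξ), rotate_rotate_inv, sub_add_cancel]
  rfl

end IsConvexClosedCurve

/-! ### Averages over the rotation group -/

/-- The unit vector at angle `φ`. -/
def unitVector (φ : ℝ) : Plane := !₂[Real.cos φ, Real.sin φ]

/-- The rotation by the angle `φ`. -/
def SO2.ofAngle (φ : ℝ) : SO2 :=
  ⟨!![Real.cos φ, -Real.sin φ; Real.sin φ, Real.cos φ],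
    Matrix.of_mem_specialOrthogonalGroup_fin_two_iff.2 ⟨rfl, rfl, by simp⟩⟩

theorem SO2.continuous_ofAngle : Continuous SO2.ofAngle := by
  refine Continuous.subtype_mk (continuous_matrix fun i j => ?_) _
  fin_cases i <;> fin_cases j <;> simp <;> fun_prop

theorem rotate_ofAngle_unitVector (φ β : ℝ) :
    rotate (SO2.ofAngle φ) (unitVector β) = unitVector (φ + β) := by
  refine plane_ext ?_ ?_
  · simp [rotate_apply_zero, unitVector, SO2.ofAngle, Real.cos_add]
  · simp [rotate_apply_one, unitVector, SO2.ofAngle, Real.sin_add]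

theorem exists_angle {a b : ℝ} (h : a ^ 2 + b ^ 2 = 1) : ∃ φ, a = Real.cos φ ∧ b = Real.sin φ := by
  have hz : ‖(⟨a, b⟩ : ℂ)‖ = 1 := by
    rw [Complex.norm_def, Complex.normSq_mk, ← sq, ← sq, h, Real.sqrt_one]
  have h0 : (⟨a, b⟩ : ℂ) ≠ 0 := fun h0 => by simp [h0] at hz
  refine ⟨Complex.arg ⟨a, b⟩, ?_, ?_⟩
  · rw [Complex.cos_arg h0, hz, div_one]
  · rw [Complex.sin_arg, hz, div_one]

theorem SO2.exists_eq_ofAngle (η : SO2) : ∃ φ, η = SO2.ofAngle φ := by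
  obtain ⟨φ, h0, h1⟩ := exists_angle η.sq_add_sq
  refine ⟨φ, Subtype.ext ?_⟩
  ext i j
  fin_cases i <;> fin_cases j <;>
    simp [SO2.ofAngle, h0, h1, SO2.apply_zero_one, SO2.apply_one_one]

theorem exists_eq_smul_unitVector (v : Plane) : ∃ β, v = ‖v‖ • unitVector β := by
  rcases eq_or_ne v 0 with rfl | hv
  · exact ⟨0, by simp⟩
  · have hn : ‖v‖ ≠ 0 := norm_ne_zero_iff.2 hv
    have h : (v 0 / ‖v‖) ^ 2 + (v 1 / ‖v‖) ^ 2 = 1 := by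
      rw [div_pow, div_pow, ← add_div, ← norm_sq_plane, div_self (pow_ne_zero _ hn)]
    obtain ⟨β, h0, h1⟩ := exists_angle h
    refine ⟨β, plane_ext ?_ ?_⟩
    · simp [unitVector, ← h0]; field_simp
    · simp [unitVector, ← h1]; field_simp

/-- Left invariance allows a rotation by φ to be inserted without changing the Haar integral.
Averaging over φ and exchanging integrals leaves a circular mean that no longer depends on η. -/
theorem integral_rotate_inv [MeasurableSpace SO2] [BorelSpace SO2] (μ : Measure SO2)
    [μ.IsHaarMeasure] [IsProbabilityMeasure μ] {g : Plane → ℝ} (hg : Continuous g) (v : Plane) :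
    ∫ η, g (rotate η⁻¹ v) ∂μ =
      (2 * Real.pi)⁻¹ * ∫ φ in (0 : ℝ)..2 * Real.pi, g (‖v‖ • unitVector φ) := by
  have hpi := Real.pi_pos
  obtain ⟨β, hβ⟩ := exists_eq_smul_unitVector v
  have hinv : ∀ φ, ∫ η, g (rotate (η⁻¹ * SO2.ofAngle φ) v) ∂μ = ∫ η, g (rotate η⁻¹ v) ∂μ := by
    intro φ
    rw [← integral_mul_left_eq_self (fun η : SO2 => g (rotate η⁻¹ v)) (SO2.ofAngle φ)⁻¹]
    simp only [mul_inv_rev, inv_inv]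
  have hin : ∀ η : SO2, ∫ φ in (0 : ℝ)..2 * Real.pi, g (rotate (η⁻¹ * SO2.ofAngle φ) v) =
      ∫ φ in (0 : ℝ)..2 * Real.pi, g (‖v‖ • unitVector φ) := by
    intro η
    obtain ⟨δ, hδ⟩ := SO2.exists_eq_ofAngle η⁻¹
    have e : ∀ φ, g (rotate (η⁻¹ * SO2.ofAngle φ) v) = g (‖v‖ • unitVector (φ + (δ + β))) := by
      intro φ
      conv_lhs => rw [hβ]
      rw [hδ, ← rotateIsometry_apply, map_smul, rotateIsometry_apply, rotate_mul,
        rotate_ofAngle_unitVector, rotate_ofAngle_unitVector]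
      congr 3
      ring
    simp only [e]
    have hp : Function.Periodic (fun φ => g (‖v‖ • unitVector φ)) (2 * Real.pi) := fun φ => by
      simp [unitVector]
    rw [intervalIntegral.integral_comp_add_right (fun φ => g (‖v‖ • unitVector φ)), zero_add,
      add_comm (2 * Real.pi), hp.intervalIntegral_add_eq _ 0, zero_add]
  have hcont : Continuous fun p : ℝ × SO2 => g (rotate (p.2⁻¹ * SO2.ofAngle p.1) v) :=
    hg.comp (((SO2.continuous_inv.comp continuous_snd).mul
      (SO2.continuous_ofAngle.comp continuous_fst)).rotate continuous_const)
  obtain ⟨M, hM⟩ := (isCompact_sphere (0 : Plane) ‖v‖).exists_bound_of_continuousOn hg.continuousOn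
  have hint : Integrable (fun p : ℝ × SO2 => g (rotate (p.2⁻¹ * SO2.ofAngle p.1) v))
      ((volume.restrict (uIoc 0 (2 * Real.pi))).prod μ) := by
    have : IsFiniteMeasure (volume.restrict (uIoc 0 (2 * Real.pi))) := by
      rw [uIoc_of_le (by positivity)]; infer_instance
    refine Integrable.of_bound hcont.measurable.aestronglyMeasurable M
      (Eventually.of_forall fun p => hM _ ?_)
    rw [mem_sphere_zero_iff_norm, norm_rotate]
  have h := intervalIntegral_integral_swap
    (f := fun φ η => g (rotate (η⁻¹ * SO2.ofAngle φ) v)) hint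
  simp only [hinv, hin] at h
  rw [intervalIntegral.integral_const, integral_const, sub_zero, smul_eq_mul, probReal_univ,
    one_smul] at h
  rw [← h]
  field_simp

theorem measurableSet_unitSquare : MeasurableSet unitSquare := by
  have : unitSquare = ⋂ i : Fin 2, (fun ξ : Plane => ξ i) ⁻¹' Icc 0 1 := by
    ext; simp [unitSquare]
  rw [this]
  exact MeasurableSet.iInter fun i => measurableSet_Icc.preimage (by fun_prop)

theorem volume_unitSquare_lt_top : volume unitSquare < ⊤ := by
  refine Bornology.IsBounded.measure_lt_top (Metric.isBounded_closedBall.subset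
    (t := Metric.closedBall (0 : Plane) 2) fun ξ hξ => ?_)
  rw [mem_closedBall_zero_iff, ← sq_le_sq₀ (norm_nonneg _) (by norm_num), norm_sq_plane]
  nlinarith [(hξ 0).1, (hξ 0).2, (hξ 1).1, (hξ 1).2]

/-! ### Lattice sums of bounded functions of bounded support under random rigid motions. -/

section BoundedSupport

variable {F : Plane → ℝ} {M A : ℝ}

theorem integrable_of_bounded_support (hF : Measurable F) (hM : ∀ x, |F x| ≤ M)
    (hA : ∀ x, A < ‖x‖ → F x = 0) : Integrable F := by
  have hsupp : Function.support F ⊆ Metric.closedBall (0 : Plane) A := fun x hx => by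
    rw [mem_closedBall_zero_iff]
    by_contra hcon
    exact hx (hA _ (not_le.1 hcon))
  rw [← integrableOn_iff_integrable_of_support_subset hsupp]
  exact Measure.integrableOn_of_bounded (M := M) measure_closedBall_lt_top.ne
    hF.aestronglyMeasurable (Eventually.of_forall hM)

/-- The power spectrum of a function on the plane. -/
def powerSpectrum (F : Plane → ℝ) (v : Plane) : ℝ :=
  ‖∫ x : Plane, (F x : ℂ) * osc (inner ℝ v x)‖ ^ 2

theorem continuous_powerSpectrum (hF : Integrable F) : Continuous (powerSpectrum F) := by
  refine Continuous.pow (continuous_norm.comp (continuous_of_dominated (bound := fun x => ‖F x‖)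
    (fun v => ?_) (fun v => Eventually.of_forall fun x => ?_) hF.norm
    (Eventually.of_forall fun x => ?_))) 2
  · have h2 : Measurable fun x : Plane => osc (inner ℝ v x) :=
      measurable_osc.comp (continuous_const.inner continuous_id).measurable
    exact (Complex.continuous_ofReal.comp_aestronglyMeasurable hF.aestronglyMeasurable).mul
      h2.aestronglyMeasurable
  · rw [norm_mul, norm_osc, mul_one, Complex.norm_real]
  · exact continuous_const.mul (continuous_osc.comp (continuous_id.inner continuous_const))

theorem powerSpectrum_comp_rotate (F : Plane → ℝ) (η : SO2) (v : Plane) :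
    powerSpectrum (fun x => F (rotate η⁻¹ x)) v = powerSpectrum F (rotate η⁻¹ v) := by
  rw [powerSpectrum, ← (rotateIsometry η).measurePreserving.integral_comp
    (rotateIsometry η).toHomeomorph.measurableEmbedding, powerSpectrum]
  simp only [rotateIsometry_apply, rotate_inv_rotate]
  congr 3
  funext x
  rw [← inner_rotate η (rotate η⁻¹ v), rotate_rotate_inv]

theorem powerSpectrum_smul_unitVector (F : Plane → ℝ) (R φ : ℝ) :
    powerSpectrum F (R • unitVector φ) =
      ‖∫ x : Plane, (F x : ℂ) * osc (R * (Real.cos φ * x 0 + Real.sin φ * x 1))‖ ^ 2 := by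
  rw [powerSpectrum]
  congr 3
  funext x
  rw [real_inner_smul_left, inner_plane]
  rfl

theorem integrable_sq_latticeSum_rotate [MeasurableSpace SO2] [BorelSpace SO2] (μ : Measure SO2)
    [IsProbabilityMeasure μ] (hF : Measurable F) (hM : ∀ x, |F x| ≤ M)
    (hA : ∀ x, A < ‖x‖ → F x = 0) {h : ℝ} (hh : 0 < h) (c : ℝ) :
    Integrable (fun p : Plane × SO2 =>
      |h ^ 2 * ∑' w, F (rotate p.2⁻¹ (latticePoint h w - h • p.1)) - c| ^ 2)
      ((volume.restrict unitSquare).prod μ) := by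
  obtain ⟨W, hW⟩ := exists_finset_lattice hh A
  have : IsFiniteMeasure (volume.restrict unitSquare) :=
    ⟨by rw [Measure.restrict_apply_univ]; exact volume_unitSquare_lt_top⟩
  have hrot : ∀ w, Measurable fun p : Plane × SO2 => rotate p.2⁻¹ (latticePoint h w - h • p.1) :=
    fun w => ((SO2.continuous_inv.comp continuous_snd).rotate (by fun_prop)).measurable
  have hg : Integrable (fun p : Plane × SO2 =>
      |h ^ 2 * ∑ w ∈ W, F (rotate p.2⁻¹ (latticePoint h w - h • p.1)) - c| ^ 2)
      ((volume.restrict unitSquare).prod μ) := by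
    refine Integrable.of_bound (Measurable.aestronglyMeasurable ?_)
      ((h ^ 2 * (W.card • M) + |c|) ^ 2) (Eventually.of_forall fun p => ?_)
    · have hs : Measurable fun p : Plane × SO2 =>
          ∑ w ∈ W, F (rotate p.2⁻¹ (latticePoint h w - h • p.1)) :=
        Finset.measurable_sum _ fun w _ => hF.comp (hrot w)
      exact ((hs.const_mul (h ^ 2)).sub_const c).norm.pow_const 2
    · rw [Real.norm_of_nonneg (sq_nonneg _)]
      refine pow_le_pow_left₀ (abs_nonneg _) ((abs_sub _ _).trans ?_) 2
      rw [abs_mul, abs_of_pos (by positivity : 0 < h ^ 2)]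
      gcongr
      exact (Finset.abs_sum_le_sum_abs _ _).trans (Finset.sum_le_card_nsmul _ _ _ fun w _ => hM _)
  refine hg.congr ?_
  have hmem : ∀ᵐ p ∂(volume.restrict unitSquare).prod μ, p.1 ∈ unitSquare :=
    Measure.quasiMeasurePreserving_fst.ae (ae_restrict_mem measurableSet_unitSquare)
  filter_upwards [hmem] with p hp
  rw [tsum_eq_sum (s := W) fun w hw => hA _ (by rw [norm_rotate]; exact hW _ hp w hw)]

/-- The mean square error of the lattice sums of a function under random rigid motions, in terms of
the circular means of its power spectrum. -/
theorem integral_sq_latticeSum_rotate_le [MeasurableSpace SO2] [BorelSpace SO2] (μ : Measure SO2)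
    [μ.IsHaarMeasure] [IsProbabilityMeasure μ] (hF : Measurable F) (hM : ∀ x, |F x| ≤ M)
    (hA : ∀ x, A < ‖x‖ → F x = 0) {h : ℝ} (hh : 0 < h) {B : (Fin 2 → ℤ) → ℝ} (hB : Summable B)
    (hB0 : 0 ≤ B 0)
    (hle : ∀ k ≠ 0, ∫ φ in (0 : ℝ)..2 * Real.pi, powerSpectrum F
      ((2 * Real.pi / h * ‖latticePoint 1 k‖) • unitVector φ) ≤ B k) :
    ∫ ξ in unitSquare, ∫ η,
      |h ^ 2 * ∑' w, F (rotate η⁻¹ (latticePoint h w - h • ξ)) - ∫ x, F x| ^ 2 ∂μ ≤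
      ∑' k, B k := by
  have hpi := Real.pi_pos
  have hpi1 : (2 * Real.pi)⁻¹ ≤ 1 := inv_le_one_of_one_le₀ (by linarith [Real.pi_gt_three])
  have hps := continuous_powerSpectrum (integrable_of_bounded_support hF hM hA)
  let K : (Fin 2 → ℤ) → SO2 → ℝ := fun k η =>
    if k = 0 then 0 else powerSpectrum F (rotate η⁻¹ ((2 * Real.pi / h) • latticePoint 1 k))
  have hK0 : ∀ k η, 0 ≤ K k η := fun k η => by
    simp only [K]; split_ifs; exacts [le_rfl, sq_nonneg _]
  have hsum : ∀ η, ∫ ξ in unitSquare,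
      |h ^ 2 * ∑' w, F (rotate η⁻¹ (latticePoint h w - h • ξ)) - ∫ x, F x| ^ 2 =
      ∑' k, K k η := by
    intro η
    have hFη : Measurable fun x => F (rotate η⁻¹ x) :=
      hF.comp (rotateIsometry η⁻¹).continuous.measurable
    have hs := hasSum_sq_latticeSum hFη (fun x => hM _)
      (fun x hx => hA _ (by rwa [norm_rotate])) hh
    have hi : ∫ x, F (rotate η⁻¹ x) = ∫ x, F x :=
      (rotateIsometry η⁻¹).measurePreserving.integral_comp
        (rotateIsometry η⁻¹).toHomeomorph.measurableEmbedding F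
    rw [hi] at hs
    rw [← hs.tsum_eq]
    congr 1
    funext k
    simp only [K]
    refine if_congr Iff.rfl rfl ?_
    rw [← powerSpectrum_comp_rotate, powerSpectrum]
    congr 3
    funext x
    rw [real_inner_smul_left, inner_plane]
    simp [latticePoint]
  have hKm : ∀ k, ∫ η, K k η ∂μ ≤ B k := by
    intro k
    simp only [K]
    split_ifs with hk
    · simpa [hk] using hB0
    · rw [integral_rotate_inv μ hps]
      refine le_trans ?_ (hle k hk)
      rw [norm_smul, Real.norm_of_nonneg (by positivity)]
      refine mul_le_of_le_one_left (intervalIntegral.integral_nonneg (by positivity)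
        fun φ _ => sq_nonneg _) hpi1
  have hKi : ∀ k, Integrable (K k) μ := by
    intro k
    by_cases hk : k = 0
    · simp [K, hk]
    · have e : K k = fun η => powerSpectrum F
          (rotate η⁻¹ ((2 * Real.pi / h) • latticePoint 1 k)) := by
        funext η; simp [K, hk]
      obtain ⟨C, hC⟩ := (isCompact_sphere (0 : Plane)
        ‖(2 * Real.pi / h) • latticePoint 1 k‖).exists_bound_of_continuousOn hps.continuousOn
      rw [e]
      refine Integrable.of_bound ((hps.comp (SO2.continuous_inv.rotate
        continuous_const)).measurable.aestronglyMeasurable) C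
        (Eventually.of_forall fun η => hC _ ?_)
      rw [mem_sphere_zero_iff_norm, norm_rotate]
  have hKn : ∀ k, ∫ η, ‖K k η‖ ∂μ = ∫ η, K k η ∂μ := fun k => by
    simp only [Real.norm_of_nonneg (hK0 _ _)]
  have hKs : Summable fun k => ∫ η, K k η ∂μ :=
    hB.of_nonneg_of_le (fun k => integral_nonneg (hK0 k)) hKm
  -- The terms are nonnegative, so summability of their integrals, which the majorant B gives,
  -- permits termwise integration over the rotations.
  have htot := hasSum_integral_of_summable_integral_norm hKi (by simpa only [hKn] using hKs)
  have hswap := integral_integral_swap (f := fun (ξ : Plane) (η : SO2) =>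
    |h ^ 2 * ∑' w, F (rotate η⁻¹ (latticePoint h w - h • ξ)) - ∫ x, F x| ^ 2)
    (μ := volume.restrict unitSquare) (ν := μ)
    (integrable_sq_latticeSum_rotate μ hF hM hA hh (∫ x, F x))
  rw [hswap]
  simp only [hsum]
  rw [← htot.tsum_eq]
  exact hKs.tsum_le_tsum hKm hB

end BoundedSupport

/-! ### Summation over the dual lattice. -/

theorem norm_le_norm_latticePoint (k : Fin 2 → ℤ) : ‖k‖ ≤ ‖latticePoint 1 k‖ := by
  refine (pi_norm_le_iff_of_nonneg (norm_nonneg _)).2 fun i => ?_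
  have h := PiLp.norm_apply_le (latticePoint 1 k) i
  refine le_trans (le_of_eq ?_) h
  fin_cases i <;> simp [latticePoint, Int.norm_eq_abs]

theorem one_le_norm_int {k : Fin 2 → ℤ} (hk : k ≠ 0) : 1 ≤ ‖k‖ := by
  obtain ⟨i, hi⟩ := Function.ne_iff.1 hk
  refine le_trans ?_ (norm_le_pi_norm k i)
  rw [Int.norm_eq_abs]
  exact_mod_cast Int.one_le_abs hi

namespace IsConvexClosedCurve

variable {γ : ℝ → Plane} {T : ℝ} (hγ : IsConvexClosedCurve γ T)

include hγ

/-- The mean square error for a fixed lattice width `h` and tube width `ε`. -/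
theorem exists_meanSquare_le {f : Plane → ℝ} (hf : ContDiff ℝ ∞ fun t => f (γ t)) {q : ℕ}
    {θ : ℝ → ℝ} (hθ : IsWeight q θ) {ρ : ℝ} (hρ : IsTubeWidth γ ρ) [MeasurableSpace SO2]
    [BorelSpace SO2] (μ : Measure SO2) [μ.IsHaarMeasure] [IsProbabilityMeasure μ] :
    ∃ C, ∀ h ∈ Ioc (0 : ℝ) 1, ∀ ε ∈ Ioc 0 ρ,
      ∫ ξ in unitSquare, ∫ η, |ibimMoved γ f θ ε h η ξ - boundaryIntegral γ T f| ^ 2 ∂μ ≤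
        C * (h * (h / ε) ^ (2 * (q + 1))) := by
  obtain ⟨Mθ, hMθ0, hMθ⟩ := hθ.exists_bound
  obtain ⟨w₀, hw₀, hw⟩ := hγ.exists_speed_bound hρ.2.2
  have hper : Function.Periodic (fun t => f (γ t) * ‖deriv γ t‖) T := fun t => by
    simp only [hγ.periodic t, hγ.periodic.deriv_periodic t]
  obtain ⟨C, hC0, hC⟩ := hγ.framedCurve.exists_integral_sq_tubeFourier_le
    (hf.mul hγ.contDiff_speed) hper hρ.1 hw₀ hw hθ
  -- The exponent is at least 3, above the threshold 2 for summability over ℤ². The norm of k in the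
  -- sum is the sup norm, which is at most the Euclidean one.
  have hs : (2 : ℝ) < 1 + 2 * (q + 1 : ℕ) := by
    push_cast; linarith [(Nat.cast_nonneg q : (0 : ℝ) ≤ q)]
  refine ⟨C * ∑' k : Fin 2 → ℤ, ‖k‖ ^ (-(1 + 2 * (q + 1 : ℕ) : ℝ)), fun h hh ε hε => ?_⟩
  have hh0 := hh.1
  have hε0 := hε.1
  obtain ⟨M, A, hM, hA⟩ := hγ.exists_bound_tubeFunction hρ hε0 hε.2 hf.continuous hMθ0 hMθ
  have hFm := hγ.measurable_tubeFunction hρ hε.2 hf.continuous hθ.measurable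
  have key := integral_sq_latticeSum_rotate_le μ hFm hM hA hh0
    (B := fun k => C * (h * (h / ε) ^ (2 * (q + 1))) * ‖k‖ ^ (-(1 + 2 * (q + 1 : ℕ) : ℝ)))
    ((EisensteinSeries.summable_one_div_norm_rpow hs).mul_left _) (by positivity) ?_
  · rw [hγ.integral_tubeFunction hρ hε0 hε.2 hf.continuous hθ, tsum_mul_left] at key
    simp only [hγ.ibimMoved_eq]
    refine key.trans (le_of_eq ?_)
    ring
  · intro k hk
    have hk1 := one_le_norm_int hk
    have hk2 := norm_le_norm_latticePoint k
    have hk0 : 0 < ‖k‖ := by linarith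
    have hR : ‖k‖ / h ≤ 2 * Real.pi / h * ‖latticePoint 1 k‖ := by
      rw [div_mul_eq_mul_div]
      gcongr
      nlinarith [Real.pi_gt_three]
    -- The circular estimate needs frequency at least 1, which holds because h ≤ 1 and a nonzero
    -- integer vector has norm at least 1.
    have hR1 : 1 ≤ ‖k‖ / h := by
      rw [one_le_div hh0]
      exact hh.2.trans hk1
    simp only [powerSpectrum_smul_unitVector,
      hγ.integral_tubeFunction_mul_osc hρ hε0 hε.2 hf.continuous hθ.measurable hMθ]
    refine (hC ε hε _ (hR1.trans hR)).trans ?_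
    have hb : 0 < ‖k‖ / h * (‖k‖ / h * ε) ^ (2 * (q + 1)) := by positivity
    calc C / (2 * Real.pi / h * ‖latticePoint 1 k‖ *
          (2 * Real.pi / h * ‖latticePoint 1 k‖ * ε) ^ (2 * (q + 1)))
        ≤ C / (‖k‖ / h * (‖k‖ / h * ε) ^ (2 * (q + 1))) := by gcongr
      _ = C * (h * (h / ε) ^ (2 * (q + 1))) * ‖k‖ ^ (-(1 + 2 * (q + 1 : ℕ) : ℝ)) := by
          have e : (1 + 2 * (q + 1 : ℕ) : ℝ) = ((1 + 2 * (q + 1) : ℕ) : ℝ) := by push_cast; ring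
          rw [e, Real.rpow_neg hk0.le, Real.rpow_natCast, pow_add, pow_one, mul_pow, div_pow,
            div_pow]
          field_simp

end IsConvexClosedCurve

end

/-- Mean square error of the implicit boundary integral method under random rigid motions, for a
convex closed smooth curve with finitely many points of vanishing curvature. The mean over the
rotations is bounded without regard to the flat points, so the order of vanishing plays no role. -/
theorem theorem3p1
    (γ : ℝ → Plane) (T : ℝ) (hγ : IsConvexClosedCurve γ T)
    (k : ℝ) (hk : 2 < k)
    (hfin : {z : Plane | ∃ t, γ t = z ∧ curvature γ t = 0}.Finite)
    (hflat : ∀ t, curvature γ t = 0 →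
      ∃ m : ℝ, m ≤ k - 2 ∧ CurvatureVanishesToOrder (range γ) (γ t) m)
    (f : Plane → ℝ) (hf : ContDiff ℝ ∞ (fun t => f (γ t)))
    (q : ℕ) (θ : ℝ → ℝ) (hθ : IsWeight q θ)
    (α : ℝ) (hα : α ∈ Icc (0 : ℝ) 1)
    (ε : ℝ → ℝ) (hε : ε =Θ[𝓝[>] 0] fun h : ℝ => h ^ α)
    (ρ : ℝ) (hρ : IsTubeWidth γ ρ) (hερ : ∀ᶠ h in 𝓝[>] (0 : ℝ), 0 < ε h ∧ ε h ≤ ρ)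
    [MeasurableSpace SO2] [BorelSpace SO2]
    (μ : Measure SO2) [μ.IsHaarMeasure] [IsProbabilityMeasure μ] :
    (∀ᶠ h in 𝓝[>] (0 : ℝ),
      Integrable
        (fun p : Plane × SO2 =>
          |ibimMoved γ f θ (ε h) h p.2 p.1 - boundaryIntegral γ T f| ^ 2)
        ((volume.restrict unitSquare).prod μ)) ∧
    (fun h : ℝ => ∫ ξ in unitSquare, ∫ η,
        |ibimMoved γ f θ (ε h) h η ξ - boundaryIntegral γ T f| ^ 2 ∂μ)
      =O[𝓝[>] 0] fun h : ℝ => h ^ (1 + 2 * ((q : ℝ) + 1) * (1 - α)) := by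
  have hpos : ∀ᶠ h in 𝓝[>] (0 : ℝ), h ∈ Ioc (0 : ℝ) 1 := Ioc_mem_nhdsGT one_pos
  constructor
  · obtain ⟨Mθ, hMθ0, hMθ⟩ := hθ.exists_bound
    filter_upwards [hpos, hερ] with h hh hεh
    obtain ⟨M, A, hM, hA⟩ :=
      hγ.exists_bound_tubeFunction hρ hεh.1 hεh.2 hf.continuous hMθ0 hMθ
    simp only [hγ.ibimMoved_eq]
    exact integrable_sq_latticeSum_rotate μ
      (hγ.measurable_tubeFunction hρ hεh.2 hf.continuous hθ.measurable) hM hA hh.1 _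
  · obtain ⟨C, hC⟩ := hγ.exists_meanSquare_le hf hθ hρ μ
    -- The lower bound on the tube width, h^α ≤ cε, is what bounds h/ε from above.
    obtain ⟨c, hc, hcε⟩ := hε.2.exists_pos
    refine IsBigO.of_bound (|C| * c ^ (2 * (q + 1))) ?_
    filter_upwards [hpos, hερ, hcε.bound] with h hh hεh hch
    have hh0 := hh.1
    have hα0 : 0 < h ^ α := Real.rpow_pos_of_pos hh0 α
    rw [Real.norm_of_nonneg hα0.le, Real.norm_of_nonneg hεh.1.le] at hch
    rw [Real.norm_of_nonneg (integral_nonneg fun ξ => integral_nonneg fun η => sq_nonneg _),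
      Real.norm_of_nonneg (Real.rpow_nonneg hh0.le _)]
    have hquot : h / ε h ≤ c * h ^ (1 - α) := by
      rw [div_le_iff₀ hεh.1, Real.rpow_sub hh0, Real.rpow_one]
      have : h = h / h ^ α * h ^ α := by field_simp
      calc h = h / h ^ α * h ^ α := this
        _ ≤ h / h ^ α * (c * ε h) := by gcongr
        _ = _ := by ring
    have hexp : h ^ (1 + 2 * ((q : ℝ) + 1) * (1 - α)) =
        h * (h ^ (1 - α)) ^ (2 * (q + 1)) := by
      rw [Real.rpow_add hh0, Real.rpow_one, ← Real.rpow_natCast (h ^ (1 - α)),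
        ← Real.rpow_mul hh0.le]
      congr 2
      push_cast
      ring
    calc _ ≤ C * (h * (h / ε h) ^ (2 * (q + 1))) := hC h hh (ε h) hεh
      _ ≤ |C| * (h * (c * h ^ (1 - α)) ^ (2 * (q + 1))) := by
          have h0 : 0 ≤ h / ε h := (div_pos hh0 hεh.1).le
          gcongr
          exact le_abs_self C
      _ = _ := by rw [hexp, mul_pow]; ring
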